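/- Let $\Omega=(l,r)$ be a bounded open interval, $T>0$, $\varepsilon>0$, $f,A\in C^2(\mathbb R)$ with $A\ge 1$, and let $g_D\in W^{1,\infty}((0,T)\times\partial\Omega)$. Let $u\in L^2(0,T;H^1(\Omega))\cap L^\infty((0,T)\times\Omega)$ be an entropy solution of $$\partial_t u+\partial_x f(u)=\varepsilon\,\partial_x(A(u)\partial_x u)\quad\text{in }(0,T)\times\Omega$$ with initial data $u_0\in H^1(\Omega)$ and boundary values $u=g_D$ on $(0,T)\times\partial\Omega$ (in the sense of traces), with respect to $\eta(v)=\tfrac12v^2$, $q(v)=\int_0^v wf'(w)\,dw$. That is, for all $\varphi\in C_0^\infty([0,T)\times\Omega)$, $$\int_0^T\!\!\int_\Omega \partial_t\varphi\,u+\partial_x\varphi\,\big(f(u)-\varepsilon A(u)\partial_xu\big)\,dx\,dt+\int_\Omega u_0\,\varphi(0,\cdot)\,dx=0,$$ and for all $\Phi\in C_0^\infty([0,T)\times\Omega)$ with $\Phi\ge0$, $$\int_0^T\!\!\int_\Omega \partial_t\Phi\,\eta(u)+\partial_x\Phi\,\big(q(u)-\varepsilon\, uA(u)\partial_xu\big)-\varepsilon\,\Phi\,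 A(u)(\partial_xu)^2\,dx\,dt+\int_\Omega \Phi(0,\cdot)\,\eta(u_0)\,dx\ge 0.$$ Let $r_1\in L^1(0,T;L^2(\Omega))$ and $r_2\in L^2(0,T;H^{-1}(\Omega))$, where $H^{-1}(\Omega)$ is the dual of $H^1_0(\Omega)$ normed by $\|\partial_x\cdot\|_{L^2(\Omega)}$. Let $\hat u\in W^{1,\infty}((0,T)\times\Omega)$ be a Lipschitz weak solution of $$\partial_t\hat u+\partial_xf(\hat u)=\varepsilon\,\partial_x(A(\hat u)\partial_x\hat u)+r_1+\varepsilon r_2$$ with initial data $\hat u_0\in W^{1,\infty}(\Omega)$ and the same boundary data $g_D$. Let $a,b$ be real numbers with $a\le\min\{\operatorname{ess\,inf}u,\operatorname{ess\,inf}\hat u\}$ and $b\ge\max\{\operatorname{ess\,sup}u,\operatorname{ess\,sup}\hat u\}$, the essential bounds being taken over $(0,T)\times\Omega$ (for instance with equality in both), and set $$K[\hat u]=\Big(\varepsilon\,\|\partial_x\hat u\|_{L^\infty((0,T)\times\Omega)}\sup_{v\in[a,b]}|A'(v)|^2+\sup_{v\in[a,b]}|f''(v)|\Big)\|\partial_x\hat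 u\|_{L^\infty((0,T)\times\Omega)}.$$ Then for almost every $t\in(0,T)$, $$\|u-\hat u\|_{L^\infty(0,t;L^2(\Omega))}^2+2\varepsilon\,\|\partial_xu-\partial_x\hat u\|_{L^2((0,t)\times\Omega)}^2\le\Big(4\|u_0-\hat u_0\|_{L^2(\Omega)}^2+16\|r_1\|_{L^1(0,t;L^2(\Omega))}^2+8\varepsilon\|r_2\|_{L^2(0,t;H^{-1}(\Omega))}^2\Big)e^{8K[\hat u]t}.$$ -/

import Mathlib

open MeasureTheory Set TopologicalSpace
open scoped ENNReal NNReal Distributions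

noncomputable section

namespace ConvDiff

/-! Points of space-time are pairs `p = (t, x)`. The spatial domain is `Ω = (l, r)`. -/

/-- The spatial domain `Ω = (l, r)`. -/
def Om (l r : ℝ) : Opens ℝ := ⟨Ioo l r, isOpen_Ioo⟩

/-- The space-time cylinder `(0, T) × Ω`. -/
def Cyl (T l r : ℝ) : Opens (ℝ × ℝ) := ⟨Ioo 0 T ×ˢ Ioo l r, isOpen_Ioo.prod isOpen_Ioo⟩

/-- The open set `(-∞, T) × Ω`. The restrictions to `t ≥ 0` of the test functions on it are the
elements of `C_0^∞([0, T) × Ω)`: they vanish near `t = T` and near `∂Ω`, but not at `t = 0`. -/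
def CylInit (T l r : ℝ) : Opens (ℝ × ℝ) := ⟨Iio T ×ˢ Ioo l r, isOpen_Iio.prod isOpen_Ioo⟩

/-- Lebesgue measure on `Ω`. -/
abbrev volOm (l r : ℝ) : Measure ℝ := volume.restrict (Ioo l r)

/-- Lebesgue measure on `(0, T) × Ω`. -/
abbrev volCyl (T l r : ℝ) : Measure (ℝ × ℝ) := volume.restrict (Ioo 0 T ×ˢ Ioo l r)

/-- Classical partial derivative in time. -/
def dt (φ : ℝ × ℝ → ℝ) (p : ℝ × ℝ) : ℝ := deriv (fun s => φ (s, p.2)) p.1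

/-- Classical partial derivative in space. -/
def dx (φ : ℝ × ℝ → ℝ) (p : ℝ × ℝ) : ℝ := deriv (fun y => φ (p.1, y)) p.2

/-- The slice `φ(t, ·) ∈ C_0^∞(Ω)` of a test function `φ` on `(-∞, T) × Ω`. -/
def slice {T l r : ℝ} (φ : 𝓓(CylInit T l r, ℝ)) (t : ℝ) : 𝓓(Om l r, ℝ) where
  toFun x := φ (t, x)
  contDiff' := φ.contDiff.comp (contDiff_const.prodMk contDiff_id)
  hasCompactSupport' :=
    φ.hasCompactSupport.comp_isClosedEmbedding
      (Topology.IsClosedEmbedding.of_continuous_injective_isClosedMap (by fun_prop)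
        (fun _ _ h => (Prod.mk.inj h).2) (isClosedMap_prodMk_left t))
  tsupport_subset' := by
    have h : tsupport (fun x => φ (t, x)) ⊆ (fun x : ℝ => (t, x)) ⁻¹' tsupport φ :=
      tsupport_comp_subset_preimage φ (by fun_prop)
    intro x hx
    exact (φ.tsupport_subset (h hx)).2

/-! ### Sobolev spaces -/

/-- `v ∈ H¹(Ω)`. -/
def MemH1 (l r : ℝ) (v : ℝ → ℝ) : Prop :=
  MemLp v 2 (volOm l r) ∧ ∃ g : ℝ → ℝ, MemLp g 2 (volOm l r) ∧
    ∀ φ : 𝓓(Om l r, ℝ), ∫ x in Ioo l r, v x * deriv φ x = -∫ x in Ioo l r, g x * φ x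

/-- `g` is the weak derivative `∂ₓ v` on `(0, T) × Ω`. -/
def HasWeakDx (T l r : ℝ) (v g : ℝ × ℝ → ℝ) : Prop :=
  LocallyIntegrableOn v (Ioo 0 T ×ˢ Ioo l r) ∧ LocallyIntegrableOn g (Ioo 0 T ×ˢ Ioo l r) ∧
    ∀ φ : 𝓓(Cyl T l r, ℝ),
      ∫ p in Ioo 0 T ×ˢ Ioo l r, v p * dx φ p = -∫ p in Ioo 0 T ×ˢ Ioo l r, g p * φ p

/-- `v ∈ L²(0, T; H¹(Ω))` with weak spatial derivative `∂ₓ v = g`. -/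
def MemL2H1 (T l r : ℝ) (v g : ℝ × ℝ → ℝ) : Prop :=
  MemLp v 2 (volCyl T l r) ∧ MemLp g 2 (volCyl T l r) ∧ HasWeakDx T l r v g

/-- The function `v ∈ H¹(Ω)` has the boundary traces `cl` at `l` and `cr` at `r`: its continuous
representative on `[l, r]` takes these values. -/
def HasTraces (l r : ℝ) (v : ℝ → ℝ) (cl cr : ℝ) : Prop :=
  ∃ w : ℝ → ℝ, ContinuousOn w (Icc l r) ∧ v =ᵐ[volOm l r] w ∧ w l = cl ∧ w r = cr

/-- The norm of `F` in `H⁻¹(Ω)`, the dual of `H¹₀(Ω)` normed by `‖∂ₓ ·‖_{L²(Ω)}`, as the supremum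
over the dense subspace `C_0^∞(Ω)`; a distribution is in `H⁻¹(Ω)` iff this is finite. -/
def normHm1 {l r : ℝ} (F : 𝓓'(Om l r, ℝ)) : ℝ≥0∞ :=
  ⨆ (φ : 𝓓(Om l r, ℝ)) (_ : eLpNorm (deriv φ) 2 (volOm l r) ≤ 1), ‖F φ‖ₑ

/-- The norm in `L²(0, t; H⁻¹(Ω))`. -/
def normL2Hm1 {l r : ℝ} (t : ℝ) (F : ℝ → 𝓓'(Om l r, ℝ)) : ℝ≥0∞ :=
  (∫⁻ s in Ioo 0 t, normHm1 (F s) ^ 2) ^ (1 / 2 : ℝ)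

/-- `F ∈ L²(0, T; H⁻¹(Ω))`. -/
def MemL2Hm1 {l r : ℝ} (T : ℝ) (F : ℝ → 𝓓'(Om l r, ℝ)) : Prop :=
  (∀ φ : 𝓓(Om l r, ℝ), AEStronglyMeasurable (fun t => F t φ) (volume.restrict (Ioo 0 T))) ∧
    AEMeasurable (fun t => normHm1 (F t)) (volume.restrict (Ioo 0 T)) ∧ normL2Hm1 T F < ∞

/-- The norm in `L¹(0, t; L²(Ω))`. -/
def normL1L2 (t l r : ℝ) (v : ℝ × ℝ → ℝ) : ℝ≥0∞ :=
  ∫⁻ s in Ioo 0 t, eLpNorm (fun x => v (s, x)) 2 (volOm l r)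

/-- `v ∈ L¹(0, T; L²(Ω))`. -/
def MemL1L2 (T l r : ℝ) (v : ℝ × ℝ → ℝ) : Prop :=
  AEStronglyMeasurable v (volCyl T l r) ∧ normL1L2 T l r v < ∞

/-- The norm in `L^∞(0, t; L²(Ω))`. -/
def normLinfL2 (t l r : ℝ) (v : ℝ × ℝ → ℝ) : ℝ≥0∞ :=
  essSup (fun s => eLpNorm (fun x => v (s, x)) 2 (volOm l r)) (volume.restrict (Ioo 0 t))

/-! ### Solutions -/

/-- `u`, with weak spatial derivative `ux`, is a weak solution of
`∂ₜ u + ∂ₓ f(u) = ε ∂ₓ (A(u) ∂ₓ u)` on `(0, T) × Ω` with initial data `u₀`. -/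
structure IsWeakSolution (T l r ε : ℝ) (f A : ℝ → ℝ) (u₀ : ℝ → ℝ) (u ux : ℝ × ℝ → ℝ) : Prop where
  bounded : MemLp u ∞ (volCyl T l r)
  hasWeakDx : HasWeakDx T l r u ux
  integrable_flux : Integrable (fun p => ε * (A (u p) * ux p)) (volCyl T l r)
  weak_eq : ∀ φ : 𝓓(CylInit T l r, ℝ),
    (∫ p in Ioo 0 T ×ˢ Ioo l r, dt φ p * u p + dx φ p * (f (u p) - ε * (A (u p) * ux p)))
      + ∫ x in Ioo l r, u₀ x * φ (0, x) = 0

/-- A weak solution is an entropy solution for the entropy/entropy-flux pair `(η, q)` if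
`∂ₜ η(u) + ∂ₓ (q(u) - ε η'(u) A(u) ∂ₓ u) ≤ -ε ∂ₓ(η'(u)) A(u) ∂ₓ u` holds weakly, with the initial
data `η(u₀)`; here `∂ₓ(η'(u)) = η''(u) ∂ₓ u`. -/
structure IsEntropySolution (T l r ε : ℝ) (f A η q : ℝ → ℝ) (u₀ : ℝ → ℝ) (u ux : ℝ × ℝ → ℝ) : Prop
    extends IsWeakSolution T l r ε f A u₀ u ux where
  integrable_dissipation : Integrable
    (fun p => ε * ((deriv (deriv η) (u p) * ux p) * (A (u p) * ux p))) (volCyl T l r)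
  entropy_ineq : ∀ φ : 𝓓(CylInit T l r, ℝ), (∀ p : ℝ × ℝ, 0 ≤ p.1 → 0 ≤ φ p) →
    0 ≤ (∫ p in Ioo 0 T ×ˢ Ioo l r,
          dt φ p * η (u p)
            + dx φ p * (q (u p) - ε * (deriv η (u p) * (A (u p) * ux p)))
            - ε * (φ p * ((deriv (deriv η) (u p) * ux p) * (A (u p) * ux p))))
        + ∫ x in Ioo l r, φ (0, x) * η (u₀ x)

/-- The quadratic entropy. -/
def quadEntropy (v : ℝ) : ℝ := v ^ 2 / 2

/-- The entropy flux of the quadratic entropy, `q(v) = ∫₀ᵛ w f'(w) dw`. -/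
def quadFlux (f : ℝ → ℝ) (v : ℝ) : ℝ := ∫ w in (0 : ℝ)..v, w * deriv f w

/-- `v ∈ W^{1,∞}((0, T) × Ω)` (identified with its Lipschitz extension to the closed cylinder, so
that `∂ₓ v` is the classical derivative, which exists almost everywhere) is a weak solution of
`∂ₜ v + ∂ₓ f(v) = ε ∂ₓ (A(v) ∂ₓ v) + r₁ + ε r₂` with initial data `v₀`. -/
structure IsLipschitzPerturbedSolution (T l r ε : ℝ) (f A : ℝ → ℝ) (r₁ : ℝ × ℝ → ℝ)
    (r₂ : ℝ → 𝓓'(Om l r, ℝ)) (v₀ : ℝ → ℝ) (v : ℝ × ℝ → ℝ) : Prop where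
  lipschitz : ∃ C : ℝ≥0, LipschitzOnWith C v (Icc 0 T ×ˢ Icc l r)
  initial : ∀ x ∈ Icc l r, v (0, x) = v₀ x
  weak_eq : ∀ φ : 𝓓(CylInit T l r, ℝ),
    (∫ p in Ioo 0 T ×ˢ Ioo l r,
        dt φ p * v p + dx φ p * (f (v p) - ε * (A (v p) * dx v p)) + r₁ p * φ p)
      + ε * (∫ t in Ioo 0 T, r₂ t (slice φ t))
      + ∫ x in Ioo l r, v₀ x * φ (0, x) = 0

/-- The constant
`K = (ε ‖∂ₓ v‖_∞ sup_{[a,b]} |A'|² + sup_{[a,b]} |f''|) ‖∂ₓ v‖_∞`. -/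
def stabConst (T l r ε : ℝ) (f A : ℝ → ℝ) (a b : ℝ) (v : ℝ × ℝ → ℝ) : ℝ :=
  (ε * (eLpNorm (dx v) ∞ (volCyl T l r)).toReal * sSup ((fun w => |deriv A w| ^ 2) '' Icc a b)
      + sSup ((fun w => |deriv (deriv f) w|) '' Icc a b))
    * (eLpNorm (dx v) ∞ (volCyl T l r)).toReal

end ConvDiff

end

/-! The proof is the relative entropy method for the quadratic entropy. Put w = u - û. Take the
entropy inequality of u, subtract its weak equation tested with û, and add the chain rule identities
for û²/2 and for the primitive of f at û. In the weak sense this gives ∂ₜ(w²/2) + ∂ₓ(`relFlux`) ≤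
`relProd` (`rel_entropy_ineq_tensor`). Since û is only Lipschitz, it enters the test function
through mollification (`weak_eq_mul_lipschitz`).

The spatial cutoff is then removed. Equal boundary values put almost every time slice of w in
H¹₀(Ω), and `relFlux` is w times a function h in L². On a boundary strip of width d this gives ∫ |w
h| ≤ (d/2) ∫ ((∂ₓw)² + h²), which absorbs the factor 1/d in the derivative of the cutoff. What
remains is an integral over shrinking strips, so the flux disappears in the limit
(`tendsto_integral_cutoff`, `rel_entropy_ineq`).

To eliminate ∂ₜû from `relProd`, the perturbed equation is read at almost every time and tested with
w. The exceptional times must not depend on the test function. This is achieved with a countable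
family of test functions whose derivatives are dense among the mean-zero functions of L²
(`exists_seq_testFunction_dense_deriv`, `ae_perturbed_slice_bound`). The outcome is the dissipation
-ε A(u)(∂ₓw)² ≤ -ε (∂ₓw)² and four errors: ε (A(u) - A(û)) ∂ₓû ∂ₓw, the Taylor remainder of f times
∂ₓû, r₁ w and ε r₂ applied to w (`ae_integral_relProd_le`).

The end is an energy argument (`energy_estimate`). The terms with ∂ₓw are absorbed by Young's
inequality with a free weight. Because r₁ is only integrable in time, its term is controlled through
the essential supremum in time of ‖w‖. One weight bounds that supremum, a larger one keeps part of
the dissipation, and Grönwall's inequality closes the estimate. -/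

noncomputable section

namespace ConvDiff

/-! ### Square-integrable functions -/

section L2

variable {α : Type*} [MeasurableSpace α] {μ : Measure α}

/-- The integral of the square of `h`. -/
def sqInt (μ : Measure α) (h : α → ℝ) : ℝ := ∫ x, h x ^ 2 ∂μ

theorem sqInt_nonneg (h : α → ℝ) : 0 ≤ sqInt μ h := integral_nonneg fun _ => sq_nonneg _

theorem eLpNorm_two_eq_ofReal_sqrt {h : α → ℝ} (hh : MemLp h 2 μ) :
    eLpNorm h 2 μ = ENNReal.ofReal (√(sqInt μ h)) := by
  rw [hh.eLpNorm_eq_integral_rpow_norm (by norm_num) (by norm_num), Real.sqrt_eq_rpow, sqInt]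
  simp

theorem eLpNorm_two_sq_eq {h : α → ℝ} (hh : MemLp h 2 μ) :
    eLpNorm h 2 μ ^ 2 = ENNReal.ofReal (sqInt μ h) := by
  rw [eLpNorm_two_eq_ofReal_sqrt hh, ← ENNReal.ofReal_pow (Real.sqrt_nonneg _),
    Real.sq_sqrt (sqInt_nonneg h)]

theorem abs_integral_mul_le {g h : α → ℝ} (hg : MemLp g 2 μ) (hh : MemLp h 2 μ) :
    |∫ x, g x * h x ∂μ| ≤ √(sqInt μ g) * √(sqInt μ h) := by
  have h1 := integral_mul_norm_le_Lp_mul_Lq (μ := μ) (f := g) (g := h) (p := 2) (q := 2)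
    (by constructor <;> norm_num) (by simpa using hg) (by simpa using hh)
  have h2 : ∀ k : α → ℝ, (∫ a, ‖k a‖ ^ (2 : ℝ) ∂μ) ^ (1 / 2 : ℝ) = √(sqInt μ k) := by
    intro k
    rw [Real.sqrt_eq_rpow, sqInt]
    simp
  rw [h2, h2] at h1
  refine le_trans ?_ h1
  refine (abs_integral_le_integral_abs).trans (le_of_eq ?_)
  simp [abs_mul]

end L2

/-! ### Test functions on an interval -/

section Interval

variable {l r : ℝ}

theorem testFunction_eq_zero_of_notMem (ψ : 𝓓(Om l r, ℝ)) {x : ℝ} (hx : x ∉ Ioo l r) : ψ x = 0 := by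
  by_contra h
  exact hx (ψ.tsupport_subset (subset_tsupport _ h))

theorem contDiff_deriv_testFunction (ψ : 𝓓(Om l r, ℝ)) : ContDiff ℝ (⊤ : ℕ∞) (deriv ψ) :=
  (contDiff_infty_iff_deriv.1 ψ.contDiff).2

theorem hasDerivAt_testFunction (ψ : 𝓓(Om l r, ℝ)) (x : ℝ) : HasDerivAt ψ (deriv ψ x) x :=
  ((contDiff_infty_iff_deriv.1 ψ.contDiff).1 x).hasDerivAt

theorem memLp_testFunction (ψ : 𝓓(Om l r, ℝ)) (p : ℝ≥0∞) : MemLp ψ p (volOm l r) :=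
  (ψ.continuous.memLp_of_hasCompactSupport ψ.hasCompactSupport).restrict _

theorem memLp_deriv_testFunction (ψ : 𝓓(Om l r, ℝ)) (p : ℝ≥0∞) :
    MemLp (deriv ψ) p (volOm l r) :=
  ((contDiff_deriv_testFunction ψ).continuous.memLp_of_hasCompactSupport
    ψ.hasCompactSupport.deriv).restrict _

theorem integral_deriv_testFunction (ψ : 𝓓(Om l r, ℝ)) (x : ℝ) :
    ∫ y in l..x, deriv ψ y = ψ x := by
  rw [intervalIntegral.integral_deriv_eq_sub (fun y _ => (hasDerivAt_testFunction ψ y).differentiableAt)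
    ((contDiff_deriv_testFunction ψ).continuous.intervalIntegrable _ _),
    testFunction_eq_zero_of_notMem ψ (x := l) (by simp), sub_zero]

theorem setIntegral_deriv_testFunction (hlr : l < r) (ψ : 𝓓(Om l r, ℝ)) :
    ∫ y in Ioo l r, deriv ψ y = 0 := by
  rw [← integral_Ioc_eq_integral_Ioo, ← intervalIntegral.integral_of_le hlr.le,
    integral_deriv_testFunction, testFunction_eq_zero_of_notMem ψ (x := r) (by simp)]

/-- The primitive from `l` always vanishes to the left of the support of `h`. Mean zero is exactly
what makes it vanish to the right as well, hence compactly supported in the interval. -/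
theorem exists_testFunction_deriv_eq (hlr : l < r) {h : ℝ → ℝ} (hh : ContDiff ℝ (⊤ : ℕ∞) h)
    (hc : HasCompactSupport h) (hs : tsupport h ⊆ Ioo l r) (h0 : ∫ x in Ioo l r, h x = 0) :
    ∃ ψ : 𝓓(Om l r, ℝ), deriv ψ = h := by
  obtain ⟨a, b, hla, hbr, hab⟩ : ∃ a b, l < a ∧ b < r ∧ tsupport h ⊆ Icc a b := by
    rcases (tsupport h).eq_empty_or_nonempty with he | hne
    · obtain ⟨m, hm⟩ := exists_between hlr
      exact ⟨m, m, hm.1, hm.2, by simp [he]⟩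
    · have hc' : IsCompact (tsupport h) := hc
      refine ⟨sInf (tsupport h), sSup (tsupport h), (hs (hc'.sInf_mem hne)).1,
        (hs (hc'.sSup_mem hne)).2, fun x hx => ⟨csInf_le hc'.bddBelow hx, le_csSup hc'.bddAbove hx⟩⟩
  have hz : ∀ x ∉ Icc a b, h x = 0 := fun x hx => by
    by_contra hne
    exact hx (hab (subset_tsupport _ hne))
  set ψ : ℝ → ℝ := fun x => ∫ y in l..x, h y with hψ
  have hd : ∀ x, HasDerivAt ψ (h x) x := fun x =>
    intervalIntegral.integral_hasDerivAt_right (hh.continuous.intervalIntegrable _ _)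
      hh.continuous.aestronglyMeasurable.stronglyMeasurableAtFilter hh.continuous.continuousAt
  have hderiv : deriv ψ = h := funext fun x => (hd x).deriv
  have hsupp : ∀ x ∉ Icc a b, ψ x = 0 := by
    intro x hx
    by_cases hxa : x < a
    · refine (intervalIntegral.integral_zero_ae (Filter.Eventually.of_forall fun y hy => hz y ?_))
      intro hy'
      have := hy.2
      have h2 := hy'.1
      rcases le_max_iff.1 this with h | h <;> linarith
    · have hxb : b < x := by
        by_contra hb
        exact hx ⟨not_lt.1 hxa, not_lt.1 hb⟩
      have h1 : ∫ y in l..r, h y = 0 := by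
        rw [intervalIntegral.integral_of_le hlr.le, integral_Ioc_eq_integral_Ioo, h0]
      have h2 : ∫ y in x..r, h y = 0 := by
        refine (intervalIntegral.integral_zero_ae (Filter.Eventually.of_forall fun y hy => hz y ?_))
        intro hy'
        have := hy.1
        have h2 := hy'.2
        rcases min_lt_iff.1 this with h | h <;> linarith
      have h3 := intervalIntegral.integral_add_adjacent_intervals
        (hh.continuous.intervalIntegrable (μ := volume) l x) (hh.continuous.intervalIntegrable x r)
      simp only [hψ]
      linarith
  have hts : tsupport ψ ⊆ Icc a b := closure_minimal
    (fun x hx => by_contra fun hn => hx (hsupp x hn)) isClosed_Icc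
  refine ⟨⟨ψ, ?_, HasCompactSupport.of_support_subset_isCompact isCompact_Icc
    ((subset_tsupport _).trans hts), fun x hx => ⟨hla.trans_le (hts hx).1, (hts hx).2.trans_lt hbr⟩⟩,
    hderiv⟩
  exact contDiff_infty_iff_deriv.2 ⟨fun x => (hd x).differentiableAt, hderiv ▸ hh⟩

/-- A smooth function with compact support in `(l, r)` and integral one. -/
theorem exists_testFunction_integral_eq_one (hlr : l < r) :
    ∃ ρ : 𝓓(Om l r, ℝ), (∀ x, 0 ≤ ρ x) ∧ ∫ x in Ioo l r, ρ x = 1 := by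
  have hpos : 0 < (r - l) / 4 := by linarith
  let b : ContDiffBump ((l + r) / 2) := ⟨(r - l) / 4 / 2, (r - l) / 4, by positivity, by linarith⟩
  have hts : tsupport (b.normed volume) ⊆ Ioo l r := by
    rw [b.tsupport_normed_eq]
    intro x hx
    rw [Real.closedBall_eq_Icc] at hx
    have h1 : (l + r) / 2 - (r - l) / 4 ≤ x := hx.1
    have h2 : x ≤ (l + r) / 2 + (r - l) / 4 := hx.2
    constructor <;> linarith
  refine ⟨⟨b.normed volume, b.contDiff_normed, b.hasCompactSupport_normed, hts⟩,
    fun x => b.nonneg_normed x, ?_⟩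
  change ∫ x in Ioo l r, b.normed volume x = 1
  rw [setIntegral_eq_integral_of_forall_compl_eq_zero]
  · exact b.integral_normed
  · intro x hx
    by_contra h
    exact hx (hts (subset_tsupport _ h))

/-- The du Bois-Reymond lemma. -/
theorem ae_eq_const_of_integral_mul_deriv_eq_zero (hlr : l < r) {g : ℝ → ℝ}
    (hg : Integrable g (volOm l r)) (h : ∀ ψ : 𝓓(Om l r, ℝ), ∫ x in Ioo l r, g x * deriv ψ x = 0) :
    ∃ c : ℝ, ∀ᵐ x ∂(volOm l r), g x = c := by
  obtain ⟨ρ, -, hρ⟩ := exists_testFunction_integral_eq_one hlr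
  refine ⟨∫ x in Ioo l r, g x * ρ x, ?_⟩
  set c := ∫ x in Ioo l r, g x * ρ x with hc
  have key := (isOpen_Ioo (a := l) (b := r)).ae_eq_zero_of_integral_contDiff_smul_eq_zero
    (μ := volume) (f := fun x => g x - c) ?_ ?_
  · rw [ae_restrict_iff' measurableSet_Ioo]
    filter_upwards [key] with x hx hx'
    linarith [hx hx']
  · exact (IntegrableOn.locallyIntegrableOn (hg.sub (integrable_const c)))
  · intro k hk hkc hks
    have hkz : ∀ x ∉ Ioo l r, k x = 0 := fun x hx => by
      by_contra hne
      exact hx (hks (subset_tsupport _ hne))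
    have hkb : ∀ k : ℝ → ℝ, Continuous k → HasCompactSupport k →
        Integrable (fun x => g x * k x) (volOm l r) := by
      intro k hk hkc
      obtain ⟨C, hC⟩ := hk.bounded_above_of_compact_support hkc
      exact hg.mul_bdd (c := C) hk.aestronglyMeasurable (Filter.Eventually.of_forall hC)
    have hki : Integrable k (volOm l r) :=
      (hk.continuous.integrable_of_hasCompactSupport hkc).restrict
    have hρi : Integrable ρ (volOm l r) :=
      (ρ.continuous.integrable_of_hasCompactSupport ρ.hasCompactSupport).restrict
    set m := ∫ x in Ioo l r, k x with hm
    -- Subtracting `m • ρ` from `k` makes the mean zero, so the difference is the derivative of a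
    -- test function. This also explains the choice of `c` as the integral of `g` against `ρ`.
    obtain ⟨ψ, hψ⟩ := exists_testFunction_deriv_eq (h := k - m • (ρ : ℝ → ℝ)) hlr
      (hk.sub (contDiff_const.smul ρ.contDiff)) (hkc.sub (ρ.hasCompactSupport.smul_left (f := fun _ => m)))
      ((tsupport_sub _ _).trans (union_subset hks
        ((tsupport_smul_subset_right (fun _ => m) _).trans ρ.tsupport_subset))) (by
          have : ∫ x in Ioo l r, (k - m • (ρ : ℝ → ℝ)) x
              = (∫ x in Ioo l r, k x) - ∫ x in Ioo l r, m * ρ x :=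
            integral_sub hki (hρi.const_mul m)
          rw [this, integral_const_mul, hρ]; simp [hm])
    have h1 := h ψ
    rw [hψ] at h1
    have h2 : ∫ x in Ioo l r, g x * (k - m • (ρ : ℝ → ℝ)) x
        = (∫ x in Ioo l r, g x * k x) - m * c := by
      have : ∀ x, g x * (k - m • (ρ : ℝ → ℝ)) x = g x * k x - m * (g x * ρ x) := by
        intro x; simp; ring
      simp_rw [this]
      rw [integral_sub (hkb k hk.continuous hkc)
        ((hkb ρ ρ.continuous ρ.hasCompactSupport).const_mul m), integral_const_mul]
    have h3 : ∫ x, k x • (g x - c) = ∫ x in Ioo l r, k x • (g x - c) := by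
      rw [setIntegral_eq_integral_of_forall_compl_eq_zero]
      intro x hx; simp [hkz x hx]
    have h4 : ∫ x in Ioo l r, k x • (g x - c) = (∫ x in Ioo l r, g x * k x) - c * m := by
      have : ∀ x, k x • (g x - c) = g x * k x - c * k x := by
        intro x; simp; ring
      simp_rw [this]
      rw [integral_sub (hkb k hk.continuous hkc) (hki.const_mul c), integral_const_mul]
    rw [h3, h4]
    linarith

/-- There is a sequence of test functions whose derivatives are dense among the square-integrable
functions of mean zero. -/
theorem exists_seq_testFunction_dense_deriv (hlr : l < r) :
    ∃ ψ : ℕ → 𝓓(Om l r, ℝ), ∀ g : ℝ → ℝ, MemLp g 2 (volOm l r) → ∫ x in Ioo l r, g x = 0 →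
      ∀ δ : ℝ, 0 < δ → ∃ n, √(sqInt (volOm l r) (fun x => g x - deriv (ψ n) x)) < δ := by
  have : Fact ((2 : ℝ≥0∞) ≠ ∞) := ⟨by norm_num⟩
  let E := Lp ℝ 2 (volOm l r)
  let L : 𝓓(Om l r, ℝ) →ₗ[ℝ] E :=
    { toFun := fun ψ => (memLp_deriv_testFunction ψ 2).toLp
      map_add' := fun φ ψ => by
        rw [← MemLp.toLp_add]
        congr 1
        ext x
        exact ((hasDerivAt_testFunction φ x).add (hasDerivAt_testFunction ψ x)).deriv
      map_smul' := fun c ψ => by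
        rw [RingHom.id_apply, ← MemLp.toLp_const_smul]
        congr 1
        ext x
        exact ((hasDerivAt_testFunction ψ x).const_smul c).deriv }
  -- Separability of L² passes to subsets, so the countable dense set can be chosen inside the range
  -- of `L`: its members are genuine derivatives of test functions.
  obtain ⟨t, htD, htc, htd⟩ :=
    (IsSeparable.of_separableSpace (LinearMap.range L : Set E)).exists_countable_dense_subset
  have hne : t.Nonempty := by
    by_contra h
    rw [not_nonempty_iff_eq_empty] at h
    rw [h, closure_empty] at htd
    exact htd (LinearMap.range L).zero_mem
  obtain ⟨e, he⟩ := htc.exists_eq_range hne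
  have : ∀ n, ∃ ψ, L ψ = e n := fun n => htD (he ▸ mem_range_self n)
  choose ψ hψ using this
  refine ⟨ψ, fun g hg hg0 δ hδ => ?_⟩
  have hmem : hg.toLp ∈ closure (LinearMap.range L : Set E) := by
    -- The double orthogonal complement is the closure. By du Bois-Reymond the functions orthogonal
    -- to all derivatives are constants, and `g`, having mean zero, is orthogonal to those.
    have h1 : hg.toLp ∈ (LinearMap.range L)ᗮᗮ := by
      rw [Submodule.mem_orthogonal]
      intro k hk
      rw [Submodule.mem_orthogonal] at hk
      obtain ⟨c, hc⟩ := ae_eq_const_of_integral_mul_deriv_eq_zero hlr (g := k)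
        ((Lp.memLp k).integrable (by norm_num)) (fun φ => by
          have := hk (L φ) ⟨φ, rfl⟩
          rw [L2.inner_def] at this
          rw [← this]
          refine integral_congr_ae ?_
          filter_upwards [(memLp_deriv_testFunction φ 2).coeFn_toLp] with x hx
          change _ = inner ℝ ((memLp_deriv_testFunction φ 2).toLp _ x) (k x)
          rw [hx]
          simp)
      rw [L2.inner_def]
      have : ∫ x in Ioo l r, inner ℝ (k x) (hg.toLp _ x) = ∫ x in Ioo l r, c * g x := by
        refine integral_congr_ae ?_
        filter_upwards [hg.coeFn_toLp, hc] with x hx hx'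
        rw [hx, hx']
        simp [mul_comm]
      rw [this, integral_const_mul, hg0, mul_zero]
    rw [Submodule.orthogonal_orthogonal_eq_closure] at h1
    exact h1
  have h2 : hg.toLp ∈ closure t := by
    have := closure_mono htd hmem
    rwa [closure_closure] at this
  rw [he] at h2
  obtain ⟨_, ⟨n, rfl⟩, hn⟩ := Metric.mem_closure_iff.1 h2 δ hδ
  refine ⟨n, ?_⟩
  have hd : MemLp (fun x => g x - deriv (ψ n) x) 2 (volOm l r) :=
    hg.sub (memLp_deriv_testFunction (ψ n) 2)
  rw [← hψ n] at hn
  change dist hg.toLp (memLp_deriv_testFunction (ψ n) 2).toLp < δ at hn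
  rw [Lp.dist_def, eLpNorm_congr_ae (g := fun x => g x - deriv (ψ n) x),
    eLpNorm_two_eq_ofReal_sqrt hd, ENNReal.toReal_ofReal (Real.sqrt_nonneg _)] at hn
  · exact hn
  · filter_upwards [hg.coeFn_toLp, (memLp_deriv_testFunction (ψ n) 2).coeFn_toLp] with x h1 h2
    simp [h1, h2]

end Interval

/-! ### Triangle inequality and products in L². -/

section L2

variable {α : Type*} [MeasurableSpace α] {μ : Measure α}

theorem sqrt_sqInt_add_le {g h : α → ℝ} (hg : MemLp g 2 μ) (hh : MemLp h 2 μ) :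
    √(sqInt μ (fun x => g x + h x)) ≤ √(sqInt μ g) + √(sqInt μ h) := by
  have h1 := eLpNorm_add_le hg.1 hh.1 (p := 2) (by norm_num)
  rw [eLpNorm_two_eq_ofReal_sqrt hg, eLpNorm_two_eq_ofReal_sqrt hh,
    eLpNorm_two_eq_ofReal_sqrt (hg.add hh), ← ENNReal.ofReal_add (Real.sqrt_nonneg _)
    (Real.sqrt_nonneg _), ENNReal.ofReal_le_ofReal_iff (by positivity)] at h1
  exact h1

theorem integrable_mul_of_memLp_two {g h : α → ℝ} (hg : MemLp g 2 μ) (hh : MemLp h 2 μ) :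
    Integrable (fun x => g x * h x) μ := hg.integrable_mul hh

theorem sqInt_neg (h : α → ℝ) : sqInt μ (fun x => -h x) = sqInt μ h := by simp [sqInt]

end L2

/-! ### Primitives of L² functions and H¹₀ on an interval. -/

section Interval

variable {l r : ℝ}

theorem intervalIntegral_eq_setIntegral_Ioo {a b : ℝ} (hab : a ≤ b) (g : ℝ → ℝ) :
    ∫ y in a..b, g y = ∫ y in Ioo a b, g y := by
  rw [intervalIntegral.integral_of_le hab, integral_Ioc_eq_integral_Ioo]

theorem intervalIntegrable_of_integrable_volOm {g : ℝ → ℝ} (hg : Integrable g (volOm l r))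
    {a b : ℝ} (ha : a ∈ Icc l r) (hb : b ∈ Icc l r) : IntervalIntegrable g volume a b := by
  have h1 : IntegrableOn g (Icc l r) := by
    rw [integrableOn_Icc_iff_integrableOn_Ioo]; exact hg
  refine (h1.mono_set ?_).intervalIntegrable
  exact (convex_Icc l r).ordConnected.uIcc_subset ha hb

theorem sq_setIntegral_Ioo_le {a b : ℝ} (hab : a ≤ b) {g : ℝ → ℝ} (hg : MemLp g 2 (volOm a b)) :
    (∫ y in Ioo a b, g y) ^ 2 ≤ (b - a) * ∫ y in Ioo a b, g y ^ 2 := by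
  have h := abs_integral_mul_le (memLp_const (1 : ℝ)) hg
  have h1 : sqInt (volOm a b) (fun _ => (1 : ℝ)) = b - a := by
    simp [sqInt, hab]
  rw [h1] at h
  simp only [one_mul] at h
  have h2 := pow_le_pow_left₀ (abs_nonneg _) h 2
  rwa [sq_abs, mul_pow, Real.sq_sqrt (by linarith), Real.sq_sqrt (sqInt_nonneg g)] at h2

theorem abs_primitive_le {g : ℝ → ℝ} (hg : MemLp g 2 (volOm l r)) {x : ℝ} (hx : x ∈ Icc l r) :
    |∫ y in l..x, g y| ≤ √(r - l) * √(sqInt (volOm l r) g) := by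
  rw [← Real.sqrt_mul (by linarith [hx.1, hx.2])]
  refine Real.abs_le_sqrt ?_
  have hsub : Ioo l x ⊆ Ioo l r := Ioo_subset_Ioo le_rfl hx.2
  rw [intervalIntegral_eq_setIntegral_Ioo hx.1]
  refine (sq_setIntegral_Ioo_le hx.1 (hg.mono_measure (Measure.restrict_mono hsub le_rfl))).trans ?_
  refine mul_le_mul (by linarith [hx.2]) ?_ (integral_nonneg fun _ => sq_nonneg _)
    (by linarith [hx.1, hx.2])
  exact setIntegral_mono_set hg.integrable_sq (Filter.Eventually.of_forall fun _ => sq_nonneg _)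
    hsub.eventuallyLE

theorem continuousOn_primitive_Icc (hlr : l ≤ r) {g : ℝ → ℝ} (hg : Integrable g (volOm l r)) :
    ContinuousOn (fun x => ∫ y in l..x, g y) (Icc l r) := by
  have := (intervalIntegrable_of_integrable_volOm hg (left_mem_Icc.2 hlr)
    (right_mem_Icc.2 hlr)).absolutelyContinuousOnInterval_intervalIntegral
    (c := l) left_mem_uIcc
  simpa [uIcc_of_le hlr] using this.continuousOn

theorem aestronglyMeasurable_primitive (hlr : l ≤ r) {g : ℝ → ℝ} (hg : Integrable g (volOm l r)) :
    AEStronglyMeasurable (fun x => ∫ y in l..x, g y) (volOm l r) :=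
  ((continuousOn_primitive_Icc hlr hg).mono Ioo_subset_Icc_self).aestronglyMeasurable
    measurableSet_Ioo

theorem memLp_primitive (hlr : l ≤ r) {g : ℝ → ℝ} (hg : MemLp g 2 (volOm l r)) (p : ℝ≥0∞) :
    MemLp (fun x => ∫ y in l..x, g y) p (volOm l r) := by
  refine MemLp.of_bound (aestronglyMeasurable_primitive hlr (hg.integrable (by norm_num)))
    (√(r - l) * √(sqInt (volOm l r) g)) ?_
  rw [ae_restrict_iff' measurableSet_Ioo]
  exact Filter.Eventually.of_forall fun x hx => abs_primitive_le hg (Ioo_subset_Icc_self hx)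

theorem integral_primitive_mul_deriv (hlr : l < r) {g : ℝ → ℝ} (hg : Integrable g (volOm l r))
    (ψ : 𝓓(Om l r, ℝ)) :
    ∫ x in Ioo l r, (∫ y in l..x, g y) * deriv ψ x = -∫ x in Ioo l r, g x * ψ x := by
  have hi := intervalIntegrable_of_integrable_volOm hg (left_mem_Icc.2 hlr.le)
    (right_mem_Icc.2 hlr.le)
  have h1 := hi.absolutelyContinuousOnInterval_intervalIntegral (c := l) left_mem_uIcc
  have h2 : AbsolutelyContinuousOnInterval ψ l r :=
    (ψ.contDiff.of_le (mod_cast le_top) : ContDiff ℝ 1 ψ).contDiffOn.absolutelyContinuousOnInterval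
  have h3 := h1.integral_mul_deriv_eq_deriv_mul h2
  rw [testFunction_eq_zero_of_notMem ψ (x := r) (by simp),
    testFunction_eq_zero_of_notMem ψ (x := l) (by simp), mul_zero, mul_zero, sub_zero, zero_sub,
    intervalIntegral_eq_setIntegral_Ioo hlr.le] at h3
  rw [h3, ← intervalIntegral_eq_setIntegral_Ioo hlr.le]
  congr 1
  refine intervalIntegral.integral_congr_ae ?_
  filter_upwards [hi.ae_hasDerivAt_integral] with x hx hx'
  rw [(hx (uIoc_subset_uIcc hx') l left_mem_uIcc).deriv]

/-- The difference of `z` and the primitive is orthogonal to every `deriv (ψ n)`, by density to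
every derivative of a test function, and so constant. Requiring the identity only along a sequence
matters for time slices, where each test function brings its own null set of times. -/
theorem ae_eq_const_add_primitive (hlr : l < r) {ψ : ℕ → 𝓓(Om l r, ℝ)}
    (hψ : ∀ g : ℝ → ℝ, MemLp g 2 (volOm l r) → ∫ x in Ioo l r, g x = 0 →
      ∀ δ : ℝ, 0 < δ → ∃ n, √(sqInt (volOm l r) (fun x => g x - deriv (ψ n) x)) < δ)
    {z y : ℝ → ℝ} (hz : MemLp z 2 (volOm l r)) (hy : MemLp y 2 (volOm l r))
    (h : ∀ n, ∫ x in Ioo l r, z x * deriv (ψ n) x = -∫ x in Ioo l r, y x * ψ n x) :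
    ∃ c : ℝ, ∀ᵐ x ∂(volOm l r), z x = c + ∫ s in l..x, y s := by
  have hy1 : Integrable y (volOm l r) := hy.integrable (by norm_num)
  have hP := memLp_primitive hlr.le hy 2
  have hd : MemLp (fun x => z x - ∫ s in l..x, y s) 2 (volOm l r) := hz.sub hP
  have h0 : ∀ n, ∫ x in Ioo l r, (z x - ∫ s in l..x, y s) * deriv (ψ n) x = 0 := by
    intro n
    simp_rw [sub_mul]
    rw [integral_sub (integrable_mul_of_memLp_two hz (memLp_deriv_testFunction (ψ n) 2))
      (integrable_mul_of_memLp_two hP (memLp_deriv_testFunction (ψ n) 2)), h n,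
      integral_primitive_mul_deriv hlr hy1, sub_self]
  obtain ⟨c, hc⟩ := ae_eq_const_of_integral_mul_deriv_eq_zero hlr
    (hd.integrable (by norm_num)) (fun φ => by
    set M := √(sqInt (volOm l r) (fun x => z x - ∫ s in l..x, y s)) with hM
    have hb : ∀ δ : ℝ, 0 < δ →
        |∫ x in Ioo l r, (z x - ∫ s in l..x, y s) * deriv φ x| ≤ M * δ := by
      intro δ hδ
      obtain ⟨n, hn⟩ := hψ (deriv φ) (memLp_deriv_testFunction φ 2)
        (setIntegral_deriv_testFunction hlr φ) δ hδ
      have e : ∫ x in Ioo l r, (z x - ∫ s in l..x, y s) * deriv φ x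
          = ∫ x in Ioo l r, (z x - ∫ s in l..x, y s) * (deriv φ x - deriv (ψ n) x) := by
        simp_rw [mul_sub]
        rw [integral_sub (integrable_mul_of_memLp_two hd (memLp_deriv_testFunction φ 2))
          (integrable_mul_of_memLp_two hd (memLp_deriv_testFunction (ψ n) 2)), h0 n, sub_zero]
      rw [e]
      refine (abs_integral_mul_le hd ((memLp_deriv_testFunction φ 2).sub
        (memLp_deriv_testFunction (ψ n) 2))).trans ?_
      exact mul_le_mul_of_nonneg_left hn.le (Real.sqrt_nonneg _)
    have hM0 : 0 ≤ M := Real.sqrt_nonneg _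
    refine abs_nonpos_iff.1 (le_of_forall_pos_le_add fun η hη => ?_)
    refine (hb (η / (M + 1)) (by positivity)).trans ?_
    rw [zero_add, ← mul_div_assoc, div_le_iff₀ (by positivity)]
    nlinarith)
  exact ⟨c, hc.mono fun x hx => by linarith⟩

/-- An estimate for test functions of a sequence with dense derivatives extends to `H¹₀`. -/
theorem abs_integral_add_le_of_dense (hlr : l < r) {ψ : ℕ → 𝓓(Om l r, ℝ)}
    (hψ : ∀ g : ℝ → ℝ, MemLp g 2 (volOm l r) → ∫ x in Ioo l r, g x = 0 →
      ∀ δ : ℝ, 0 < δ → ∃ n, √(sqInt (volOm l r) (fun x => g x - deriv (ψ n) x)) < δ)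
    {a b : ℝ → ℝ} (ha : MemLp a 2 (volOm l r)) (hb : Integrable b (volOm l r)) {C : ℝ} (hC : 0 ≤ C)
    (h : ∀ n, |(∫ x in Ioo l r, a x * deriv (ψ n) x) + ∫ x in Ioo l r, b x * ψ n x|
      ≤ C * √(sqInt (volOm l r) (deriv (ψ n))))
    {g : ℝ → ℝ} (hg : MemLp g 2 (volOm l r)) (hg0 : ∫ x in Ioo l r, g x = 0) :
    |(∫ x in Ioo l r, a x * g x) + ∫ x in Ioo l r, b x * ∫ y in l..x, g y|
      ≤ C * √(sqInt (volOm l r) g) := by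
  -- Replacing `g` by `deriv (ψ n)` costs at most `M * δ`: the three summands come from the norm on
  -- the right, from the `a` integral by Cauchy-Schwarz, and from the `b` integral by the uniform
  -- bound on primitives.
  set M := C + √(sqInt (volOm l r) a) + (∫ x in Ioo l r, |b x|) * √(r - l) with hM
  have hM0 : 0 ≤ M := by
    have : 0 ≤ ∫ x in Ioo l r, |b x| := integral_nonneg fun _ => abs_nonneg _
    positivity
  have key : ∀ δ : ℝ, 0 < δ → |(∫ x in Ioo l r, a x * g x) + ∫ x in Ioo l r, b x * ∫ y in l..x, g y|
      ≤ C * √(sqInt (volOm l r) g) + M * δ := by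
    intro δ hδ
    obtain ⟨n, hn⟩ := hψ g hg hg0 δ hδ
    have hψ2 := memLp_deriv_testFunction (ψ n) 2
    have hk : MemLp (fun x => g x - deriv (ψ n) x) 2 (volOm l r) := hg.sub hψ2
    have e1 : ∫ x in Ioo l r, a x * g x = (∫ x in Ioo l r, a x * deriv (ψ n) x)
        + ∫ x in Ioo l r, a x * (g x - deriv (ψ n) x) := by
      rw [← integral_add (integrable_mul_of_memLp_two ha hψ2) (integrable_mul_of_memLp_two ha hk)]
      congr 1; ext x; ring
    have hpk : MemLp (fun x => ∫ y in l..x, (g y - deriv (ψ n) y)) ∞ (volOm l r) :=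
      memLp_primitive hlr.le hk _
    have hbk : ∀ {p : ℝ → ℝ}, MemLp p ∞ (volOm l r) →
        Integrable (fun x => b x * p x) (volOm l r) := fun hp => by
      have := hp.integrable_mul (q := 1) (memLp_one_iff_integrable.2 hb)
      exact this.congr (Filter.Eventually.of_forall fun x => mul_comm _ _)
    have e2 : ∫ x in Ioo l r, b x * ∫ y in l..x, g y = (∫ x in Ioo l r, b x * ψ n x)
        + ∫ x in Ioo l r, b x * ∫ y in l..x, (g y - deriv (ψ n) y) := by
      rw [← integral_add (hbk (memLp_testFunction (ψ n) ∞)) (hbk hpk)]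
      refine setIntegral_congr_fun measurableSet_Ioo fun x hx => ?_
      have hi := intervalIntegrable_of_integrable_volOm (hg.integrable (by norm_num))
        (left_mem_Icc.2 hlr.le) (Ioo_subset_Icc_self hx)
      rw [intervalIntegral.integral_sub hi
        ((contDiff_deriv_testFunction (ψ n)).continuous.intervalIntegrable _ _),
        integral_deriv_testFunction]
      ring
    have b1 : |∫ x in Ioo l r, a x * (g x - deriv (ψ n) x)| ≤ √(sqInt (volOm l r) a) * δ :=
      (abs_integral_mul_le ha hk).trans (mul_le_mul_of_nonneg_left hn.le (Real.sqrt_nonneg _))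
    have b2 : |∫ x in Ioo l r, b x * ∫ y in l..x, (g y - deriv (ψ n) y)|
        ≤ (∫ x in Ioo l r, |b x|) * √(r - l) * δ := by
      refine abs_integral_le_integral_abs.trans ?_
      rw [mul_assoc, ← integral_mul_const]
      refine setIntegral_mono_on (hbk hpk).abs (hb.abs.mul_const _) measurableSet_Ioo
        fun x hx => ?_
      rw [abs_mul]
      refine mul_le_mul_of_nonneg_left ?_ (abs_nonneg _)
      exact (abs_primitive_le hk (Ioo_subset_Icc_self hx)).trans
        (mul_le_mul_of_nonneg_left hn.le (Real.sqrt_nonneg _))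
    have b3 : √(sqInt (volOm l r) (deriv (ψ n))) ≤ √(sqInt (volOm l r) g) + δ := by
      have := sqrt_sqInt_add_le hg (hk.neg)
      have e3 : (fun x => g x + (-fun x => g x - deriv (ψ n) x) x) = deriv (ψ n) := by
        ext x; simp
      rw [e3] at this
      have e4 : sqInt (volOm l r) (-fun x => g x - deriv (ψ n) x)
          = sqInt (volOm l r) (fun x => g x - deriv (ψ n) x) := sqInt_neg _
      rw [e4] at this
      linarith
    rw [e1, e2]
    have b4 := (h n).trans (mul_le_mul_of_nonneg_left b3 hC)
    rw [abs_le] at b1 b2 b4 ⊢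
    rw [hM]
    constructor <;> nlinarith
  refine le_of_forall_pos_le_add fun η hη => (key (η / (M + 1)) (by positivity)).trans ?_
  have : M * (η / (M + 1)) ≤ η := by
    rw [← mul_div_assoc, div_le_iff₀ (by positivity)]
    nlinarith
  linarith

/-- If `W² ≤ d ∫ g²` on an interval of length `d`, then
`∫ |W h| ≤ d / 2 ∫ (g² + h²)` there. -/
theorem setIntegral_abs_mul_le_of_sq_le {a b : ℝ} (hab : a < b) {W g h : ℝ → ℝ}
    (hg : MemLp g 2 (volOm a b)) (hh : MemLp h 2 (volOm a b))
    (hW : ∀ᵐ x ∂(volOm a b), W x ^ 2 ≤ (b - a) * ∫ y in Ioo a b, g y ^ 2) :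
    ∫ x in Ioo a b, |W x * h x| ≤ (b - a) / 2 * ∫ x in Ioo a b, (g x ^ 2 + h x ^ 2) := by
  have hd : 0 < b - a := by linarith
  set G := ∫ y in Ioo a b, g y ^ 2 with hG
  have h1 : ∫ x in Ioo a b, |W x * h x| ≤ ∫ x in Ioo a b, (G / 2 + (b - a) / 2 * h x ^ 2) := by
    refine integral_mono_of_nonneg (Filter.Eventually.of_forall fun _ => abs_nonneg _)
      ((integrable_const _).add (hh.integrable_sq.const_mul _)) ?_
    filter_upwards [hW] with x hx
    rw [abs_mul]
    -- Young's inequality weighted by the length `b - a`, which matches the factor in `hW`.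
    have h2 : (|W x| - (b - a) * |h x|) ^ 2 ≥ 0 := sq_nonneg _
    have h3 : 2 * (b - a) * (|W x| * |h x|) ≤ (b - a) * G + (b - a) ^ 2 * h x ^ 2 := by
      have := sq_abs (W x)
      have := sq_abs (h x)
      nlinarith
    have h4 : 2 * (b - a) * (|W x| * |h x|)
        ≤ 2 * (b - a) * (G / 2 + (b - a) / 2 * h x ^ 2) := by linarith
    exact le_of_mul_le_mul_left h4 (by positivity)
  refine h1.trans (le_of_eq ?_)
  rw [integral_add (integrable_const _) (hh.integrable_sq.const_mul _), integral_const_mul,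
    integral_add hg.integrable_sq hh.integrable_sq]
  simp [hab.le]
  ring

/-- The boundary layer estimate for `W ∈ H¹₀(l, r)`. -/
theorem setIntegral_strips_abs_mul_le {W g h : ℝ → ℝ} {d : ℝ} (hd : 0 < d) (hdr : d ≤ r - l)
    (hg : MemLp g 2 (volOm l r)) (hh : MemLp h 2 (volOm l r)) (hg0 : ∫ x in Ioo l r, g x = 0)
    (hW : ∀ᵐ x ∂(volOm l r), W x = ∫ y in l..x, g y) :
    (∫ x in Ioo l (l + d), |W x * h x|) ≤ d / 2 * ∫ x in Ioo l (l + d), (g x ^ 2 + h x ^ 2) ∧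
    (∫ x in Ioo (r - d) r, |W x * h x|) ≤ d / 2 * ∫ x in Ioo (r - d) r, (g x ^ 2 + h x ^ 2) := by
  have hg1 : Integrable g (volOm l r) := hg.integrable (by norm_num)
  constructor
  · have hsub : Ioo l (l + d) ⊆ Ioo l r := Ioo_subset_Ioo le_rfl (by linarith)
    have hm := Measure.restrict_mono (μ := volume) hsub le_rfl
    have := setIntegral_abs_mul_le_of_sq_le (W := W) (by linarith : l < l + d)
      (hg.mono_measure hm) (hh.mono_measure hm) ?_
    · simpa using this
    · filter_upwards [ae_restrict_of_ae_restrict_of_subset hsub hW,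
        ae_restrict_mem measurableSet_Ioo] with x hx hx'
      rw [hx, intervalIntegral_eq_setIntegral_Ioo hx'.1.le]
      have hs2 : Ioo l x ⊆ Ioo l (l + d) := Ioo_subset_Ioo le_rfl hx'.2.le
      refine (sq_setIntegral_Ioo_le hx'.1.le (hg.mono_measure
        (Measure.restrict_mono (hs2.trans hsub) le_rfl))).trans ?_
      refine mul_le_mul (by linarith [hx'.2]) ?_ (integral_nonneg fun _ => sq_nonneg _)
        (by linarith)
      exact setIntegral_mono_set (hg.mono_measure hm).integrable_sq
        (Filter.Eventually.of_forall fun _ => sq_nonneg _) hs2.eventuallyLE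
  · have hsub : Ioo (r - d) r ⊆ Ioo l r := Ioo_subset_Ioo (by linarith) le_rfl
    have hm := Measure.restrict_mono (μ := volume) hsub le_rfl
    have := setIntegral_abs_mul_le_of_sq_le (W := W) (by linarith : r - d < r)
      (hg.mono_measure hm) (hh.mono_measure hm) ?_
    · simpa using this
    · filter_upwards [ae_restrict_of_ae_restrict_of_subset hsub hW,
        ae_restrict_mem measurableSet_Ioo] with x hx hx'
      have hxm : x ∈ Icc l r := Ioo_subset_Icc_self (hsub hx')
      -- As `g` has mean zero, its integral from `l` to `x` is minus that from `x` to `r`, and the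
      -- argument of the left strip can be repeated from `r`.
      have h1 := intervalIntegral.integral_add_adjacent_intervals
        (intervalIntegrable_of_integrable_volOm hg1 (left_mem_Icc.2 (hxm.1.trans hxm.2)) hxm)
        (intervalIntegrable_of_integrable_volOm hg1 hxm (right_mem_Icc.2 (hxm.1.trans hxm.2)))
      rw [intervalIntegral_eq_setIntegral_Ioo (hxm.1.trans hxm.2), hg0] at h1
      rw [hx, eq_neg_of_add_eq_zero_left h1, neg_sq, intervalIntegral_eq_setIntegral_Ioo hxm.2]
      have hs2 : Ioo x r ⊆ Ioo (r - d) r := Ioo_subset_Ioo hx'.1.le le_rfl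
      refine (sq_setIntegral_Ioo_le hxm.2 (hg.mono_measure
        (Measure.restrict_mono (hs2.trans hsub) le_rfl))).trans ?_
      refine mul_le_mul (by linarith [hx'.1]) ?_ (integral_nonneg fun _ => sq_nonneg _)
        (by linarith)
      exact setIntegral_mono_set (hg.mono_measure hm).integrable_sq
        (Filter.Eventually.of_forall fun _ => sq_nonneg _) hs2.eventuallyLE

end Interval

/-! ### The space-time cylinder -/

section Cylinder

variable {T l r : ℝ}

theorem volCyl_eq_prod (T l r : ℝ) : volCyl T l r = (volOm 0 T).prod (volOm l r) := by
  rw [Measure.prod_restrict]; rfl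

instance isFiniteMeasure_volCyl (T l r : ℝ) : IsFiniteMeasure (volCyl T l r) := by
  rw [volCyl_eq_prod]; infer_instance

theorem memLp_volCyl_of_continuous {h : ℝ × ℝ → ℝ} (hh : Continuous h) (p : ℝ≥0∞) :
    MemLp h p (volCyl T l r) := by
  have hK : IsCompact (Icc 0 T ×ˢ Icc l r) := isCompact_Icc.prod isCompact_Icc
  obtain ⟨M, hM⟩ := hK.exists_bound_of_continuousOn hh.continuousOn
  refine MemLp.of_bound hh.aestronglyMeasurable M ?_
  filter_upwards [ae_restrict_mem (measurableSet_Ioo.prod measurableSet_Ioo)] with p hp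
  exact hM p ⟨Ioo_subset_Icc_self hp.1, Ioo_subset_Icc_self hp.2⟩

theorem Integrable.mul_memLp_top {α : Type*} [MeasurableSpace α] {μ : Measure α} {g h : α → ℝ}
    (hg : Integrable g μ) (hh : MemLp h ∞ μ) : Integrable (fun x => g x * h x) μ := by
  have := hh.integrable_mul (q := 1) (memLp_one_iff_integrable.2 hg)
  exact this.congr (Filter.Eventually.of_forall fun x => mul_comm _ _)

theorem Integrable.memLp_top_mul {α : Type*} [MeasurableSpace α] {μ : Measure α} {g h : α → ℝ}
    (hg : Integrable g μ) (hh : MemLp h ∞ μ) : Integrable (fun x => h x * g x) μ :=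
  hh.integrable_mul (q := 1) (memLp_one_iff_integrable.2 hg)

theorem integral_volCyl {h : ℝ × ℝ → ℝ} (hh : Integrable h (volCyl T l r)) :
    ∫ p in Ioo 0 T ×ˢ Ioo l r, h p = ∫ t in Ioo 0 T, ∫ x in Ioo l r, h (t, x) := by
  have e : volume.restrict (Ioo 0 T ×ˢ Ioo l r) = (volOm 0 T).prod (volOm l r) :=
    volCyl_eq_prod T l r
  rw [e]
  rw [volCyl_eq_prod] at hh
  exact integral_prod _ hh

theorem integral_volCyl_symm {h : ℝ × ℝ → ℝ} (hh : Integrable h (volCyl T l r)) :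
    ∫ p in Ioo 0 T ×ˢ Ioo l r, h p = ∫ x in Ioo l r, ∫ t in Ioo 0 T, h (t, x) := by
  have e : volume.restrict (Ioo 0 T ×ˢ Ioo l r) = (volOm 0 T).prod (volOm l r) :=
    volCyl_eq_prod T l r
  rw [e]
  rw [volCyl_eq_prod] at hh
  exact integral_prod_symm _ hh

theorem ae_ae_of_ae_volCyl {P : ℝ × ℝ → Prop} (h : ∀ᵐ p ∂(volCyl T l r), P p) :
    ∀ᵐ t ∂(volOm 0 T), ∀ᵐ x ∂(volOm l r), P (t, x) := by
  rw [volCyl_eq_prod] at h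
  exact Measure.ae_ae_of_ae_prod h

theorem integrable_integral_slice {h : ℝ × ℝ → ℝ} (hh : Integrable h (volCyl T l r)) :
    Integrable (fun t => ∫ x in Ioo l r, h (t, x)) (volOm 0 T) := by
  rw [volCyl_eq_prod] at hh
  exact hh.integral_prod_left

theorem ae_integrable_slice {h : ℝ × ℝ → ℝ} (hh : Integrable h (volCyl T l r)) :
    ∀ᵐ t ∂(volOm 0 T), Integrable (fun x => h (t, x)) (volOm l r) := by
  rw [volCyl_eq_prod] at hh
  exact hh.prod_right_ae

theorem ae_aestronglyMeasurable_slice {h : ℝ × ℝ → ℝ}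
    (hh : AEStronglyMeasurable h (volCyl T l r)) :
    ∀ᵐ t ∂(volOm 0 T), AEStronglyMeasurable (fun x => h (t, x)) (volOm l r) := by
  rw [volCyl_eq_prod] at hh
  exact hh.prodMk_left

theorem ae_memLp_two_slice {h : ℝ × ℝ → ℝ} (hh : MemLp h 2 (volCyl T l r)) :
    ∀ᵐ t ∂(volOm 0 T), MemLp (fun x => h (t, x)) 2 (volOm l r) := by
  filter_upwards [ae_integrable_slice hh.integrable_sq, ae_aestronglyMeasurable_slice hh.1]
    with t h1 h2
  exact (memLp_two_iff_integrable_sq h2).2 h1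

/-- The fundamental lemma of the calculus of variations on `(0, T)`. -/
theorem ae_eq_zero_of_integral_testFunction_mul_eq_zero {h : ℝ → ℝ} (hh : Integrable h (volOm l r))
    (h0 : ∀ θ : 𝓓(Om l r, ℝ), ∫ t in Ioo l r, θ t * h t = 0) : ∀ᵐ t ∂(volOm l r), h t = 0 := by
  have key := (isOpen_Ioo (a := l) (b := r)).ae_eq_zero_of_integral_contDiff_smul_eq_zero
    (μ := volume) (f := h) (IntegrableOn.locallyIntegrableOn hh) ?_
  · rw [ae_restrict_iff' measurableSet_Ioo]
    exact key
  · intro k hk hkc hks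
    have h1 := h0 ⟨k, hk, hkc, hks⟩
    rw [← h1, setIntegral_eq_integral_of_forall_compl_eq_zero]
    · rfl
    · intro x hx
      have : k x = 0 := by
        by_contra hne
        exact hx (hks (subset_tsupport _ hne))
      change k x * h x = 0
      rw [this, zero_mul]

end Cylinder

/-! ### Tensor products of test functions -/

/-- The open half-line `(-∞, T)`. -/
def Past (T : ℝ) : Opens ℝ := ⟨Iio T, isOpen_Iio⟩

section Tensor

variable {T l r : ℝ}

theorem tsupport_tensor_subset {U U' : Opens ℝ} (θ : 𝓓(U, ℝ)) (ψ : 𝓓(U', ℝ)) (V : ℝ × ℝ → ℝ) :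
    tsupport (fun p : ℝ × ℝ => θ p.1 * ψ p.2 * V p) ⊆ tsupport θ ×ˢ tsupport ψ := by
  refine closure_minimal (fun p hp => ?_) ((isClosed_tsupport _).prod (isClosed_tsupport _))
  have hp' : θ p.1 * ψ p.2 * V p ≠ 0 := hp
  exact ⟨subset_tsupport _ (left_ne_zero_of_mul (left_ne_zero_of_mul hp')),
    subset_tsupport _ (right_ne_zero_of_mul (left_ne_zero_of_mul hp'))⟩

/-- The test function `θ(t) ψ(x) V(t, x)` on `(-∞, T) × Ω`. -/
def tensorInit (θ : 𝓓(Past T, ℝ)) (ψ : 𝓓(Om l r, ℝ)) {V : ℝ × ℝ → ℝ}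
    (hV : ContDiff ℝ (⊤ : ℕ∞) V) : 𝓓(CylInit T l r, ℝ) where
  toFun p := θ p.1 * ψ p.2 * V p
  contDiff' := ((θ.contDiff.comp contDiff_fst).mul (ψ.contDiff.comp contDiff_snd)).mul hV
  hasCompactSupport' := HasCompactSupport.of_support_subset_isCompact
    (θ.hasCompactSupport.isCompact.prod ψ.hasCompactSupport.isCompact)
    ((subset_tsupport _).trans (tsupport_tensor_subset θ ψ V))
  tsupport_subset' := (tsupport_tensor_subset θ ψ V).trans
    (prod_mono θ.tsupport_subset ψ.tsupport_subset)

/-- The test function `θ(t) ψ(x)` on `(0, T) × Ω`. -/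
def tensorCyl (θ : 𝓓(Om 0 T, ℝ)) (ψ : 𝓓(Om l r, ℝ)) : 𝓓(Cyl T l r, ℝ) where
  -- The factor `1` keeps the shape of `tsupport_tensor_subset`, with constant `V`.
  toFun p := θ p.1 * ψ p.2 * 1
  contDiff' := ((θ.contDiff.comp contDiff_fst).mul (ψ.contDiff.comp contDiff_snd)).mul
    contDiff_const
  hasCompactSupport' := HasCompactSupport.of_support_subset_isCompact
    (θ.hasCompactSupport.isCompact.prod ψ.hasCompactSupport.isCompact)
    ((subset_tsupport _).trans (tsupport_tensor_subset θ ψ fun _ => 1))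
  tsupport_subset' := (tsupport_tensor_subset θ ψ fun _ => 1).trans
    (prod_mono θ.tsupport_subset ψ.tsupport_subset)

/-- Extension of a test function on `(0, T)` to `(-∞, T)`. -/
def toPast (θ : 𝓓(Om 0 T, ℝ)) : 𝓓(Past T, ℝ) :=
  ⟨θ, θ.contDiff, θ.hasCompactSupport, θ.tsupport_subset.trans fun _ hx => hx.2⟩

theorem hasDerivAt_testFunction' {U : Opens ℝ} (θ : 𝓓(U, ℝ)) (t : ℝ) :
    HasDerivAt θ (deriv θ t) t :=
  ((contDiff_infty_iff_deriv.1 θ.contDiff).1 t).hasDerivAt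

theorem continuous_deriv_testFunction {U : Opens ℝ} (θ : 𝓓(U, ℝ)) : Continuous (deriv θ) :=
  (contDiff_infty_iff_deriv.1 θ.contDiff).2.continuous

theorem dx_tensorCyl (θ : 𝓓(Om 0 T, ℝ)) (ψ : 𝓓(Om l r, ℝ)) (p : ℝ × ℝ) :
    dx (tensorCyl θ ψ) p = θ p.1 * deriv ψ p.2 := by
  have := ((hasDerivAt_testFunction' ψ p.2).const_mul (θ p.1)).mul_const 1
  rw [mul_one] at this
  exact this.deriv

theorem hasDerivAt_fst_of_contDiff {V : ℝ × ℝ → ℝ} (hV : ContDiff ℝ (⊤ : ℕ∞) V) (p : ℝ × ℝ) :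
    HasDerivAt (fun s => V (s, p.2)) (dt V p) p.1 := by
  have h1 : Differentiable ℝ (fun s : ℝ => V (s, p.2)) :=
    (hV.comp (contDiff_id.prodMk contDiff_const)).differentiable (by simp)
  exact (h1 p.1).hasDerivAt

theorem hasDerivAt_snd_of_contDiff {V : ℝ × ℝ → ℝ} (hV : ContDiff ℝ (⊤ : ℕ∞) V) (p : ℝ × ℝ) :
    HasDerivAt (fun y => V (p.1, y)) (dx V p) p.2 := by
  have h1 : Differentiable ℝ (fun y : ℝ => V (p.1, y)) :=
    (hV.comp (contDiff_const.prodMk contDiff_id)).differentiable (by simp)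
  exact (h1 p.2).hasDerivAt

theorem dt_tensorInit (θ : 𝓓(Past T, ℝ)) (ψ : 𝓓(Om l r, ℝ)) {V : ℝ × ℝ → ℝ}
    (hV : ContDiff ℝ (⊤ : ℕ∞) V) (p : ℝ × ℝ) :
    dt (tensorInit θ ψ hV) p = deriv θ p.1 * ψ p.2 * V p + θ p.1 * ψ p.2 * dt V p :=
  (((hasDerivAt_testFunction' θ p.1).mul_const (ψ p.2)).mul (hasDerivAt_fst_of_contDiff hV p)).deriv

theorem dx_tensorInit (θ : 𝓓(Past T, ℝ)) (ψ : 𝓓(Om l r, ℝ)) {V : ℝ × ℝ → ℝ}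
    (hV : ContDiff ℝ (⊤ : ℕ∞) V) (p : ℝ × ℝ) :
    dx (tensorInit θ ψ hV) p = θ p.1 * deriv ψ p.2 * V p + θ p.1 * ψ p.2 * dx V p :=
  (((hasDerivAt_testFunction' ψ p.2).const_mul (θ p.1)).mul (hasDerivAt_snd_of_contDiff hV p)).deriv

theorem dt_const (c : ℝ) (p : ℝ × ℝ) : dt (fun _ => c) p = 0 := deriv_const _ _

theorem dx_const (c : ℝ) (p : ℝ × ℝ) : dx (fun _ => c) p = 0 := deriv_const _ _

theorem tensorInit_apply (θ : 𝓓(Past T, ℝ)) (ψ : 𝓓(Om l r, ℝ)) {V : ℝ × ℝ → ℝ}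
    (hV : ContDiff ℝ (⊤ : ℕ∞) V) (p : ℝ × ℝ) : tensorInit θ ψ hV p = θ p.1 * ψ p.2 * V p := rfl

theorem slice_tensorInit_one (θ : 𝓓(Past T, ℝ)) (ψ : 𝓓(Om l r, ℝ)) (t : ℝ) :
    slice (tensorInit θ ψ (V := fun _ => 1) contDiff_const) t = θ t • ψ := by
  ext x
  change θ t * ψ x * 1 = θ t * ψ x
  rw [mul_one]

theorem memLp_top_tensor {θ ψ : ℝ → ℝ} (hθ : Continuous θ) (hψ : Continuous ψ) :
    MemLp (fun p : ℝ × ℝ => θ p.1 * ψ p.2) ∞ (volCyl T l r) :=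
  memLp_volCyl_of_continuous (by fun_prop) _

end Tensor

/-! ### Lipschitz functions on space-time -/

section Lipschitz

variable {T l r : ℝ} {v : ℝ × ℝ → ℝ} {C : ℝ≥0}

theorem lipschitzWith_slice_fst (hv : LipschitzWith C v) (x : ℝ) :
    LipschitzWith C (fun s => v (s, x)) := by
  simpa [Function.comp_def] using hv.comp (LipschitzWith.prodMk_right x)

theorem lipschitzWith_slice_snd (hv : LipschitzWith C v) (t : ℝ) :
    LipschitzWith C (fun y => v (t, y)) := by
  simpa [Function.comp_def] using hv.comp (LipschitzWith.prodMk_left t)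

theorem measurable_dx (hv : LipschitzWith C v) : Measurable (dx v) :=
  measurable_deriv_with_param (f := fun t x => v (t, x)) hv.continuous

theorem measurable_dt (hv : LipschitzWith C v) : Measurable (dt v) :=
  (measurable_deriv_with_param (f := fun x t => v (t, x))
    (hv.continuous.comp continuous_swap)).comp measurable_swap

theorem abs_dx_le (hv : LipschitzWith C v) (p : ℝ × ℝ) : |dx v p| ≤ C :=
  norm_deriv_le_of_lipschitz (lipschitzWith_slice_snd hv p.1)

theorem abs_dt_le (hv : LipschitzWith C v) (p : ℝ × ℝ) : |dt v p| ≤ C :=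
  norm_deriv_le_of_lipschitz (lipschitzWith_slice_fst hv p.2)

theorem memLp_dx (hv : LipschitzWith C v) (p : ℝ≥0∞) : MemLp (dx v) p (volCyl T l r) :=
  MemLp.of_bound (measurable_dx hv).aestronglyMeasurable C
    (Filter.Eventually.of_forall (abs_dx_le hv))

theorem memLp_dt (hv : LipschitzWith C v) (p : ℝ≥0∞) : MemLp (dt v) p (volCyl T l r) :=
  MemLp.of_bound (measurable_dt hv).aestronglyMeasurable C
    (Filter.Eventually.of_forall (abs_dt_le hv))

theorem absolutelyContinuous_comp_lipschitz {F h : ℝ → ℝ} (hF : ContDiff ℝ 1 F)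
    (hh : LipschitzWith C h) (a b : ℝ) :
    AbsolutelyContinuousOnInterval (fun s => F (h s)) a b := by
  obtain ⟨M, hM⟩ := isCompact_uIcc.exists_bound_of_continuousOn (s := uIcc a b)
    hh.continuous.continuousOn
  obtain ⟨K, hK⟩ := (hF.contDiffOn (s := Icc (-M) M)).exists_lipschitzOnWith (by norm_num)
    (convex_Icc _ _) isCompact_Icc
  refine LipschitzOnWith.absolutelyContinuousOnInterval (K := K * C) ?_
  exact hK.comp (hh.lipschitzOnWith) fun s hs => abs_le.1 (hM s hs)

theorem ae_differentiableAt_slice (hv : LipschitzWith C v) :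
    ∀ᵐ p : ℝ × ℝ, HasDerivAt (fun s => v (s, p.2)) (dt v p) p.1 ∧
      HasDerivAt (fun y => v (p.1, y)) (dx v p) p.2 := by
  filter_upwards [hv.ae_differentiableAt] with p hp
  have h1 : DifferentiableAt ℝ (fun s : ℝ => v (s, p.2)) p.1 :=
    DifferentiableAt.comp p.1 (f := fun s : ℝ => (s, p.2)) (g := v) hp (by fun_prop)
  have h2 : DifferentiableAt ℝ (fun y : ℝ => v (p.1, y)) p.2 :=
    DifferentiableAt.comp p.2 (f := fun y : ℝ => (p.1, y)) (g := v) hp (by fun_prop)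
  exact ⟨h1.hasDerivAt, h2.hasDerivAt⟩

theorem hasDerivAt_comp_of_contDiff {F h : ℝ → ℝ} {h' s : ℝ} (hF : ContDiff ℝ 1 F)
    (hh : HasDerivAt h h' s) : HasDerivAt (fun s => F (h s)) (deriv F (h s) * h') s :=
  HasDerivAt.comp s ((hF.differentiable (by norm_num)) (h s)).hasDerivAt hh

theorem integrable_comp_mul (hv : LipschitzWith C v) {F : ℝ → ℝ} (hF : Continuous F)
    {g : ℝ × ℝ → ℝ} (hg : Integrable g (volCyl T l r)) :
    Integrable (fun p => F (v p) * g p) (volCyl T l r) :=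
  Integrable.memLp_top_mul hg (memLp_volCyl_of_continuous (hF.comp hv.continuous) _)

theorem integral_time_by_parts (hT : 0 < T) {K : ℝ → ℝ} (hK : AbsolutelyContinuousOnInterval K 0 T)
    (θ : 𝓓(Past T, ℝ)) :
    ∫ t in Ioo 0 T, (deriv θ t * K t + θ t * deriv K t) = -(θ 0 * K 0) := by
  have h2 : AbsolutelyContinuousOnInterval θ 0 T :=
    (θ.contDiff.of_le (mod_cast le_top) : ContDiff ℝ 1 θ).contDiffOn.absolutelyContinuousOnInterval
  have h3 := h2.integral_deriv_mul_eq_sub hK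
  have h4 : θ T = 0 := by
    by_contra h
    exact lt_irrefl T (θ.tsupport_subset (subset_tsupport _ h))
  rw [h4, zero_mul, zero_sub, intervalIntegral_eq_setIntegral_Ioo hT.le] at h3
  exact h3

theorem integral_space_by_parts (hlr : l < r) {K : ℝ → ℝ}
    (hK : AbsolutelyContinuousOnInterval K l r) (ψ : 𝓓(Om l r, ℝ)) :
    ∫ x in Ioo l r, (deriv ψ x * K x + ψ x * deriv K x) = 0 := by
  have h2 : AbsolutelyContinuousOnInterval ψ l r :=
    (ψ.contDiff.of_le (mod_cast le_top) : ContDiff ℝ 1 ψ).contDiffOn.absolutelyContinuousOnInterval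
  have h3 := h2.integral_deriv_mul_eq_sub hK
  rw [testFunction_eq_zero_of_notMem ψ (x := r) (by simp),
    testFunction_eq_zero_of_notMem ψ (x := l) (by simp), zero_mul, zero_mul, sub_zero,
    intervalIntegral_eq_setIntegral_Ioo hlr.le] at h3
  exact h3

/-- Integration by parts in time on the lines x = const, where `F ∘ v` is absolutely continuous. By
Rademacher and Fubini, on almost every line the chain rule holds at almost every time. The
right-hand side is the boundary term at `t = 0`. -/
theorem integral_tensor_dt_comp (hT : 0 < T) (hv : LipschitzWith C v)
    {F : ℝ → ℝ} (hF : ContDiff ℝ 1 F) (θ : 𝓓(Past T, ℝ)) (ψ : 𝓓(Om l r, ℝ)) :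
    ∫ p in Ioo 0 T ×ˢ Ioo l r, (deriv θ p.1 * ψ p.2 * F (v p)
        + θ p.1 * ψ p.2 * (deriv F (v p) * dt v p))
      = -∫ x in Ioo l r, θ 0 * ψ x * F (v (0, x)) := by
  have hi : Integrable (fun p : ℝ × ℝ => deriv θ p.1 * ψ p.2 * F (v p)
      + θ p.1 * ψ p.2 * (deriv F (v p) * dt v p)) (volCyl T l r) := by
    refine Integrable.add ?_ ?_
    · exact Integrable.memLp_top_mul ((memLp_volCyl_of_continuous
        (hF.continuous.comp hv.continuous) 1).integrable le_rfl)
        (memLp_top_tensor (continuous_deriv_testFunction θ) ψ.continuous)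
    · exact Integrable.memLp_top_mul (integrable_comp_mul hv (hF.continuous_deriv le_rfl)
        ((memLp_dt hv 1).integrable le_rfl)) (memLp_top_tensor θ.continuous ψ.continuous)
  rw [integral_volCyl_symm hi, ← integral_neg]
  have hae : ∀ᵐ x ∂(volOm l r), ∀ᵐ t ∂(volOm 0 T),
      HasDerivAt (fun s => v (s, x)) (dt v (t, x)) t := by
    have h1 : ∀ᵐ p ∂((volOm l r).prod (volOm 0 T)),
        HasDerivAt (fun s => v (s, p.1)) (dt v p.swap) p.2 := by
      have h2 : ∀ᵐ p ∂((volOm 0 T).prod (volOm l r)),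
          HasDerivAt (fun s => v (s, p.2)) (dt v p) p.1 := by
        rw [← volCyl_eq_prod]
        exact ae_restrict_of_ae ((ae_differentiableAt_slice hv).mono fun p hp => hp.1)
      have := (Measure.measurePreserving_swap (μ := volOm l r) (ν := volOm 0 T)).quasiMeasurePreserving.ae h2
      exact this
    exact Measure.ae_ae_of_ae_prod h1
  refine integral_congr_ae ?_
  filter_upwards [hae] with x hx
  have h1 := integral_time_by_parts hT
    (absolutelyContinuous_comp_lipschitz hF (lipschitzWith_slice_fst hv x) 0 T) θ
  have h2 : ∫ t in Ioo 0 T, (deriv θ t * ψ x * F (v (t, x))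
      + θ t * ψ x * (deriv F (v (t, x)) * dt v (t, x)))
      = ψ x * ∫ t in Ioo 0 T, (deriv θ t * F (v (t, x))
        + θ t * deriv (fun s => F (v (s, x))) t) := by
    rw [← integral_const_mul]
    refine integral_congr_ae ?_
    filter_upwards [hx] with t ht
    rw [(hasDerivAt_comp_of_contDiff hF ht).deriv]
    ring
  rw [h2, h1]
  ring

theorem integral_tensor_dx_comp (hlr : l < r) (hv : LipschitzWith C v)
    {F : ℝ → ℝ} (hF : ContDiff ℝ 1 F) (θ : 𝓓(Past T, ℝ)) (ψ : 𝓓(Om l r, ℝ)) :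
    ∫ p in Ioo 0 T ×ˢ Ioo l r, (θ p.1 * deriv ψ p.2 * F (v p)
        + θ p.1 * ψ p.2 * (deriv F (v p) * dx v p)) = 0 := by
  have hi : Integrable (fun p : ℝ × ℝ => θ p.1 * deriv ψ p.2 * F (v p)
      + θ p.1 * ψ p.2 * (deriv F (v p) * dx v p)) (volCyl T l r) := by
    refine Integrable.add ?_ ?_
    · exact Integrable.memLp_top_mul ((memLp_volCyl_of_continuous
        (hF.continuous.comp hv.continuous) 1).integrable le_rfl)
        (memLp_top_tensor θ.continuous (continuous_deriv_testFunction ψ))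
    · exact Integrable.memLp_top_mul (integrable_comp_mul hv (hF.continuous_deriv le_rfl)
        ((memLp_dx hv 1).integrable le_rfl)) (memLp_top_tensor θ.continuous ψ.continuous)
  rw [integral_volCyl hi]
  have hae : ∀ᵐ t ∂(volOm 0 T), ∀ᵐ x ∂(volOm l r),
      HasDerivAt (fun y => v (t, y)) (dx v (t, x)) x :=
    ae_ae_of_ae_volCyl (ae_restrict_of_ae ((ae_differentiableAt_slice hv).mono fun p hp => hp.2))
  refine integral_eq_zero_of_ae ?_
  filter_upwards [hae] with t ht
  have h1 := integral_space_by_parts hlr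
    (absolutelyContinuous_comp_lipschitz hF (lipschitzWith_slice_snd hv t) l r) ψ
  have h2 : ∫ x in Ioo l r, (θ t * deriv ψ x * F (v (t, x))
      + θ t * ψ x * (deriv F (v (t, x)) * dx v (t, x)))
      = θ t * ∫ x in Ioo l r, (deriv ψ x * F (v (t, x))
        + ψ x * deriv (fun y => F (v (t, y))) x) := by
    rw [← integral_const_mul]
    refine integral_congr_ae ?_
    filter_upwards [ht] with x hx
    rw [(hasDerivAt_comp_of_contDiff hF hx).deriv]
    ring
  simp only [Pi.zero_apply] at h2 ⊢
  rw [h2, h1, mul_zero]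

theorem intervalIntegral_dx (hv : LipschitzWith C v) (t x : ℝ) :
    ∫ y in l..x, dx v (t, y) = v (t, x) - v (t, l) :=
  ((lipschitzWith_slice_snd hv t).lipschitzOnWith
    (s := uIcc l x)).absolutelyContinuousOnInterval.integral_deriv_eq_sub

end Lipschitz

/-! ### From space-time identities to almost every time slice. -/

section Slices

variable {T l r : ℝ} {v : ℝ × ℝ → ℝ} {C : ℝ≥0}

theorem integral_tensor_eq {h : ℝ × ℝ → ℝ} (hh : Integrable h (volCyl T l r)) {θ : ℝ → ℝ}
    (hθ : Continuous θ) :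
    ∫ p in Ioo 0 T ×ˢ Ioo l r, θ p.1 * h p = ∫ t in Ioo 0 T, θ t * ∫ x in Ioo l r, h (t, x) := by
  have hθ' : MemLp (fun p : ℝ × ℝ => θ p.1) ∞ (volCyl T l r) :=
    memLp_volCyl_of_continuous (hθ.comp continuous_fst) _
  rw [integral_volCyl (Integrable.memLp_top_mul hh hθ')]
  simp_rw [integral_const_mul]

/-- Testing with `θ(t) ψ(x)` and varying `θ` localizes the identity in time. The exceptional set
depends on `ψ`. -/
theorem ae_integral_slice_mul_deriv_eq {u ux : ℝ × ℝ → ℝ} (hu : MemL2H1 T l r u ux)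
    (ψ : 𝓓(Om l r, ℝ)) :
    ∀ᵐ t ∂(volOm 0 T), ∫ x in Ioo l r, u (t, x) * deriv ψ x = -∫ x in Ioo l r, ux (t, x) * ψ x := by
  obtain ⟨hu2, hux2, -, -, hw⟩ := hu
  have hu1 : Integrable u (volCyl T l r) := hu2.integrable (by norm_num)
  have hux1 : Integrable ux (volCyl T l r) := hux2.integrable (by norm_num)
  have i1 : Integrable (fun p : ℝ × ℝ => u p * deriv ψ p.2) (volCyl T l r) :=
    Integrable.mul_memLp_top hu1 (memLp_volCyl_of_continuous
      ((continuous_deriv_testFunction ψ).comp continuous_snd) _)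
  have i2 : Integrable (fun p : ℝ × ℝ => ux p * ψ p.2) (volCyl T l r) :=
    Integrable.mul_memLp_top hux1 (memLp_volCyl_of_continuous
      (ψ.continuous.comp continuous_snd) _)
  have key := ae_eq_zero_of_integral_testFunction_mul_eq_zero
    (integrable_integral_slice (i1.add i2)) (fun θ => ?_)
  · filter_upwards [key, ae_integrable_slice i1, ae_integrable_slice i2] with t h1 h2 h3
    have h4 : ∫ x in Ioo l r, (u (t, x) * deriv ψ x + ux (t, x) * ψ x) = 0 := h1
    rw [integral_add h2 h3] at h4
    linarith
  · rw [← integral_tensor_eq (i1.add i2) θ.continuous]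
    have h1 := hw (tensorCyl θ ψ)
    simp_rw [dx_tensorCyl] at h1
    have e2 : ∀ p : ℝ × ℝ, (tensorCyl θ ψ : 𝓓(Cyl T l r, ℝ)) p = θ p.1 * ψ p.2 := fun p =>
      mul_one _
    simp_rw [e2] at h1
    have hθ : MemLp (fun p : ℝ × ℝ => θ p.1) ∞ (volCyl T l r) :=
      memLp_volCyl_of_continuous (θ.continuous.comp continuous_fst) _
    have e3 : ∀ p : ℝ × ℝ, θ p.1 * ((fun p : ℝ × ℝ => u p * deriv ψ p.2)
        + fun p : ℝ × ℝ => ux p * ψ p.2) p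
        = θ p.1 * (u p * deriv ψ p.2) + θ p.1 * (ux p * ψ p.2) := fun p => mul_add _ _ _
    simp_rw [e3]
    rw [integral_add (Integrable.memLp_top_mul i1 hθ) (Integrable.memLp_top_mul i2 hθ)]
    have e4 : ∀ p : ℝ × ℝ, θ p.1 * (u p * deriv ψ p.2) = u p * (θ p.1 * deriv ψ p.2) :=
      fun p => by ring
    have e5 : ∀ p : ℝ × ℝ, θ p.1 * (ux p * ψ p.2) = ux p * (θ p.1 * ψ p.2) :=
      fun p => by ring
    simp_rw [e4, e5]
    rw [h1, neg_add_cancel]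

/-- Almost every time slice of `u - v` is in `H¹₀(l, r)`. -/
theorem ae_slice_sub_mem_H10 (hlr : l < r) {u ux : ℝ × ℝ → ℝ} (hu : MemL2H1 T l r u ux)
    (hv : LipschitzWith C v)
    (hb : ∀ᵐ t ∂(volOm 0 T), HasTraces l r (fun x => u (t, x)) (v (t, l)) (v (t, r))) :
    ∀ᵐ t ∂(volOm 0 T), ∫ x in Ioo l r, (ux (t, x) - dx v (t, x)) = 0 ∧
      ∀ᵐ x ∂(volOm l r), u (t, x) - v (t, x) = ∫ y in l..x, (ux (t, y) - dx v (t, y)) := by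
  obtain ⟨ψ, hψ⟩ := exists_seq_testFunction_dense_deriv hlr
  filter_upwards [hb, ae_memLp_two_slice hu.1, ae_memLp_two_slice hu.2.1,
    ae_all_iff.2 fun n => ae_integral_slice_mul_deriv_eq hu (ψ n)] with t h1 h2 h3 h4
  obtain ⟨c, hc⟩ := ae_eq_const_add_primitive hlr hψ h2 h3 h4
  obtain ⟨z, hzc, huz, hzl, hzr⟩ := h1
  have hy1 : Integrable (fun x => ux (t, x)) (volOm l r) := h3.integrable (by norm_num)
  -- Two continuous functions that agree almost everywhere on the interval agree on its closure.
  -- This transfers the traces to the primitive: the value at `l` fixes `c`, and the value at `r`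
  -- gives mean zero.
  have hEq : EqOn z (fun x => c + ∫ s in l..x, ux (t, s)) (Icc l r) := by
    refine Measure.eqOn_Icc_of_ae_eq volume hlr.ne ?_ hzc
      (continuousOn_const.add (continuousOn_primitive_Icc hlr.le hy1))
    rw [← restrict_Ioo_eq_restrict_Icc]
    filter_upwards [hc, huz] with x hx hx'
    rw [← hx', hx]
  have hcl : c = v (t, l) := by
    have := hEq (left_mem_Icc.2 hlr.le)
    rw [hzl] at this
    simpa using this.symm
  have hsub : ∀ x ∈ Icc l r, ∫ y in l..x, (ux (t, y) - dx v (t, y))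
      = (∫ y in l..x, ux (t, y)) - (v (t, x) - v (t, l)) := by
    intro x hx
    rw [intervalIntegral.integral_sub (intervalIntegrable_of_integrable_volOm hy1
      (left_mem_Icc.2 hlr.le) hx), intervalIntegral_dx hv]
    refine IntervalIntegrable.mono_fun' (g := fun _ => (C : ℝ)) intervalIntegrable_const
      ((measurable_dx hv).comp measurable_prodMk_left).aestronglyMeasurable
      (Filter.Eventually.of_forall fun y => abs_dx_le hv _)
  constructor
  · rw [← intervalIntegral_eq_setIntegral_Ioo hlr.le, hsub r (right_mem_Icc.2 hlr.le)]
    have := hEq (right_mem_Icc.2 hlr.le)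
    rw [hzr, hcl] at this
    simp only at this
    linarith
  · filter_upwards [hc, ae_restrict_mem measurableSet_Ioo] with x hx hx'
    rw [hx, hsub x (Ioo_subset_Icc_self hx'), hcl]
    ring

/-- Homogeneity: the defining supremum is applied to a multiple of `φ` whose derivative has norm at
most one. -/
theorem abs_apply_le_normHm1 {F : 𝓓'(Om l r, ℝ)} (hF : normHm1 F ≠ ∞) (φ : 𝓓(Om l r, ℝ)) :
    |F φ| ≤ (normHm1 F).toReal * √(sqInt (volOm l r) (deriv φ)) := by
  have hφ2 := memLp_deriv_testFunction φ 2
  have key : ∀ c : ℝ, 0 < c → c * √(sqInt (volOm l r) (deriv φ)) ≤ 1 →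
      c * |F φ| ≤ (normHm1 F).toReal := by
    intro c hc h1
    have hd : deriv (c • φ : 𝓓(Om l r, ℝ)) = c • deriv φ := by
      ext x
      exact ((hasDerivAt_testFunction φ x).const_smul c).deriv
    have h2 : eLpNorm (deriv (c • φ : 𝓓(Om l r, ℝ))) 2 (volOm l r) ≤ 1 := by
      rw [hd, eLpNorm_const_smul, eLpNorm_two_eq_ofReal_sqrt hφ2, Real.enorm_of_nonneg hc.le,
        ← ENNReal.ofReal_mul hc.le]
      exact ENNReal.ofReal_le_one.2 h1
    have h3 : ‖F (c • φ)‖ₑ ≤ normHm1 F := le_iSup₂_of_le (c • φ) h2 le_rfl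
    have h4 := ENNReal.toReal_mono hF h3
    rw [map_smul, toReal_enorm, norm_smul, Real.norm_of_nonneg hc.le, Real.norm_eq_abs] at h4
    exact h4
  set m := √(sqInt (volOm l r) (deriv φ)) with hm
  have hm0 : 0 ≤ m := Real.sqrt_nonneg _
  have hN0 : 0 ≤ (normHm1 F).toReal := ENNReal.toReal_nonneg
  rcases hm0.eq_or_lt with h0 | hpos
  · rw [← h0, mul_zero]
    by_contra hne
    push Not at hne
    -- If the derivative has norm zero, every multiple of `φ` is admissible; this one would make the
    -- value of `F` exceed its norm.
    have := key (((normHm1 F).toReal + 1) / |F φ|) (by positivity) (by rw [← h0]; simp)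
    rw [div_mul_cancel₀ _ hne.ne'] at this
    linarith
  · have := key (1 / m) (by positivity) (by rw [one_div, inv_mul_cancel₀ hpos.ne'])
    rwa [one_div, ← div_eq_inv_mul, div_le_iff₀ hpos] at this

theorem ae_normHm1_ne_top {r₂ : ℝ → 𝓓'(Om l r, ℝ)} (hr₂ : MemL2Hm1 T r₂) :
    ∀ᵐ t ∂(volOm 0 T), normHm1 (r₂ t) ≠ ∞ := by
  have h1 : ∫⁻ s in Ioo 0 T, normHm1 (r₂ s) ^ 2 ≠ ∞ := fun h => by
    have := hr₂.2.2
    rw [normL2Hm1, h] at this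
    simp at this
  filter_upwards [ae_lt_top' (hr₂.2.1.pow_const 2) h1] with t ht
  intro h
  rw [h] at ht
  simp at ht

theorem memLp_two_toReal_normHm1 {r₂ : ℝ → 𝓓'(Om l r, ℝ)} (hr₂ : MemL2Hm1 T r₂) :
    MemLp (fun t => (normHm1 (r₂ t)).toReal) 2 (volOm 0 T) := by
  have h1 : ∫⁻ s in Ioo 0 T, normHm1 (r₂ s) ^ 2 ≠ ∞ := fun h => by
    have := hr₂.2.2
    rw [normL2Hm1, h] at this
    simp at this
  have hm : AEMeasurable (fun t => (normHm1 (r₂ t)).toReal) (volOm 0 T) := hr₂.2.1.ennreal_toReal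
  refine (memLp_two_iff_integrable_sq hm.aestronglyMeasurable).2 ?_
  have := integrable_toReal_of_lintegral_ne_top (hr₂.2.1.pow_const 2) h1
  simpa [ENNReal.toReal_pow] using this

theorem ae_memLp_two_of_memL1L2 {r₁ : ℝ × ℝ → ℝ} (hr₁ : MemL1L2 T l r r₁) :
    Integrable (fun t => (eLpNorm (fun x => r₁ (t, x)) 2 (volOm l r)).toReal) (volOm 0 T) ∧
    (∀ᵐ t ∂(volOm 0 T), MemLp (fun x => r₁ (t, x)) 2 (volOm l r)) ∧
      Integrable r₁ (volCyl T l r) := by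
  have hm : AEMeasurable (fun t => eLpNorm (fun x => r₁ (t, x)) 2 (volOm l r)) (volOm 0 T) := by
    have h1 : AEMeasurable (fun p => ‖r₁ p‖ₑ ^ (2 : ℝ)) ((volOm 0 T).prod (volOm l r)) := by
      rw [← volCyl_eq_prod]
      exact hr₁.1.enorm.pow_const _
    have h2 := h1.lintegral_prod_right'
    refine (h2.pow_const (1 / 2 : ℝ)).congr (Filter.Eventually.of_forall fun t => ?_)
    simp [eLpNorm_eq_lintegral_rpow_enorm_toReal]
  have hfin : ∫⁻ t in Ioo 0 T, eLpNorm (fun x => r₁ (t, x)) 2 (volOm l r) ≠ ∞ := hr₁.2.ne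
  refine ⟨integrable_toReal_of_lintegral_ne_top hm hfin, ?_, hr₁.1, ?_⟩
  · filter_upwards [ae_lt_top' hm hfin, ae_aestronglyMeasurable_slice hr₁.1] with t h1 h2
    exact ⟨h2, h1⟩
  · rw [hasFiniteIntegral_iff_enorm, volCyl_eq_prod, lintegral_prod]
    · have hle : ∀ᵐ t ∂(volOm 0 T), ∫⁻ x in Ioo l r, ‖r₁ (t, x)‖ₑ
          ≤ eLpNorm (fun x => r₁ (t, x)) 2 (volOm l r) * ENNReal.ofReal (r - l) ^ (1 / 2 : ℝ) := by
        filter_upwards [ae_aestronglyMeasurable_slice hr₁.1] with t ht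
        have := eLpNorm_le_eLpNorm_mul_rpow_measure_univ (p := 1) (q := 2) (by norm_num) ht
        rw [eLpNorm_one_eq_lintegral_enorm] at this
        refine this.trans (le_of_eq ?_)
        congr 2
        · simp
        · norm_num
      refine (lintegral_mono_ae hle).trans_lt ?_
      rw [lintegral_mul_const'' _ hm]
      exact ENNReal.mul_lt_top hr₁.2 (by
        refine ENNReal.rpow_lt_top_of_nonneg (by norm_num) ENNReal.ofReal_ne_top)
    · rw [← volCyl_eq_prod]
      exact hr₁.1.enorm

/-- Since `v` is Lipschitz, ∂ₜ and ∂ₓ f(v) can be moved off the test function, and varying `θ`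
localizes in time. The diffusive flux stays paired with `deriv ψ`, because A(v) ∂ₓv is merely
bounded and cannot be differentiated. -/
theorem ae_perturbed_slice (hT : 0 < T) (hlr : l < r) {ε : ℝ} {f A : ℝ → ℝ} (hf : ContDiff ℝ 1 f)
    (hA : Continuous A) {r₁ : ℝ × ℝ → ℝ} (hr₁ : MemL1L2 T l r r₁) {r₂ : ℝ → 𝓓'(Om l r, ℝ)}
    (hr₂ : MemL2Hm1 T r₂) {v₀ : ℝ → ℝ} (hv : LipschitzWith C v)
    (hs : IsLipschitzPerturbedSolution T l r ε f A r₁ r₂ v₀ v) (ψ : 𝓓(Om l r, ℝ)) :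
    ∀ᵐ t ∂(volOm 0 T), (∫ x in Ioo l r, ε * (A (v (t, x)) * dx v (t, x)) * deriv ψ x)
      + (∫ x in Ioo l r, (dt v (t, x) + deriv f (v (t, x)) * dx v (t, x) - r₁ (t, x)) * ψ x)
      = ε * r₂ t ψ := by
  obtain ⟨-, -, hr₁i⟩ := ae_memLp_two_of_memL1L2 hr₁
  have hdt := (memLp_dt (T := T) (l := l) (r := r) hv 1).integrable le_rfl
  have hdx := (memLp_dx (T := T) (l := l) (r := r) hv 1).integrable le_rfl
  have hAdx : Integrable (fun p => ε * (A (v p) * dx v p)) (volCyl T l r) :=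
    (integrable_comp_mul hv hA hdx).const_mul ε
  have hb : Integrable (fun p => dt v p + deriv f (v p) * dx v p - r₁ p) (volCyl T l r) :=
    (hdt.add (integrable_comp_mul hv (hf.continuous_deriv le_rfl) hdx)).sub hr₁i
  have hψ' : MemLp (fun p : ℝ × ℝ => deriv ψ p.2) ∞ (volCyl T l r) :=
    memLp_volCyl_of_continuous ((continuous_deriv_testFunction ψ).comp continuous_snd) _
  have hψ : MemLp (fun p : ℝ × ℝ => ψ p.2) ∞ (volCyl T l r) :=
    memLp_volCyl_of_continuous (ψ.continuous.comp continuous_snd) _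
  have i1 : Integrable (fun p : ℝ × ℝ => ε * (A (v p) * dx v p) * deriv ψ p.2) (volCyl T l r) :=
    Integrable.mul_memLp_top hAdx hψ'
  have i2 : Integrable (fun p : ℝ × ℝ => (dt v p + deriv f (v p) * dx v p - r₁ p) * ψ p.2)
    (volCyl T l r) := Integrable.mul_memLp_top hb hψ
  have hr₂i : Integrable (fun t => r₂ t ψ) (volOm 0 T) := by
    refine (((memLp_two_toReal_normHm1 hr₂).integrable (by norm_num)).mul_const
      (√(sqInt (volOm l r) (deriv ψ)))).mono' (hr₂.1 ψ) ?_
    filter_upwards [ae_normHm1_ne_top hr₂] with t ht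
    exact abs_apply_le_normHm1 ht ψ
  have j : Integrable (fun t => (∫ x in Ioo l r, ((fun p : ℝ × ℝ =>
      ε * (A (v p) * dx v p) * deriv ψ p.2) + fun p : ℝ × ℝ =>
        (dt v p + deriv f (v p) * dx v p - r₁ p) * ψ p.2) (t, x)) - ε * r₂ t ψ) (volOm 0 T) :=
    (integrable_integral_slice (i1.add i2)).sub (hr₂i.const_mul ε)
  have key := ae_eq_zero_of_integral_testFunction_mul_eq_zero j (fun θ => ?_)
  · filter_upwards [key, ae_integrable_slice i1, ae_integrable_slice i2] with t h1 h2 h3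
    simp only [Pi.add_apply] at h1
    rw [integral_add h2 h3] at h1
    linarith
  · have hθ : MemLp (fun p : ℝ × ℝ => θ p.1) ∞ (volCyl T l r) :=
      memLp_volCyl_of_continuous (θ.continuous.comp continuous_fst) _
    have hθ1 : MemLp θ ∞ (volOm 0 T) := memLp_testFunction θ _
    have h1 := hs.weak_eq (tensorInit (toPast θ) ψ (V := fun _ => 1) contDiff_const)
    have h2 := integral_tensor_dt_comp hT hv (contDiff_id (n := 1)) (toPast θ) ψ (l := l) (r := r)
    have h3 := integral_tensor_dx_comp hlr hv hf (toPast θ) ψ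
    -- Here `θ` is supported in `(0, T)`, so all initial terms drop out.
    have hθ0 : toPast θ 0 = 0 := testFunction_eq_zero_of_notMem θ (by simp)
    simp only [dt_tensorInit, dx_tensorInit, tensorInit_apply, dt_const, dx_const,
      slice_tensorInit_one, map_smul, hθ0, zero_mul, mul_zero, integral_zero, add_zero, mul_one,
      smul_eq_mul, neg_zero, deriv_id', id, one_mul] at h1 h2
    have e1 : ∀ t, θ t * ((∫ x in Ioo l r, ((fun p : ℝ × ℝ =>
      ε * (A (v p) * dx v p) * deriv ψ p.2) + fun p : ℝ × ℝ =>
        (dt v p + deriv f (v p) * dx v p - r₁ p) * ψ p.2) (t, x)) - ε * r₂ t ψ)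
        = θ t * (∫ x in Ioo l r, ((fun p : ℝ × ℝ =>
      ε * (A (v p) * dx v p) * deriv ψ p.2) + fun p : ℝ × ℝ =>
        (dt v p + deriv f (v p) * dx v p - r₁ p) * ψ p.2) (t, x)) - ε * (θ t * r₂ t ψ) :=
      fun t => by ring
    simp_rw [e1]
    rw [integral_sub (Integrable.memLp_top_mul (integrable_integral_slice (i1.add i2)) hθ1)
      ((Integrable.memLp_top_mul hr₂i hθ1).const_mul ε),
      ← integral_tensor_eq (i1.add i2) θ.continuous, integral_const_mul]
    have cθ : Continuous (deriv θ) := continuous_deriv_testFunction θ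
    have hv1 : Integrable v (volCyl T l r) :=
      (memLp_volCyl_of_continuous hv.continuous 1).integrable le_rfl
    have hf1 : Integrable (fun p => f (v p)) (volCyl T l r) :=
      (memLp_volCyl_of_continuous (hf.continuous.comp hv.continuous) 1).integrable le_rfl
    have k1 : Integrable (fun p : ℝ × ℝ => deriv θ p.1 * ψ p.2 * v p + θ p.1 * ψ p.2 * dt v p)
        (volCyl T l r) :=
      (Integrable.memLp_top_mul hv1 (memLp_top_tensor cθ ψ.continuous)).add
        (Integrable.memLp_top_mul hdt (memLp_top_tensor θ.continuous ψ.continuous))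
    have k2 : Integrable (fun p : ℝ × ℝ => θ p.1 * deriv ψ p.2 * f (v p)
        + θ p.1 * ψ p.2 * (deriv f (v p) * dx v p)) (volCyl T l r) :=
      (Integrable.memLp_top_mul hf1 (memLp_top_tensor θ.continuous
        (continuous_deriv_testFunction ψ))).add
        (Integrable.memLp_top_mul (integrable_comp_mul hv (hf.continuous_deriv le_rfl) hdx)
          (memLp_top_tensor θ.continuous ψ.continuous))
    have k3 : Integrable (fun p : ℝ × ℝ => θ p.1 * ((fun p : ℝ × ℝ =>
      ε * (A (v p) * dx v p) * deriv ψ p.2) + fun p : ℝ × ℝ =>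
        (dt v p + deriv f (v p) * dx v p - r₁ p) * ψ p.2) p) (volCyl T l r) :=
      Integrable.memLp_top_mul (i1.add i2) hθ
    have e2 : ∫ p in Ioo 0 T ×ˢ Ioo l r, (deriv (toPast θ) p.1 * ψ p.2 * v p
        + toPast θ p.1 * deriv ψ p.2 * (f (v p) - ε * (A (v p) * dx v p))
        + r₁ p * (toPast θ p.1 * ψ p.2))
        = ((∫ p in Ioo 0 T ×ˢ Ioo l r, (deriv θ p.1 * ψ p.2 * v p + θ p.1 * ψ p.2 * dt v p))
          + ∫ p in Ioo 0 T ×ˢ Ioo l r, (θ p.1 * deriv ψ p.2 * f (v p)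
            + θ p.1 * ψ p.2 * (deriv f (v p) * dx v p)))
          - ∫ p in Ioo 0 T ×ˢ Ioo l r, θ p.1 * ((fun p : ℝ × ℝ =>
            ε * (A (v p) * dx v p) * deriv ψ p.2) + fun p : ℝ × ℝ =>
            (dt v p + deriv f (v p) * dx v p - r₁ p) * ψ p.2) p := by
      refine Eq.trans (integral_congr_ae (Filter.Eventually.of_forall fun p => ?_))
        ((integral_sub (k1.add k2) k3).trans (congrArg₂ _ (integral_add k1 k2) rfl))
      simp only [Pi.add_apply]
      change deriv θ p.1 * ψ p.2 * v p
        + θ p.1 * deriv ψ p.2 * (f (v p) - ε * (A (v p) * dx v p))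
        + r₁ p * (θ p.1 * ψ p.2) = _
      ring
    have h2' : ∫ p in Ioo 0 T ×ˢ Ioo l r,
      (deriv θ p.1 * ψ p.2 * v p + θ p.1 * ψ p.2 * dt v p) = 0 := h2
    have h3' : ∫ p in Ioo 0 T ×ˢ Ioo l r, (θ p.1 * deriv ψ p.2 * f (v p)
            + θ p.1 * ψ p.2 * (deriv f (v p) * dx v p)) = 0 := h3
    rw [e2, h2', h3'] at h1
    have h1' : 0 + 0 - (∫ p in Ioo 0 T ×ˢ Ioo l r, θ p.1 * ((fun p : ℝ × ℝ =>
            ε * (A (v p) * dx v p) * deriv ψ p.2) + fun p : ℝ × ℝ =>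
            (dt v p + deriv f (v p) * dx v p - r₁ p) * ψ p.2) p)
            + ε * ∫ t in Ioo 0 T, θ t * r₂ t ψ = 0 := h1
    linarith

/-- The perturbed equation at almost every time, tested with `H¹₀` functions. -/
theorem ae_perturbed_slice_bound (hT : 0 < T) (hlr : l < r) {ε : ℝ} (hε : 0 < ε) {f A : ℝ → ℝ}
    (hf : ContDiff ℝ 1 f) (hA : Continuous A) {r₁ : ℝ × ℝ → ℝ} (hr₁ : MemL1L2 T l r r₁)
    {r₂ : ℝ → 𝓓'(Om l r, ℝ)} (hr₂ : MemL2Hm1 T r₂) {v₀ : ℝ → ℝ} (hv : LipschitzWith C v)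
    (hs : IsLipschitzPerturbedSolution T l r ε f A r₁ r₂ v₀ v) :
    ∀ᵐ t ∂(volOm 0 T), ∀ g : ℝ → ℝ, MemLp g 2 (volOm l r) → ∫ x in Ioo l r, g x = 0 →
      |(∫ x in Ioo l r, ε * (A (v (t, x)) * dx v (t, x)) * g x)
        + ∫ x in Ioo l r, (dt v (t, x) + deriv f (v (t, x)) * dx v (t, x) - r₁ (t, x))
          * ∫ y in l..x, g y|
      ≤ ε * (normHm1 (r₂ t)).toReal * √(sqInt (volOm l r) g) := by
  obtain ⟨ψ, hψ⟩ := exists_seq_testFunction_dense_deriv hlr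
  have hdx2 : MemLp (fun p => ε * (A (v p) * dx v p)) 2 (volCyl T l r) := by
    have h1 : MemLp (fun p => A (v p)) ∞ (volCyl T l r) :=
      memLp_volCyl_of_continuous (hA.comp hv.continuous) _
    have h2 : MemLp (fun p => A (v p) * dx v p) 2 (volCyl T l r) :=
      (memLp_dx hv 2).mul' h1
    exact h2.const_mul ε
  have hb : Integrable (fun p => dt v p + deriv f (v p) * dx v p - r₁ p) (volCyl T l r) :=
    (((memLp_dt hv 1).integrable le_rfl).add (integrable_comp_mul hv (hf.continuous_deriv le_rfl)
      ((memLp_dx hv 1).integrable le_rfl))).sub (ae_memLp_two_of_memL1L2 hr₁).2.2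
  -- The countably many null sets are united first; only then is `g` introduced and reached by
  -- density, so the set of good times does not depend on `g`.
  filter_upwards [ae_all_iff.2 fun n => ae_perturbed_slice hT hlr hf hA hr₁ hr₂ hv hs (ψ n),
    ae_memLp_two_slice hdx2, ae_integrable_slice hb, ae_normHm1_ne_top hr₂] with t h1 h2 h3 h4 g hg
    hg0
  refine abs_integral_add_le_of_dense hlr hψ h2 h3 (by positivity) (fun n => ?_) hg hg0
  rw [h1 n, abs_mul, abs_of_pos hε, mul_assoc]
  exact mul_le_mul_of_nonneg_left (abs_apply_le_normHm1 h4 _) hε.le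

end Slices

/-! ### Mollification of Lipschitz functions. -/

section Mollification

open Filter Topology
open scoped Convolution

variable {v : ℝ × ℝ → ℝ} {C : ℝ≥0}

theorem dt_eq_lineDeriv (v : ℝ × ℝ → ℝ) (p : ℝ × ℝ) : dt v p = lineDeriv ℝ v p (1, 0) := by
  have h := deriv_comp_const_add (f := fun s => v (s, p.2)) p.1 0
  rw [add_zero] at h
  rw [dt, ← h, lineDeriv]
  congr 1
  ext s
  congr 1
  ext <;> simp

theorem dx_eq_lineDeriv (v : ℝ × ℝ → ℝ) (p : ℝ × ℝ) : dx v p = lineDeriv ℝ v p (0, 1) := by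
  have h := deriv_comp_const_add (f := fun y => v (p.1, y)) p.2 0
  rw [add_zero] at h
  rw [dx, ← h, lineDeriv]
  congr 1
  ext s
  congr 1
  ext <;> simp

theorem integrable_mul_comp_sub {k : ℝ × ℝ → ℝ} (hk : Continuous k) (hkc : HasCompactSupport k)
    {g : ℝ × ℝ → ℝ} (hg : Continuous g) (p : ℝ × ℝ) : Integrable (fun y => k y * g (p - y)) :=
  (hk.mul (hg.comp (continuous_const.sub continuous_id))).integrable_of_hasCompactSupport
    (hkc.mul_right)

/-- Differentiation under the integral, dominated by the Lipschitz constant; for almost every `y`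
the directional derivative exists by Rademacher. The derivative of a mollification is thus a
mollification of a bounded function, so Lebesgue differentiation gives its convergence almost
everywhere. -/
theorem lineDeriv_convolution (hv : LipschitzWith C v) {k : ℝ × ℝ → ℝ} (hk : Continuous k)
    (hkc : HasCompactSupport k) (p e : ℝ × ℝ) :
    lineDeriv ℝ (fun q => ∫ y, k y * v (q - y)) p e = ∫ y, k y * lineDeriv ℝ v (p - y) e := by
  have hae : ∀ᵐ y : ℝ × ℝ, HasDerivAt (fun s : ℝ => v (p - y + s • e))
      (lineDeriv ℝ v (p - y) e) 0 := by
    have h1 : ∀ᵐ q : ℝ × ℝ, LineDifferentiableAt ℝ v q e := hv.ae_lineDifferentiableAt e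
    have h2 := (Measure.measurePreserving_sub_left volume p).quasiMeasurePreserving.ae h1
    filter_upwards [h2] with y hy
    exact hy.hasLineDerivAt
  have key := hasDerivAt_integral_of_dominated_loc_of_lip (μ := volume) (x₀ := (0 : ℝ))
    (s := univ) (F := fun (s : ℝ) (y : ℝ × ℝ) => k y * v (p + s • e - y))
    (F' := fun y => k y * lineDeriv ℝ v (p - y) e) (bound := fun y => ‖k y‖ * (C * ‖e‖))
    Filter.univ_mem ?_ ?_ ?_ ?_ ?_ ?_
  · exact key.2.deriv
  · exact Filter.Eventually.of_forall fun s =>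
      (integrable_mul_comp_sub hk hkc hv.continuous _).aestronglyMeasurable
  · exact integrable_mul_comp_sub hk hkc hv.continuous _
  · refine hk.aestronglyMeasurable.mul ?_
    exact ((measurable_lineDeriv hv.continuous).comp
      (measurable_const.sub measurable_id)).aestronglyMeasurable
  · refine Filter.Eventually.of_forall fun y => LipschitzOnWith.of_dist_le_mul fun s _ s' _ => ?_
    rw [Real.dist_eq, ← mul_sub, abs_mul]
    have h1 := hv.dist_le_mul (p + s • e - y) (p + s' • e - y)
    rw [dist_sub_right, dist_add_left, dist_eq_norm (s • e), ← sub_smul, norm_smul, Real.dist_eq,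
      Real.norm_eq_abs] at h1
    have h2 : ((Real.nnabs (‖k y‖ * (C * ‖e‖)) : ℝ≥0) : ℝ) = ‖k y‖ * (C * ‖e‖) := by
      rw [Real.coe_nnabs, abs_of_nonneg (by positivity)]
    rw [h2, Real.dist_eq, ← Real.norm_eq_abs (k y), mul_assoc]
    refine mul_le_mul_of_nonneg_left (h1.trans (le_of_eq (by ring))) (norm_nonneg _)
  · exact ((hk.integrable_of_hasCompactSupport hkc).norm).mul_const _
  · filter_upwards [hae] with y hy
    have e1 : (fun s : ℝ => k y * v (p + s • e - y)) = fun s : ℝ => k y * v (p - y + s • e) := by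
      ext s
      congr 2
      abel
    rw [e1]
    exact hy.const_mul _

/-- A Lipschitz function on space-time is a limit of smooth functions with the same Lipschitz
constant, whose first derivatives converge almost everywhere. -/
theorem exists_smooth_approx (hv : LipschitzWith C v) :
    ∃ V : ℕ → ℝ × ℝ → ℝ, (∀ n, ContDiff ℝ (⊤ : ℕ∞) (V n)) ∧ (∀ n, LipschitzWith C (V n)) ∧
      (∀ p, Tendsto (fun n => V n p) atTop (𝓝 (v p))) ∧
      (∀ᵐ p, Tendsto (fun n => dt (V n) p) atTop (𝓝 (dt v p))) ∧
      ∀ᵐ p, Tendsto (fun n => dx (V n) p) atTop (𝓝 (dx v p)) := by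
  -- The outer radius is twice the inner one, since the almost everywhere convergence used below
  -- needs a uniform bound on their ratio.
  let φ : ℕ → ContDiffBump (0 : ℝ × ℝ) := fun n =>
    ⟨1 / ((n : ℝ) + 1) / 2, 1 / ((n : ℝ) + 1), by positivity, half_lt_self (by positivity)⟩
  have hφ : Tendsto (fun n => (φ n).rOut) atTop (𝓝 0) := tendsto_one_div_add_atTop_nhds_zero_nat
  let V : ℕ → ℝ × ℝ → ℝ := fun n q => ∫ y, (φ n).normed volume y * v (q - y)
  have hVc : ∀ n, V n = ((φ n).normed volume ⋆[ContinuousLinearMap.lsmul ℝ ℝ, volume] v) :=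
    fun n => rfl
  have hk : ∀ n, Continuous ((φ n).normed volume) := fun n => (φ n).continuous_normed
  have hkc : ∀ n, HasCompactSupport ((φ n).normed volume) := fun n =>
    (φ n).hasCompactSupport_normed
  have hline : ∀ e : ℝ × ℝ, ∀ᵐ p, Tendsto (fun n => lineDeriv ℝ (V n) p e) atTop
      (𝓝 (lineDeriv ℝ v p e)) := by
    intro e
    filter_upwards [ContDiffBump.ae_convolution_tendsto_right_of_locallyIntegrable (K := 2) hφ
      (Eventually.of_forall fun n => by simp only [φ]; linarith)
      (hv.locallyIntegrable_lineDeriv (μ := volume) e)] with p hp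
    refine hp.congr fun n => ?_
    exact (lineDeriv_convolution hv (hk n) (hkc n) p e).symm
  refine ⟨V, fun n => ?_, fun n => ?_, fun p => ?_, ?_, ?_⟩
  · rw [hVc]
    exact (hkc n).contDiff_convolution_left _ (φ n).contDiff_normed
      hv.continuous.locallyIntegrable
  · refine LipschitzWith.of_dist_le_mul fun p q => ?_
    rw [Real.dist_eq, ← integral_sub (integrable_mul_comp_sub (hk n) (hkc n) hv.continuous _)
      (integrable_mul_comp_sub (hk n) (hkc n) hv.continuous _)]
    have h1 : ∫ y, (φ n).normed volume y * (C * dist p q) = C * dist p q := by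
      rw [integral_mul_const, (φ n).integral_normed, one_mul]
    rw [← h1, ← Real.norm_eq_abs]
    refine norm_integral_le_of_norm_le
      (((hk n).integrable_of_hasCompactSupport (hkc n)).mul_const _)
      (Eventually.of_forall fun y => ?_)
    rw [← mul_sub, norm_mul, Real.norm_of_nonneg ((φ n).nonneg_normed y)]
    refine mul_le_mul_of_nonneg_left ?_ ((φ n).nonneg_normed y)
    have := hv.dist_le_mul (p - y) (q - y)
    rwa [dist_sub_right, Real.dist_eq] at this
  · exact ContDiffBump.convolution_tendsto_right_of_continuous hφ hv.continuous p
  · filter_upwards [hline (1, 0)] with p hp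
    simpa only [dt_eq_lineDeriv] using hp
  · filter_upwards [hline (0, 1)] with p hp
    simpa only [dx_eq_lineDeriv] using hp

end Mollification

/-! ### Spatial cutoff functions. -/

section Cutoff

open Filter Topology

/-- At such a point, endpoints included, the function attains its global minimum 0 or its global
maximum 1. -/
theorem deriv_smoothTransition_eq_zero {x : ℝ} (hx : x ∉ Ioo (0 : ℝ) 1) :
    deriv Real.smoothTransition x = 0 := by
  rcases le_or_gt x 0 with h | h
  · refine IsLocalMin.deriv_eq_zero (Eventually.of_forall fun y => ?_)
    rw [Real.smoothTransition.zero_of_nonpos h]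
    exact Real.smoothTransition.nonneg y
  · have h1 : 1 ≤ x := not_lt.1 fun h' => hx ⟨h, h'⟩
    refine IsLocalMax.deriv_eq_zero (Eventually.of_forall fun y => ?_)
    rw [Real.smoothTransition.one_of_one_le h1]
    exact Real.smoothTransition.le_one y

theorem exists_bound_deriv_smoothTransition :
    ∃ K : ℝ, 0 < K ∧ ∀ x, |deriv Real.smoothTransition x| ≤ K := by
  have hc : Continuous (deriv Real.smoothTransition) :=
    (Real.smoothTransition.contDiff (n := 1)).continuous_deriv le_rfl
  obtain ⟨K, hK⟩ := (isCompact_Icc (a := (0 : ℝ)) (b := 1)).exists_bound_of_continuousOn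
    hc.continuousOn
  refine ⟨|K| + 1, by positivity, fun x => ?_⟩
  by_cases hx : x ∈ Ioo (0 : ℝ) 1
  · have := hK x (Ioo_subset_Icc_self hx)
    rw [Real.norm_eq_abs] at this
    linarith [le_abs_self K]
  · rw [deriv_smoothTransition_eq_zero hx, abs_zero]
    positivity

theorem hasDerivAt_smoothTransition (x : ℝ) :
    HasDerivAt Real.smoothTransition (deriv Real.smoothTransition x) x :=
  ((Real.smoothTransition.contDiff (n := 1)).differentiable (by norm_num) x).hasDerivAt

/-- Smooth cutoff functions exhausting `(l, r)`. -/
theorem exists_cutoff {l r : ℝ} (hlr : l < r) :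
    ∃ (K : ℝ) (χ : ℕ → 𝓓(Om l r, ℝ)) (d : ℕ → ℝ), 0 < K ∧ (∀ n, 0 < d n) ∧ (∀ n, d n ≤ r - l) ∧
      Tendsto d atTop (𝓝 0) ∧ (∀ n x, 0 ≤ χ n x) ∧ (∀ n x, χ n x ≤ 1) ∧
      (∀ x ∈ Ioo l r, Tendsto (fun n => χ n x) atTop (𝓝 1)) ∧
      ∀ n x, |deriv (χ n) x| ≤ K / d n * ((Ioo l (l + d n)).indicator (fun _ => 1) x
        + (Ioo (r - d n) r).indicator (fun _ => 1) x) := by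
  obtain ⟨K, hK, hKb⟩ := exists_bound_deriv_smoothTransition
  let s := Real.smoothTransition
  let δ : ℕ → ℝ := fun n => (r - l) / 2 / ((n : ℝ) + 1)
  have hrl : 0 < r - l := by linarith
  have hδ : ∀ n, 0 < δ n := fun n => by positivity
  have hδ0 : Tendsto δ atTop (𝓝 0) := by
    have := (tendsto_one_div_add_atTop_nhds_zero_nat (𝕜 := ℝ)).const_mul ((r - l) / 2)
    simpa [δ, div_eq_mul_inv] using this
  -- The shift by `-1` makes the cutoff rise between distances `δ n` and `2 * δ n` from the
  -- boundary: the support stays compact inside the interval, and the derivative lives in strips of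
  -- width `2 * δ n`, the sequence later returned as `d`.
  let c : ℕ → ℝ → ℝ := fun n x => s ((x - l) / δ n - 1) * s ((r - x) / δ n - 1)
  have hz : ∀ n x, x ∉ Icc (l + δ n) (r - δ n) → c n x = 0 := by
    intro n x hx
    rcases not_and_or.1 hx with h | h
    · have : (x - l) / δ n - 1 ≤ 0 := by
        rw [sub_nonpos, div_le_one (hδ n)]; linarith
      simp only [c, s, Real.smoothTransition.zero_of_nonpos this, zero_mul]
    · have : (r - x) / δ n - 1 ≤ 0 := by
        rw [sub_nonpos, div_le_one (hδ n)]; linarith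
      simp only [c, s, Real.smoothTransition.zero_of_nonpos this, mul_zero]
  have hts : ∀ n, tsupport (c n) ⊆ Icc (l + δ n) (r - δ n) := fun n =>
    closure_minimal (fun x hx => by_contra fun h => hx (hz n x h)) isClosed_Icc
  have hcd : ∀ n, ContDiff ℝ (⊤ : ℕ∞) (c n) := fun n =>
    (Real.smoothTransition.contDiff.comp (by fun_prop)).mul
      (Real.smoothTransition.contDiff.comp (by fun_prop))
  let χ : ℕ → 𝓓(Om l r, ℝ) := fun n => ⟨c n, hcd n,
    HasCompactSupport.of_support_subset_isCompact isCompact_Icc ((subset_tsupport _).trans (hts n)),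
    fun x hx => ⟨by linarith [(hts n hx).1, hδ n], by linarith [(hts n hx).2, hδ n]⟩⟩
  have hs1 : ∀ y, |s y| ≤ 1 := fun y =>
    abs_le.2 ⟨by linarith [Real.smoothTransition.nonneg y], Real.smoothTransition.le_one y⟩
  refine ⟨2 * K, χ, fun n => 2 * δ n, by positivity, fun n => by have := hδ n; positivity,
    fun n => ?_, by simpa using hδ0.const_mul 2, fun n x =>
      mul_nonneg (Real.smoothTransition.nonneg _) (Real.smoothTransition.nonneg _), fun n x =>
      mul_le_one₀ (Real.smoothTransition.le_one _) (Real.smoothTransition.nonneg _)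
        (Real.smoothTransition.le_one _), fun x hx => ?_, fun n x => ?_⟩
  · have : (r - l) / 2 / ((n : ℝ) + 1) ≤ (r - l) / 2 :=
      div_le_self (by linarith) (by linarith [(Nat.cast_nonneg n : (0 : ℝ) ≤ n)])
    simp only [δ]
    linarith
  · have h1 : ∀ᶠ n in atTop, 2 * δ n < x - l :=
      (hδ0.const_mul 2).eventually_lt_const (by simpa using hx.1)
    have h2 : ∀ᶠ n in atTop, 2 * δ n < r - x :=
      (hδ0.const_mul 2).eventually_lt_const (by simpa using hx.2)
    refine tendsto_const_nhds.congr' ?_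
    filter_upwards [h1, h2] with n h1 h2
    have e1 : 1 ≤ (x - l) / δ n - 1 := by
      rw [le_sub_iff_add_le, le_div_iff₀ (hδ n)]; linarith
    have e2 : 1 ≤ (r - x) / δ n - 1 := by
      rw [le_sub_iff_add_le, le_div_iff₀ (hδ n)]; linarith
    change 1 = s ((x - l) / δ n - 1) * s ((r - x) / δ n - 1)
    simp only [s, Real.smoothTransition.one_of_one_le e1, Real.smoothTransition.one_of_one_le e2,
      mul_one]
  · have d1 : HasDerivAt (fun x => s ((x - l) / δ n - 1))
        (deriv s ((x - l) / δ n - 1) * (1 / δ n)) x :=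
      (hasDerivAt_smoothTransition _).comp x ((((hasDerivAt_id x).sub_const l).div_const _).sub_const 1)
    have d2 : HasDerivAt (fun x => s ((r - x) / δ n - 1))
        (deriv s ((r - x) / δ n - 1) * (-1 / δ n)) x :=
      (hasDerivAt_smoothTransition _).comp x ((((hasDerivAt_id x).const_sub r).div_const _).sub_const 1)
    have d3 : deriv (χ n) x = _ := (d1.mul d2).deriv
    have b1 : |deriv s ((x - l) / δ n - 1)|
        ≤ K * (Ioo l (l + 2 * δ n)).indicator (fun _ => 1) x := by
      by_cases hx : x ∈ Ioo l (l + 2 * δ n)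
      · rw [indicator_of_mem hx, mul_one]; exact hKb _
      · rw [indicator_of_notMem hx, mul_zero, deriv_smoothTransition_eq_zero, abs_zero]
        intro h
        have h1 := h.1
        have h2 := h.2
        rw [sub_pos, one_lt_div (hδ n)] at h1
        rw [sub_lt_iff_lt_add, div_lt_iff₀ (hδ n)] at h2
        exact hx ⟨by linarith [hδ n], by linarith⟩
    have b2 : |deriv s ((r - x) / δ n - 1)|
        ≤ K * (Ioo (r - 2 * δ n) r).indicator (fun _ => 1) x := by
      by_cases hx : x ∈ Ioo (r - 2 * δ n) r
      · rw [indicator_of_mem hx, mul_one]; exact hKb _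
      · rw [indicator_of_notMem hx, mul_zero, deriv_smoothTransition_eq_zero, abs_zero]
        intro h
        have h1 := h.1
        have h2 := h.2
        rw [sub_pos, one_lt_div (hδ n)] at h1
        rw [sub_lt_iff_lt_add, div_lt_iff₀ (hδ n)] at h2
        exact hx ⟨by linarith, by linarith [hδ n]⟩
    rw [d3]
    have hinv : 0 < 1 / δ n := one_div_pos.2 (hδ n)
    have e : 2 * K / (2 * δ n) = K * (1 / δ n) := by
      rw [mul_div_mul_left _ _ two_ne_zero, mul_one_div]
    rw [e]
    refine (abs_add_le _ _).trans ?_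
    have t1 : |deriv s ((x - l) / δ n - 1) * (1 / δ n) * s ((r - x) / δ n - 1)|
        ≤ K * (Ioo l (l + 2 * δ n)).indicator (fun _ => 1) x * (1 / δ n) := by
      rw [abs_mul, abs_mul, abs_of_pos hinv]
      exact (mul_le_of_le_one_right (by positivity) (hs1 _)).trans
        (mul_le_mul_of_nonneg_right b1 hinv.le)
    have t2 : |s ((x - l) / δ n - 1) * (deriv s ((r - x) / δ n - 1) * (-1 / δ n))|
        ≤ K * (Ioo (r - 2 * δ n) r).indicator (fun _ => 1) x * (1 / δ n) := by
      rw [abs_mul, abs_mul, neg_div, abs_neg, abs_of_pos hinv]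
      exact (mul_le_of_le_one_left (by positivity) (hs1 _)).trans
        (mul_le_mul_of_nonneg_right b2 hinv.le)
    refine (add_le_add t1 t2).trans (le_of_eq (by ring))

end Cutoff

/-! ### Lipschitz multipliers in the weak formulation. -/

section WeakForm

open Filter Topology

variable {T l r : ℝ} {v : ℝ × ℝ → ℝ} {C : ℝ≥0}

theorem tendsto_integral_bdd_mul {α : Type*} [MeasurableSpace α] {μ : Measure α} {g : α → ℝ}
    (hg : Integrable g μ) {h : ℕ → α → ℝ} {k : α → ℝ} (hm : ∀ n, AEStronglyMeasurable (h n) μ)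
    {K : ℝ} (hb : ∀ n, ∀ᵐ x ∂μ, |h n x| ≤ K)
    (hl : ∀ᵐ x ∂μ, Tendsto (fun n => h n x) atTop (𝓝 (k x))) :
    Tendsto (fun n => ∫ x, h n x * g x ∂μ) atTop (𝓝 (∫ x, k x * g x ∂μ)) := by
  refine tendsto_integral_of_dominated_convergence (fun x => K * |g x|)
    (fun n => (hm n).mul hg.1) (hg.abs.const_mul K) (fun n => ?_) ?_
  · filter_upwards [hb n] with x hx
    rw [norm_mul, Real.norm_eq_abs, Real.norm_eq_abs]
    exact mul_le_mul_of_nonneg_right hx (abs_nonneg _)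
  · filter_upwards [hl] with x hx
    exact hx.mul_const _

theorem exists_bound_testFunction {U : Opens ℝ} (θ : 𝓓(U, ℝ)) :
    ∃ B : ℝ, 0 ≤ B ∧ (∀ t, |θ t| ≤ B) ∧ ∀ t, |deriv θ t| ≤ B := by
  obtain ⟨B, hB⟩ := θ.continuous.bounded_above_of_compact_support θ.hasCompactSupport
  obtain ⟨B', hB'⟩ := (continuous_deriv_testFunction θ).bounded_above_of_compact_support
    θ.hasCompactSupport.deriv
  exact ⟨max B B', (norm_nonneg _).trans ((hB 0).trans (le_max_left _ _)),
    fun t => (hB t).trans (le_max_left _ _), fun t => (hB' t).trans (le_max_right _ _)⟩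

/-- The weak formulation tested with `θ(t) ψ(x) v(t, x)` for a Lipschitz function `v`. -/
theorem weak_eq_mul_lipschitz {u J : ℝ × ℝ → ℝ} {u₀ : ℝ → ℝ} (hu : Integrable u (volCyl T l r))
    (hJ : Integrable J (volCyl T l r)) (hu₀ : Integrable u₀ (volOm l r))
    (hw : ∀ φ : 𝓓(CylInit T l r, ℝ), (∫ p in Ioo 0 T ×ˢ Ioo l r, (dt φ p * u p + dx φ p * J p))
      + ∫ x in Ioo l r, u₀ x * φ (0, x) = 0) (hv : LipschitzWith C v)
    (θ : 𝓓(Past T, ℝ)) (ψ : 𝓓(Om l r, ℝ)) :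
    (∫ p in Ioo 0 T ×ˢ Ioo l r,
        ((deriv θ p.1 * ψ p.2 * v p + θ p.1 * ψ p.2 * dt v p) * u p
          + (θ p.1 * deriv ψ p.2 * v p + θ p.1 * ψ p.2 * dx v p) * J p))
      + ∫ x in Ioo l r, θ 0 * ψ x * v (0, x) * u₀ x = 0 := by
  -- With `V n` in place of `v` the test function is smooth. Uniform bounds on `V n` and its first
  -- derivatives allow dominated convergence against the integrable `u`, `J` and `u₀`.
  obtain ⟨V, hVs, hVL, hV, hVt, hVx⟩ := exists_smooth_approx hv
  obtain ⟨B, hB0, hB, hB'⟩ := exists_bound_testFunction θ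
  obtain ⟨D, hD0, hD, hD'⟩ := exists_bound_testFunction ψ
  -- The values at the origin converge, hence are bounded, and the common Lipschitz constant spreads
  -- this bound over the closed cylinder.
  obtain ⟨M, hM0, hM⟩ : ∃ M : ℝ, 0 ≤ M ∧ ∀ n, ∀ p ∈ Icc 0 T ×ˢ Icc l r, |V n p| ≤ M := by
    obtain ⟨M₁, hM₁⟩ := (hV 0).bddAbove_range
    obtain ⟨M₃, hM₃⟩ := (hV 0).bddBelow_range
    obtain ⟨M₂, hM₂⟩ := (isCompact_Icc.prod isCompact_Icc : IsCompact (Icc 0 T ×ˢ Icc l r)).isBounded.exists_norm_le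
    refine ⟨|M₁| + |M₃| + C * |M₂|, by positivity, fun n p hp => ?_⟩
    have h1 : |V n 0| ≤ |M₁| + |M₃| := by
      have a1 := hM₁ (mem_range_self n)
      have a2 := hM₃ (mem_range_self n)
      rw [abs_le]
      constructor <;>
        linarith [le_abs_self M₁, neg_abs_le M₃, abs_nonneg M₁, abs_nonneg M₃]
    have h2 := (hVL n).dist_le_mul p 0
    rw [Real.dist_eq, dist_zero_right] at h2
    have h3 : (C : ℝ) * ‖p‖ ≤ C * |M₂| :=
      mul_le_mul_of_nonneg_left ((hM₂ p hp).trans (le_abs_self _)) C.2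
    have h4 : |V n p| ≤ |V n p - V n 0| + |V n 0| := by
      have := abs_add_le (V n p - V n 0) (V n 0)
      rwa [sub_add_cancel] at this
    linarith
  have hmem : ∀ᵐ p ∂(volCyl T l r), p ∈ Icc 0 T ×ˢ Icc l r := by
    filter_upwards [ae_restrict_mem (measurableSet_Ioo.prod measurableSet_Ioo)] with p hp
    exact ⟨Ioo_subset_Icc_self hp.1, Ioo_subset_Icc_self hp.2⟩
  have hmul : ∀ {a b c B D M : ℝ}, 0 ≤ B → 0 ≤ D → |a| ≤ B → |b| ≤ D → |c| ≤ M →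
      |a * b * c| ≤ B * D * M := by
    intro a b c B D M hB hD ha hb hc
    rw [abs_mul, abs_mul]
    exact mul_le_mul (mul_le_mul ha hb (abs_nonneg _) hB) hc (abs_nonneg _) (mul_nonneg hB hD)
  have cθ : Continuous (deriv θ) := continuous_deriv_testFunction θ
  have cψ : Continuous (deriv ψ) := continuous_deriv_testFunction ψ
  have m1 : ∀ n, AEStronglyMeasurable (fun p : ℝ × ℝ => deriv θ p.1 * ψ p.2 * V n p
      + θ p.1 * ψ p.2 * dt (V n) p) (volCyl T l r) := fun n => by
    have := (measurable_dt (hVL n)).aestronglyMeasurable (μ := volCyl T l r)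
    have := (hVL n).continuous
    exact (Continuous.aestronglyMeasurable (by fun_prop)).add
      ((Continuous.aestronglyMeasurable (by fun_prop)).mul ‹_›)
  have m2 : ∀ n, AEStronglyMeasurable (fun p : ℝ × ℝ => θ p.1 * deriv ψ p.2 * V n p
      + θ p.1 * ψ p.2 * dx (V n) p) (volCyl T l r) := fun n => by
    have := (measurable_dx (hVL n)).aestronglyMeasurable (μ := volCyl T l r)
    have := (hVL n).continuous
    exact (Continuous.aestronglyMeasurable (by fun_prop)).add
      ((Continuous.aestronglyMeasurable (by fun_prop)).mul ‹_›)
  have b1 : ∀ n, ∀ᵐ p ∂(volCyl T l r), |deriv θ p.1 * ψ p.2 * V n p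
      + θ p.1 * ψ p.2 * dt (V n) p| ≤ B * D * M + B * D * C := fun n => by
    filter_upwards [hmem] with p hp
    exact (abs_add_le _ _).trans (add_le_add (hmul hB0 hD0 (hB' _) (hD _) (hM n p hp))
      (hmul hB0 hD0 (hB _) (hD _) (abs_dt_le (hVL n) p)))
  have b2 : ∀ n, ∀ᵐ p ∂(volCyl T l r), |θ p.1 * deriv ψ p.2 * V n p
      + θ p.1 * ψ p.2 * dx (V n) p| ≤ B * D * M + B * D * C := fun n => by
    filter_upwards [hmem] with p hp
    exact (abs_add_le _ _).trans (add_le_add (hmul hB0 hD0 (hB _) (hD' _) (hM n p hp))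
      (hmul hB0 hD0 (hB _) (hD _) (abs_dx_le (hVL n) p)))
  have l1 := tendsto_integral_bdd_mul hu m1 b1 (k := fun p : ℝ × ℝ => deriv θ p.1 * ψ p.2 * v p
      + θ p.1 * ψ p.2 * dt v p) (by
    filter_upwards [ae_restrict_of_ae hVt] with p hp
    exact ((hV p).const_mul _).add (hp.const_mul _))
  have l2 := tendsto_integral_bdd_mul hJ m2 b2 (k := fun p : ℝ × ℝ => θ p.1 * deriv ψ p.2 * v p
      + θ p.1 * ψ p.2 * dx v p) (by
    filter_upwards [ae_restrict_of_ae hVx] with p hp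
    exact ((hV p).const_mul _).add (hp.const_mul _))
  -- For `T ≤ 0` the cylinder is empty and `θ 0 = 0`. Otherwise the points `(0, x)` belong to the
  -- closed cylinder, where `M` applies.
  rcases le_or_gt T 0 with hT | hT
  · have hθ0 : θ 0 = 0 := by
      by_contra h
      have h1 : (0 : ℝ) < T := θ.tsupport_subset (subset_tsupport _ h)
      linarith
    simp [Ioo_eq_empty_of_le hT, hθ0]
  have l3 := tendsto_integral_bdd_mul hu₀ (h := fun n x => θ 0 * ψ x * V n (0, x))
    (k := fun x => θ 0 * ψ x * v (0, x)) (K := B * D * M)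
    (fun n => by
      have := (hVL n).continuous
      exact Continuous.aestronglyMeasurable (by fun_prop)) (fun n => by
      filter_upwards [ae_restrict_mem measurableSet_Ioo] with x hx
      exact hmul hB0 hD0 (hB _) (hD _) (hM n _ ⟨⟨le_rfl, hT.le⟩, Ioo_subset_Icc_self hx⟩))
    (Eventually.of_forall fun x => (hV _).const_mul _)
  have hint : ∀ {a g : ℝ × ℝ → ℝ} {K : ℝ}, Integrable g (volCyl T l r) →
      AEStronglyMeasurable a (volCyl T l r) → (∀ᵐ p ∂(volCyl T l r), |a p| ≤ K) →
      Integrable (fun p => a p * g p) (volCyl T l r) := fun hg ha hb => hg.bdd_mul ha hb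
  have lim := (l1.add l2).add l3
  have hzero : ∀ n, ((∫ p in Ioo 0 T ×ˢ Ioo l r, (deriv θ p.1 * ψ p.2 * V n p
        + θ p.1 * ψ p.2 * dt (V n) p) * u p)
      + ∫ p in Ioo 0 T ×ˢ Ioo l r, (θ p.1 * deriv ψ p.2 * V n p
        + θ p.1 * ψ p.2 * dx (V n) p) * J p)
      + ∫ x in Ioo l r, θ 0 * ψ x * V n (0, x) * u₀ x = 0 := by
    intro n
    have h := hw (tensorInit θ ψ (hVs n))
    simp only [dt_tensorInit, dx_tensorInit, tensorInit_apply] at h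
    rw [integral_add (hint hu (m1 n) (b1 n)) (hint hJ (m2 n) (b2 n))] at h
    simp_rw [mul_comm (u₀ _)] at h
    exact h
  have h0 := tendsto_nhds_unique lim (tendsto_const_nhds.congr fun n => (hzero n).symm)
  have m1' : AEStronglyMeasurable (fun p : ℝ × ℝ => deriv θ p.1 * ψ p.2 * v p
      + θ p.1 * ψ p.2 * dt v p) (volCyl T l r) := by
    have := (measurable_dt hv).aestronglyMeasurable (μ := volCyl T l r)
    have := hv.continuous
    exact (Continuous.aestronglyMeasurable (by fun_prop)).add
      ((Continuous.aestronglyMeasurable (by fun_prop)).mul ‹_›)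
  have m2' : AEStronglyMeasurable (fun p : ℝ × ℝ => θ p.1 * deriv ψ p.2 * v p
      + θ p.1 * ψ p.2 * dx v p) (volCyl T l r) := by
    have := (measurable_dx hv).aestronglyMeasurable (μ := volCyl T l r)
    have := hv.continuous
    exact (Continuous.aestronglyMeasurable (by fun_prop)).add
      ((Continuous.aestronglyMeasurable (by fun_prop)).mul ‹_›)
  have hMv : ∀ p ∈ Icc 0 T ×ˢ Icc l r, |v p| ≤ M := fun p hp =>
    le_of_tendsto (hV p).abs (Eventually.of_forall fun n => hM n p hp)
  rw [integral_add (hint hu m1' (K := B * D * M + B * D * C) ?_)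
    (hint hJ m2' (K := B * D * M + B * D * C) ?_)]
  · exact h0
  · filter_upwards [hmem] with p hp
    exact (abs_add_le _ _).trans (add_le_add (hmul hB0 hD0 (hB' _) (hD _) (hMv p hp))
      (hmul hB0 hD0 (hB _) (hD _) (abs_dt_le hv p)))
  · filter_upwards [hmem] with p hp
    exact (abs_add_le _ _).trans (add_le_add (hmul hB0 hD0 (hB _) (hD' _) (hMv p hp))
      (hmul hB0 hD0 (hB _) (hD _) (abs_dx_le hv p)))

end WeakForm

/-! ### Essentially bounded functions and primitives of the flux. -/

section Bounded

variable {α : Type*} [MeasurableSpace α] {μ : Measure α} {u : α → ℝ}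

theorem ae_abs_le_toReal_eLpNorm_top (hu : MemLp u ∞ μ) :
    ∀ᵐ x ∂μ, |u x| ≤ (eLpNorm u ∞ μ).toReal := by
  rw [eLpNorm_exponent_top]
  filter_upwards [ae_le_eLpNormEssSup (f := u) (μ := μ)] with x hx
  have h2 : eLpNormEssSup u μ ≠ ∞ := by
    rw [← eLpNorm_exponent_top]; exact hu.2.ne
  have := ENNReal.toReal_mono h2 hx
  rwa [toReal_enorm, Real.norm_eq_abs] at this

theorem exists_ae_abs_le (hu : MemLp u ∞ μ) : ∃ M : ℝ, 0 ≤ M ∧ ∀ᵐ x ∂μ, |u x| ≤ M :=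
  ⟨_, ENNReal.toReal_nonneg, ae_abs_le_toReal_eLpNorm_top hu⟩

theorem memLp_top_comp (hu : MemLp u ∞ μ) {F : ℝ → ℝ} (hF : Continuous F) :
    MemLp (fun x => F (u x)) ∞ μ := by
  obtain ⟨M, -, hM⟩ := exists_ae_abs_le hu
  obtain ⟨K, hK⟩ := (isCompact_Icc (a := -M) (b := M)).exists_bound_of_continuousOn hF.continuousOn
  refine memLp_top_of_bound (hF.comp_aestronglyMeasurable hu.1) K ?_
  filter_upwards [hM] with x hx
  exact hK _ (abs_le.1 hx)

end Bounded

/-- The primitive of `f` vanishing at zero. -/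
def prim (f : ℝ → ℝ) (v : ℝ) : ℝ := ∫ s in (0 : ℝ)..v, f s

theorem hasDerivAt_prim {f : ℝ → ℝ} (hf : Continuous f) (v : ℝ) : HasDerivAt (prim f) (f v) v :=
  intervalIntegral.integral_hasDerivAt_right (hf.intervalIntegrable _ _)
    hf.aestronglyMeasurable.stronglyMeasurableAtFilter hf.continuousAt

theorem deriv_prim {f : ℝ → ℝ} (hf : Continuous f) : deriv (prim f) = f :=
  funext fun v => (hasDerivAt_prim hf v).deriv

theorem contDiff_prim {f : ℝ → ℝ} (hf : Continuous f) : ContDiff ℝ 1 (prim f) := by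
  rw [contDiff_one_iff_deriv, deriv_prim hf]
  exact ⟨fun v => (hasDerivAt_prim hf v).differentiableAt, hf⟩

/-- Integration by parts. In this form the entropy flux combines with `v * f u` and `prim f v` into
`relFlux`. -/
theorem quadFlux_eq {f : ℝ → ℝ} (hf : ContDiff ℝ 1 f) (v : ℝ) :
    quadFlux f v = v * f v - prim f v := by
  have h := intervalIntegral.integral_mul_deriv_eq_deriv_mul (a := 0) (b := v) (u := fun w => w)
    (v := f) (u' := fun _ => 1) (v' := deriv f) (fun x _ => hasDerivAt_id x)
    (fun x _ => ((hf.differentiable one_ne_zero) x).hasDerivAt) intervalIntegrable_const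
    ((hf.continuous_deriv le_rfl).intervalIntegrable _ _)
  rw [quadFlux, h, prim]
  simp

theorem deriv_quadEntropy : deriv quadEntropy = fun v => v := by
  ext v
  have : HasDerivAt quadEntropy (2 * v / 2) v := by
    have h := (hasDerivAt_pow 2 v).div_const 2
    simp only [Nat.cast_ofNat, Nat.add_one_sub_one, pow_one] at h
    exact h
  rw [this.deriv]
  ring

/-! ### Relative entropy with a spatial cutoff. -/

section RelativeEntropy

variable {T l r ε : ℝ} {f A : ℝ → ℝ} {u₀ : ℝ → ℝ} {u ux v : ℝ × ℝ → ℝ} {C : ℝ≥0}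

/-- The relative entropy production of `u` with respect to `v`. -/
def relProd (ε : ℝ) (f A : ℝ → ℝ) (u ux v : ℝ × ℝ → ℝ) (p : ℝ × ℝ) : ℝ :=
  -(dt v p * (u p - v p)) - ε * (A (u p) * ux p * (ux p - dx v p)) - dx v p * (f (u p) - f (v p))

/-- The relative entropy flux of `u` with respect to `v`. -/
def relFlux (ε : ℝ) (f A : ℝ → ℝ) (u ux v : ℝ × ℝ → ℝ) (p : ℝ × ℝ) : ℝ :=
  (u p - v p) * f (u p) - (prim f (u p) - prim f (v p)) - ε * ((u p - v p) * (A (u p) * ux p))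

theorem integrable_relProd (hf : ContDiff ℝ 1 f) (hA : Continuous A)
    (hu : MemLp u ∞ (volCyl T l r)) (hux : MemLp ux 2 (volCyl T l r)) (hv : LipschitzWith C v) :
    Integrable (relProd ε f A u ux v) (volCyl T l r) := by
  have hvt : MemLp v ∞ (volCyl T l r) := memLp_volCyl_of_continuous hv.continuous _
  have hfv : MemLp (fun p => f (v p)) ∞ (volCyl T l r) := memLp_top_comp hvt hf.continuous
  refine ((?_ : Integrable _ _).neg.sub ((?_ : Integrable _ _).const_mul ε)).sub ?_
  · exact Integrable.mul_memLp_top ((memLp_dt hv 1).integrable le_rfl) (hu.sub hvt)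
  · exact integrable_mul_of_memLp_two (hux.mul' (memLp_top_comp hu hA)) (hux.sub (memLp_dx hv 2))
  · exact Integrable.mul_memLp_top ((memLp_dx hv 1).integrable le_rfl)
      ((memLp_top_comp hu hf.continuous).sub hfv)

/-- The relative entropy inequality with a test function `θ(t) ψ(x)`. -/
theorem rel_entropy_ineq_tensor (hT : 0 < T) (hlr : l < r) (hf : ContDiff ℝ 1 f)
    (hA : Continuous A) (hu₀ : MemLp u₀ 2 (volOm l r)) (hux : MemLp ux 2 (volCyl T l r))
    (hs : IsEntropySolution T l r ε f A quadEntropy (quadFlux f) u₀ u ux) (hv : LipschitzWith C v)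
    (θ : 𝓓(Past T, ℝ)) (hθ : ∀ t, 0 ≤ t → 0 ≤ θ t) (ψ : 𝓓(Om l r, ℝ)) (hψ : ∀ x, 0 ≤ ψ x) :
    0 ≤ (∫ p in Ioo 0 T ×ˢ Ioo l r,
        (deriv θ p.1 * ψ p.2 * ((u p - v p) ^ 2 / 2)
          + θ p.1 * deriv ψ p.2 * relFlux ε f A u ux v p
          + θ p.1 * ψ p.2 * relProd ε f A u ux v p))
      + ∫ x in Ioo l r, θ 0 * ψ x * ((u₀ x - v (0, x)) ^ 2 / 2) := by
  have hu : MemLp u ∞ (volCyl T l r) := hs.bounded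
  have hv1 : MemLp v ∞ (volCyl T l r) := memLp_volCyl_of_continuous hv.continuous _
  have hAu : MemLp (fun p => A (u p)) ∞ (volCyl T l r) := memLp_top_comp hu hA
  have hAux : MemLp (fun p => A (u p) * ux p) 2 (volCyl T l r) := hux.mul' hAu
  have hAux1 : Integrable (fun p => A (u p) * ux p) (volCyl T l r) := hAux.integrable (by norm_num)
  have hfu : MemLp (fun p => f (u p)) ∞ (volCyl T l r) := memLp_top_comp hu hf.continuous
  have hPu : MemLp (fun p => prim f (u p)) ∞ (volCyl T l r) :=
    memLp_top_comp hu (contDiff_prim hf.continuous).continuous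
  have hfu1 : Integrable (fun p => f (u p)) (volCyl T l r) := hfu.integrable le_top
  have hu1 : Integrable u (volCyl T l r) := hu.integrable le_top
  have hJ : Integrable (fun p => f (u p) - ε * (A (u p) * ux p)) (volCyl T l r) :=
    hfu1.sub (hAux1.const_mul ε)
  have cθ : Continuous (deriv θ) := continuous_deriv_testFunction θ
  have cψ : Continuous (deriv ψ) := continuous_deriv_testFunction ψ
  have t1 : MemLp (fun p : ℝ × ℝ => deriv θ p.1 * ψ p.2) ∞ (volCyl T l r) :=
    memLp_top_tensor cθ ψ.continuous
  have t2 : MemLp (fun p : ℝ × ℝ => θ p.1 * deriv ψ p.2) ∞ (volCyl T l r) :=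
    memLp_top_tensor θ.continuous cψ
  have t3 : MemLp (fun p : ℝ × ℝ => θ p.1 * ψ p.2) ∞ (volCyl T l r) :=
    memLp_top_tensor θ.continuous ψ.continuous
  have hdt : MemLp (dt v) ∞ (volCyl T l r) := memLp_dt hv _
  have hdx : MemLp (dx v) ∞ (volCyl T l r) := memLp_dx hv _
  -- The claim is `hE` minus `hW` plus `hTt` plus `hX`. The terms u²/2, -uv and v²/2 complete the
  -- square, and the multiples of ∂ₜv and ∂ₓv collect in `relProd`.
  have hE := hs.entropy_ineq (tensorInit θ ψ (V := fun _ => 1) contDiff_const) (fun p hp =>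
    mul_nonneg (mul_nonneg (hθ _ hp) (hψ _)) zero_le_one)
  simp only [dt_tensorInit, dx_tensorInit, tensorInit_apply, dt_const, dx_const, mul_zero,
    add_zero, mul_one, deriv_quadEntropy, quadEntropy, quadFlux_eq hf, deriv_id'', one_mul] at hE
  have hW := weak_eq_mul_lipschitz hu1 hJ (hu₀.integrable (by norm_num)) hs.weak_eq hv θ ψ
  have hTt := integral_tensor_dt_comp hT hv
    (contDiff_id.pow 2 |>.div_const 2 : ContDiff ℝ 1 fun w : ℝ => id w ^ 2 / 2) θ ψ (l := l) (r := r)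
  have hd2 : deriv (fun w : ℝ => id w ^ 2 / 2) = fun w => w := deriv_quadEntropy
  rw [hd2] at hTt
  have hX := integral_tensor_dx_comp hlr hv (contDiff_prim hf.continuous) θ ψ
  rw [deriv_prim hf.continuous] at hX
  have iE : Integrable (fun p : ℝ × ℝ => deriv θ p.1 * ψ p.2 * (u p ^ 2 / 2)
      + θ p.1 * deriv ψ p.2 * (u p * f (u p) - prim f (u p) - ε * (u p * (A (u p) * ux p)))
      - ε * (θ p.1 * ψ p.2 * (ux p * (A (u p) * ux p)))) (volCyl T l r) := by
    have g1 : Integrable (fun p => u p ^ 2 / 2) (volCyl T l r) :=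
      (memLp_top_comp hu (F := fun w => w ^ 2 / 2) (by fun_prop)).integrable le_top
    have g2 : Integrable (fun p => u p * f (u p) - prim f (u p) - ε * (u p * (A (u p) * ux p)))
        (volCyl T l r) :=
      ((Integrable.memLp_top_mul hfu1 hu).sub (hPu.integrable le_top)).sub
        ((Integrable.memLp_top_mul hAux1 hu).const_mul ε)
    exact ((Integrable.memLp_top_mul g1 t1).add (Integrable.memLp_top_mul g2 t2)).sub
      ((Integrable.memLp_top_mul (integrable_mul_of_memLp_two hux hAux) t3).const_mul ε)
  have iW : Integrable (fun p : ℝ × ℝ =>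
      (deriv θ p.1 * ψ p.2 * v p + θ p.1 * ψ p.2 * dt v p) * u p
        + (θ p.1 * deriv ψ p.2 * v p + θ p.1 * ψ p.2 * dx v p)
          * (f (u p) - ε * (A (u p) * ux p))) (volCyl T l r) := by
    have s1 : MemLp (fun p : ℝ × ℝ => deriv θ p.1 * ψ p.2 * v p + θ p.1 * ψ p.2 * dt v p) ∞
        (volCyl T l r) := (hv1.mul' t1).add (hdt.mul' t3)
    have s2 : MemLp (fun p : ℝ × ℝ => θ p.1 * deriv ψ p.2 * v p + θ p.1 * ψ p.2 * dx v p) ∞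
        (volCyl T l r) := (hv1.mul' t2).add (hdx.mul' t3)
    exact (Integrable.memLp_top_mul hu1 s1).add (Integrable.memLp_top_mul hJ s2)
  have iT : Integrable (fun p : ℝ × ℝ => deriv θ p.1 * ψ p.2 * (id (v p) ^ 2 / 2)
      + θ p.1 * ψ p.2 * (v p * dt v p)) (volCyl T l r) := by
    have g1 : MemLp (fun p => id (v p) ^ 2 / 2) ∞ (volCyl T l r) :=
      memLp_top_comp hv1 (F := fun w => id w ^ 2 / 2) (by simp only [id]; fun_prop)
    have g2 : MemLp (fun p => v p * dt v p) ∞ (volCyl T l r) := hdt.mul' hv1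
    exact (Integrable.memLp_top_mul (g1.integrable le_top) t1).add
      (Integrable.memLp_top_mul (g2.integrable le_top) t3)
  have iX : Integrable (fun p : ℝ × ℝ => θ p.1 * deriv ψ p.2 * prim f (v p)
      + θ p.1 * ψ p.2 * (f (v p) * dx v p)) (volCyl T l r) := by
    have g1 : MemLp (fun p => prim f (v p)) ∞ (volCyl T l r) :=
      memLp_top_comp hv1 (contDiff_prim hf.continuous).continuous
    have g2 : MemLp (fun p => f (v p) * dx v p) ∞ (volCyl T l r) :=
      hdx.mul' (memLp_top_comp hv1 hf.continuous)
    exact (Integrable.memLp_top_mul (g1.integrable le_top) t2).add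
      (Integrable.memLp_top_mul (g2.integrable le_top) t3)
  have e1 := ((integral_add ((iE.sub iW).add iT) iX).trans (congrArg₂ _
    ((integral_add (iE.sub iW) iT).trans (congrArg₂ _ (integral_sub iE iW) rfl)) rfl))
  have e2 := e1.symm.trans (integral_congr_ae (g := fun p : ℝ × ℝ =>
      deriv θ p.1 * ψ p.2 * ((u p - v p) ^ 2 / 2)
        + θ p.1 * deriv ψ p.2 * relFlux ε f A u ux v p
        + θ p.1 * ψ p.2 * relProd ε f A u ux v p) (Filter.Eventually.of_forall fun p => by
    simp only [Pi.add_apply, Pi.sub_apply, relFlux, relProd, id]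
    ring))
  have hv0 : Continuous (fun x => v (0, x)) := hv.continuous.comp (by fun_prop)
  have hv02 : MemLp (fun x => v (0, x)) 2 (volOm l r) := by
    obtain ⟨M, hM⟩ := (isCompact_Icc (a := l) (b := r)).exists_bound_of_continuousOn hv0.continuousOn
    refine MemLp.of_bound hv0.aestronglyMeasurable M ?_
    filter_upwards [ae_restrict_mem measurableSet_Ioo] with x hx
    exact hM x (Ioo_subset_Icc_self hx)
  have tψ : MemLp (fun x => θ 0 * ψ x) ∞ (volOm l r) := (memLp_testFunction ψ _).const_mul _
  have n1 : Integrable (fun x => θ 0 * ψ x * (u₀ x ^ 2 / 2)) (volOm l r) :=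
    Integrable.memLp_top_mul (hu₀.integrable_sq.div_const 2) tψ
  have n2 : Integrable (fun x => θ 0 * ψ x * v (0, x) * u₀ x) (volOm l r) :=
    (Integrable.memLp_top_mul (integrable_mul_of_memLp_two hv02 hu₀) tψ).congr
      (Filter.Eventually.of_forall fun x => by ring)
  have n3 : Integrable (fun x => θ 0 * ψ x * (id (v (0, x)) ^ 2 / 2)) (volOm l r) :=
    Integrable.memLp_top_mul (hv02.integrable_sq.div_const 2) tψ
  have e3 := (integral_add (n1.sub n2) n3).trans (congrArg₂ _ (integral_sub n1 n2) rfl)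
  have e4 := e3.symm.trans (integral_congr_ae (g := fun x =>
      θ 0 * ψ x * ((u₀ x - v (0, x)) ^ 2 / 2)) (Filter.Eventually.of_forall fun x => by
    simp only [Pi.sub_apply, id]
    ring))
  have hE' : 0 ≤ (∫ p in Ioo 0 T ×ˢ Ioo l r, (deriv θ p.1 * ψ p.2 * (u p ^ 2 / 2)
      + θ p.1 * deriv ψ p.2 * (u p * f (u p) - prim f (u p) - ε * (u p * (A (u p) * ux p)))
      - ε * (θ p.1 * ψ p.2 * (ux p * (A (u p) * ux p)))))
      + ∫ x in Ioo l r, θ 0 * ψ x * (u₀ x ^ 2 / 2) := hE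
  linarith

end RelativeEntropy

/-! ### Boundary layers and removal of the cutoff. -/

section BoundaryLayer

open Filter Topology

variable {T l r : ℝ}

theorem setIntegral_indicator_one_mul {S : Set ℝ} (hS : MeasurableSet S) (hSl : S ⊆ Ioo l r)
    (k : ℝ → ℝ) : ∫ x in Ioo l r, S.indicator (fun _ => 1) x * k x = ∫ x in S, k x := by
  have e : ∀ x, S.indicator (fun _ => (1 : ℝ)) x * k x = S.indicator k x := fun x => by
    by_cases hx : x ∈ S <;> simp [hx]
  simp_rw [e]
  rw [setIntegral_indicator hS, inter_eq_self_of_subset_right hSl]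

/-- The derivative of the cutoff is of size `K / d` on the two strips, and the strip estimate for
`w` gains `d / 2`. The powers of `d` cancel, leaving an integral of a fixed integrable function over
the strips. -/
theorem abs_integral_cutoff_le {w g h : ℝ × ℝ → ℝ} (hw : MemLp w 2 (volCyl T l r))
    (hg : MemLp g 2 (volCyl T l r)) (hh : MemLp h 2 (volCyl T l r))
    (hH : ∀ᵐ t ∂(volOm 0 T), ∫ x in Ioo l r, g (t, x) = 0 ∧
      ∀ᵐ x ∂(volOm l r), w (t, x) = ∫ y in l..x, g (t, y))
    {K d B : ℝ} (hd : 0 < d) (hdr : d ≤ r - l) (hB0 : 0 ≤ B) (hK : 0 < K) {θ : ℝ → ℝ}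
    (hθc : Continuous θ) (hθ : ∀ t, |θ t| ≤ B) {χ' : ℝ → ℝ} (hχc : Continuous χ')
    (hχ : ∀ x, |χ' x| ≤ K / d * ((Ioo l (l + d)).indicator (fun _ => 1) x
        + (Ioo (r - d) r).indicator (fun _ => 1) x)) :
    |∫ p in Ioo 0 T ×ˢ Ioo l r, θ p.1 * χ' p.2 * (w p * h p)|
      ≤ B * K / 2 * ∫ p in Ioo 0 T ×ˢ Ioo l r, ((Ioo l (l + d)).indicator (fun _ => (1 : ℝ)) p.2
        + (Ioo (r - d) r).indicator (fun _ => 1) p.2) * (g p ^ 2 + h p ^ 2) := by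
  have hwh : Integrable (fun p => w p * h p) (volCyl T l r) := integrable_mul_of_memLp_two hw hh
  have i1 : Integrable (fun p : ℝ × ℝ => θ p.1 * χ' p.2 * (w p * h p)) (volCyl T l r) :=
    Integrable.memLp_top_mul hwh (memLp_top_tensor hθc hχc)
  have hs1 : Ioo l (l + d) ⊆ Ioo l r := Ioo_subset_Ioo le_rfl (by linarith)
  have hs2 : Ioo (r - d) r ⊆ Ioo l r := Ioo_subset_Ioo (by linarith) le_rfl
  have hgh : Integrable (fun p => g p ^ 2 + h p ^ 2) (volCyl T l r) :=
    hg.integrable_sq.add hh.integrable_sq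
  have hind : ∀ S : Set ℝ, MeasurableSet S → MemLp (fun x => S.indicator (fun _ => (1 : ℝ)) x) ∞
      (volOm l r) := fun S hS =>
    memLp_top_of_bound (measurable_const.indicator hS).aestronglyMeasurable 1
      (Eventually.of_forall fun x => by by_cases hx : x ∈ S <;> simp [hx])
  have hind2 : ∀ S : Set ℝ, MeasurableSet S → MemLp (fun p : ℝ × ℝ =>
      S.indicator (fun _ => (1 : ℝ)) p.2) ∞ (volCyl T l r) := fun S hS =>
    memLp_top_of_bound ((measurable_const.indicator hS).comp measurable_snd).aestronglyMeasurable 1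
      (Eventually.of_forall fun p => by by_cases hx : p.2 ∈ S <;> simp [hx])
  have i2 : Integrable (fun p : ℝ × ℝ => ((Ioo l (l + d)).indicator (fun _ => (1 : ℝ)) p.2
        + (Ioo (r - d) r).indicator (fun _ => 1) p.2) * (g p ^ 2 + h p ^ 2)) (volCyl T l r) :=
    Integrable.memLp_top_mul hgh ((hind2 _ measurableSet_Ioo).add (hind2 _ measurableSet_Ioo))
  refine abs_integral_le_integral_abs.trans ?_
  rw [integral_volCyl i1.abs, integral_volCyl i2, ← integral_const_mul]
  refine integral_mono_ae (integrable_integral_slice i1.abs)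
    ((integrable_integral_slice i2).const_mul _) ?_
  filter_upwards [hH, ae_memLp_two_slice hg, ae_memLp_two_slice hh, ae_integrable_slice hwh,
    ae_integrable_slice i1, ae_integrable_slice hgh] with t h1 h2 h3 h4 h5 h6
  obtain ⟨b1, b2⟩ := setIntegral_strips_abs_mul_le hd hdr h2 h3 h1.1 h1.2
  have split : ∀ k : ℝ → ℝ, Integrable k (volOm l r) →
      ∫ x in Ioo l r, ((Ioo l (l + d)).indicator (fun _ => (1 : ℝ)) x
        + (Ioo (r - d) r).indicator (fun _ => 1) x) * k x
      = (∫ x in Ioo l (l + d), k x) + ∫ x in Ioo (r - d) r, k x := by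
    intro k hk
    simp_rw [add_mul]
    rw [integral_add (Integrable.memLp_top_mul hk (hind _ measurableSet_Ioo))
      (Integrable.memLp_top_mul hk (hind _ measurableSet_Ioo)),
      setIntegral_indicator_one_mul measurableSet_Ioo hs1,
      setIntegral_indicator_one_mul measurableSet_Ioo hs2]
  have c1 : ∫ x in Ioo l r, |θ t * χ' x * (w (t, x) * h (t, x))|
      ≤ ∫ x in Ioo l r, B * (K / d) * (((Ioo l (l + d)).indicator (fun _ => (1 : ℝ)) x
        + (Ioo (r - d) r).indicator (fun _ => 1) x) * |w (t, x) * h (t, x)|) := by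
    refine integral_mono_ae h5.abs ((Integrable.memLp_top_mul h4.abs
      ((hind _ measurableSet_Ioo).add (hind _ measurableSet_Ioo))).const_mul _)
      (Eventually.of_forall fun x => ?_)
    simp only
    rw [abs_mul, abs_mul, ← mul_assoc, mul_assoc B]
    exact mul_le_mul_of_nonneg_right (mul_le_mul (hθ t) (hχ x) (abs_nonneg _) hB0) (abs_nonneg _)
  have c2 := split _ h4.abs
  have c3 := split _ h6
  refine c1.trans ?_
  rw [integral_const_mul, c2, c3]
  have hc : 0 ≤ B * (K / d) := by positivity
  calc B * (K / d) * ((∫ x in Ioo l (l + d), |w (t, x) * h (t, x)|)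
        + ∫ x in Ioo (r - d) r, |w (t, x) * h (t, x)|)
      ≤ B * (K / d) * (d / 2 * (∫ x in Ioo l (l + d), (g (t, x) ^ 2 + h (t, x) ^ 2))
        + d / 2 * ∫ x in Ioo (r - d) r, (g (t, x) ^ 2 + h (t, x) ^ 2)) :=
        mul_le_mul_of_nonneg_left (add_le_add b1 b2) hc
    _ = _ := by field_simp

/-- Every interior point eventually leaves both strips, so the bound of `abs_integral_cutoff_le`
tends to zero by dominated convergence. -/
theorem tendsto_integral_cutoff {w g h : ℝ × ℝ → ℝ} (hw : MemLp w 2 (volCyl T l r))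
    (hg : MemLp g 2 (volCyl T l r)) (hh : MemLp h 2 (volCyl T l r))
    (hH : ∀ᵐ t ∂(volOm 0 T), ∫ x in Ioo l r, g (t, x) = 0 ∧
      ∀ᵐ x ∂(volOm l r), w (t, x) = ∫ y in l..x, g (t, y))
    {K : ℝ} (hK : 0 < K) {d : ℕ → ℝ} (hd : ∀ n, 0 < d n) (hdr : ∀ n, d n ≤ r - l)
    (hd0 : Tendsto d atTop (𝓝 0)) {χ : ℕ → 𝓓(Om l r, ℝ)}
    (hχ : ∀ n x, |deriv (χ n) x| ≤ K / d n * ((Ioo l (l + d n)).indicator (fun _ => 1) x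
        + (Ioo (r - d n) r).indicator (fun _ => 1) x)) (θ : 𝓓(Past T, ℝ)) :
    Tendsto (fun n => ∫ p in Ioo 0 T ×ˢ Ioo l r, θ p.1 * deriv (χ n) p.2 * (w p * h p)) atTop
      (𝓝 0) := by
  obtain ⟨B, hB0, hB, -⟩ := exists_bound_testFunction θ
  have hgh : Integrable (fun p => g p ^ 2 + h p ^ 2) (volCyl T l r) :=
    hg.integrable_sq.add hh.integrable_sq
  have hlim := tendsto_integral_bdd_mul hgh
    (h := fun n p => ((Ioo l (l + d n)).indicator (fun _ => (1 : ℝ)) p.2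
        + (Ioo (r - d n) r).indicator (fun _ => 1) p.2)) (k := fun _ => 0) (K := 2)
    (fun n => (((measurable_const.indicator measurableSet_Ioo).comp measurable_snd).add
      ((measurable_const.indicator measurableSet_Ioo).comp measurable_snd)).aestronglyMeasurable)
    (fun n => Eventually.of_forall fun p => by
      have : ∀ S : Set ℝ, |S.indicator (fun _ => (1 : ℝ)) p.2| ≤ 1 := fun S => by
        by_cases hx : p.2 ∈ S <;> simp [hx]
      exact (abs_add_le _ _).trans (by linarith [this (Ioo l (l + d n)), this (Ioo (r - d n) r)]))
    (by
      filter_upwards [ae_restrict_mem (measurableSet_Ioo.prod measurableSet_Ioo)] with p hp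
      refine tendsto_const_nhds.congr' ?_
      filter_upwards [hd0.eventually_lt_const (sub_pos.2 hp.2.1),
        hd0.eventually_lt_const (sub_pos.2 hp.2.2)] with n h1 h2
      rw [indicator_of_notMem (fun h => by linarith [h.2]),
        indicator_of_notMem (fun h => by linarith [h.1]), add_zero])
  simp only [zero_mul, integral_zero] at hlim
  refine squeeze_zero_norm (fun n => ?_) (by simpa using hlim.const_mul (B * K / 2))
  exact abs_integral_cutoff_le hw hg hh hH (hd n) (hdr n) hB0 hK θ.continuous hB
    (continuous_deriv_testFunction _) (hχ n)

end BoundaryLayer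

/-! ### Relative entropy without a spatial cutoff. -/

section RelativeEntropy

open Filter Topology

variable {T l r ε : ℝ} {f A : ℝ → ℝ} {u₀ : ℝ → ℝ} {u ux v : ℝ × ℝ → ℝ} {C : ℝ≥0}

/-- The only term without a visible factor `u - v` is a difference of values of `prim f`. Its
difference quotient is bounded, `prim f` being Lipschitz on the bounded range of `u` and `v`. The
factor is what the boundary layer estimate needs. -/
theorem exists_relFlux_eq_mul (hf : ContDiff ℝ 1 f)
    (hA : Continuous A) (hu : MemLp u ∞ (volCyl T l r)) (hux : MemLp ux 2 (volCyl T l r))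
    (hv : LipschitzWith C v) :
    ∃ h : ℝ × ℝ → ℝ, MemLp h 2 (volCyl T l r) ∧ ∀ p, relFlux ε f A u ux v p = (u p - v p) * h p := by
  have hv1 : MemLp v ∞ (volCyl T l r) := memLp_volCyl_of_continuous hv.continuous _
  have hPc := contDiff_prim hf.continuous
  have hPu : MemLp (fun p => prim f (u p)) ∞ (volCyl T l r) := memLp_top_comp hu hPc.continuous
  have hPv : MemLp (fun p => prim f (v p)) ∞ (volCyl T l r) := memLp_top_comp hv1 hPc.continuous
  refine ⟨fun p => f (u p) - (prim f (u p) - prim f (v p)) / (u p - v p) - ε * (A (u p) * ux p),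
    ((MemLp.sub (p := 2) ((memLp_top_comp hu hf.continuous).mono_exponent le_top) ?_)).sub
      ((hux.mul' (memLp_top_comp hu hA)).const_mul ε), fun p => ?_⟩
  · obtain ⟨M₁, hM₁, h1⟩ := exists_ae_abs_le hu
    obtain ⟨M₂, hM₂, h2⟩ := exists_ae_abs_le hv1
    obtain ⟨K, hK⟩ := (hPc.contDiffOn (s := Icc (-(M₁ + M₂)) (M₁ + M₂))).exists_lipschitzOnWith
      (by norm_num) (convex_Icc _ _) isCompact_Icc
    refine MemLp.of_bound ?_ K ?_
    · exact ((hPu.sub hPv).1.aemeasurable.div (hu.sub hv1).1.aemeasurable).aestronglyMeasurable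
    · filter_upwards [h1, h2] with p h1 h2
      rw [abs_le] at h1 h2
      have := hK.dist_le_mul (u p) ⟨by linarith, by linarith⟩ (v p) ⟨by linarith, by linarith⟩
      rw [Real.dist_eq, Real.dist_eq] at this
      rw [norm_div, Real.norm_eq_abs, Real.norm_eq_abs]
      exact div_le_of_le_mul₀ (abs_nonneg _) K.2 this
  -- Where `u = v` the quotient takes the default value zero of division, and both sides vanish.
  · by_cases hw : u p - v p = 0
    · have huv : u p = v p := by linarith
      simp [relFlux, huv]
    · have : (u p - v p) * ((prim f (u p) - prim f (v p)) / (u p - v p))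
          = prim f (u p) - prim f (v p) := mul_div_cancel₀ _ hw
      rw [relFlux, mul_sub, mul_sub, this]
      ring

/-- The relative entropy inequality with a test function of time only. -/
theorem rel_entropy_ineq (hT : 0 < T) (hlr : l < r) (hf : ContDiff ℝ 1 f)
    (hA : Continuous A) (hu₀ : MemLp u₀ 2 (volOm l r)) (hux : MemLp ux 2 (volCyl T l r))
    (hs : IsEntropySolution T l r ε f A quadEntropy (quadFlux f) u₀ u ux) (hv : LipschitzWith C v)
    (hH : ∀ᵐ t ∂(volOm 0 T), ∫ x in Ioo l r, (ux (t, x) - dx v (t, x)) = 0 ∧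
      ∀ᵐ x ∂(volOm l r), u (t, x) - v (t, x) = ∫ y in l..x, (ux (t, y) - dx v (t, y)))
    (θ : 𝓓(Past T, ℝ)) (hθ : ∀ t, 0 ≤ t → 0 ≤ θ t) :
    0 ≤ (∫ p in Ioo 0 T ×ˢ Ioo l r,
        (deriv θ p.1 * ((u p - v p) ^ 2 / 2) + θ p.1 * relProd ε f A u ux v p))
      + θ 0 * (sqInt (volOm l r) (fun x => u₀ x - v (0, x)) / 2) := by
  obtain ⟨K, χ, d, hK, hd, hdr, hd0, hχ0, hχ1, hχl, hχd⟩ := exists_cutoff hlr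
  have hu : MemLp u ∞ (volCyl T l r) := hs.bounded
  have hv1 : MemLp v ∞ (volCyl T l r) := memLp_volCyl_of_continuous hv.continuous _
  have hw : MemLp (fun p => u p - v p) 2 (volCyl T l r) := (hu.sub hv1).mono_exponent le_top
  obtain ⟨h, hh, hflux⟩ := exists_relFlux_eq_mul (ε := ε) hf hA hu hux hv
  have hG := integrable_relProd (ε := ε) hf hA hu hux hv
  have cθ : Continuous (deriv θ) := continuous_deriv_testFunction θ
  have tθ : MemLp (fun p : ℝ × ℝ => θ p.1) ∞ (volCyl T l r) :=
    memLp_volCyl_of_continuous (θ.continuous.comp continuous_fst) _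
  have tθ' : MemLp (fun p : ℝ × ℝ => deriv θ p.1) ∞ (volCyl T l r) :=
    memLp_volCyl_of_continuous (cθ.comp continuous_fst) _
  have i1 : Integrable (fun p : ℝ × ℝ => deriv θ p.1 * ((u p - v p) ^ 2 / 2)
      + θ p.1 * relProd ε f A u ux v p) (volCyl T l r) :=
    (Integrable.memLp_top_mul (hw.integrable_sq.div_const 2) tθ').add
      (Integrable.memLp_top_mul hG tθ)
  have hv0 : MemLp (fun x => v (0, x)) 2 (volOm l r) := by
    have hv0 : Continuous (fun x => v (0, x)) := hv.continuous.comp (by fun_prop)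
    obtain ⟨M, hM⟩ := (isCompact_Icc (a := l) (b := r)).exists_bound_of_continuousOn hv0.continuousOn
    refine MemLp.of_bound hv0.aestronglyMeasurable M ?_
    filter_upwards [ae_restrict_mem measurableSet_Ioo] with x hx
    exact hM x (Ioo_subset_Icc_self hx)
  have i3 : Integrable (fun x => θ 0 * ((u₀ x - v (0, x)) ^ 2 / 2)) (volOm l r) :=
    ((hu₀.sub hv0).integrable_sq.div_const 2).const_mul _
  have hχabs : ∀ n x, |χ n x| ≤ 1 := fun n x =>
    abs_le.2 ⟨by linarith [hχ0 n x], hχ1 n x⟩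
  have l1 := tendsto_integral_bdd_mul i1 (h := fun n p => χ n p.2) (k := fun _ => 1) (K := 1)
    (fun n => ((χ n).continuous.comp continuous_snd).aestronglyMeasurable)
    (fun n => Eventually.of_forall fun p => hχabs n p.2) (by
      filter_upwards [ae_restrict_mem (measurableSet_Ioo.prod measurableSet_Ioo)] with p hp
      exact hχl p.2 hp.2)
  -- The term with the derivative of the cutoff: its limit is zero, so no boundary flux survives.
  have l2 := tendsto_integral_cutoff hw (hux.sub (memLp_dx hv 2)) hh hH hK hd hdr hd0 hχd θ
  have l3 := tendsto_integral_bdd_mul i3 (h := fun n x => χ n x) (k := fun _ => 1) (K := 1)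
    (fun n => (χ n).continuous.aestronglyMeasurable)
    (fun n => Eventually.of_forall fun x => hχabs n x) (by
      filter_upwards [ae_restrict_mem measurableSet_Ioo] with x hx
      exact hχl x hx)
  have lim := (l1.add l2).add l3
  simp only [one_mul, add_zero] at lim
  have e0 : ∫ x in Ioo l r, θ 0 * ((u₀ x - v (0, x)) ^ 2 / 2)
      = θ 0 * (sqInt (volOm l r) (fun x => u₀ x - v (0, x)) / 2) := by
    rw [integral_const_mul, integral_div]; rfl
  rw [← e0]
  refine ge_of_tendsto' lim fun n => ?_
  refine (rel_entropy_ineq_tensor hT hlr hf hA hu₀ hux hs hv θ hθ (χ n) (hχ0 n)).trans (le_of_eq ?_)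
  have j1 : Integrable (fun p : ℝ × ℝ => χ n p.2 * (deriv θ p.1 * ((u p - v p) ^ 2 / 2)
      + θ p.1 * relProd ε f A u ux v p)) (volCyl T l r) :=
    Integrable.memLp_top_mul i1
      (memLp_volCyl_of_continuous ((χ n).continuous.comp continuous_snd) _)
  have j2 : Integrable (fun p : ℝ × ℝ => θ p.1 * deriv (χ n) p.2 * ((u p - v p) * h p))
      (volCyl T l r) :=
    Integrable.memLp_top_mul (integrable_mul_of_memLp_two hw hh)
      (memLp_top_tensor θ.continuous (continuous_deriv_testFunction _))
  refine congrArg₂ _ (Eq.trans (integral_congr_ae (Eventually.of_forall fun p => ?_))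
    (integral_add j1 j2)) (integral_congr_ae (Eventually.of_forall fun x => ?_))
  · simp only [hflux]
    ring
  · simp only
    ring

end RelativeEntropy

/-! ### Weak differential inequalities in time. -/

section Time

open Filter Topology
open scoped Convolution

variable {T l r : ℝ}

/-- Once its radius is small, a mollifier centred at an interior point `t` is an admissible
nonnegative test function; at almost every `t` the averages converge to `k t`. -/
theorem ae_nonneg_of_integral_testFunction_mul_nonneg {k : ℝ → ℝ} (hk : Integrable k (volOm l r))
    (h : ∀ θ : 𝓓(Om l r, ℝ), (∀ t, 0 ≤ θ t) → 0 ≤ ∫ t in Ioo l r, θ t * k t) :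
    ∀ᵐ t ∂(volOm l r), 0 ≤ k t := by
  let φ : ℕ → ContDiffBump (0 : ℝ) := fun n =>
    ⟨1 / ((n : ℝ) + 1) / 2, 1 / ((n : ℝ) + 1), by positivity, half_lt_self (by positivity)⟩
  have hφ : Tendsto (fun n => (φ n).rOut) atTop (𝓝 0) := tendsto_one_div_add_atTop_nhds_zero_nat
  have hk1 : Integrable ((Ioo l r).indicator k) := (integrable_indicator_iff measurableSet_Ioo).2 hk
  have key := ContDiffBump.ae_convolution_tendsto_right_of_locallyIntegrable (K := 2) hφ
      (Eventually.of_forall fun n => by simp only [φ]; linarith) hk1.locallyIntegrable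
  rw [ae_restrict_iff' measurableSet_Ioo]
  filter_upwards [key] with t ht htm
  rw [indicator_of_mem htm] at ht
  refine ge_of_tendsto ht ?_
  filter_upwards [hφ.eventually_lt_const (sub_pos.2 htm.1),
    hφ.eventually_lt_const (sub_pos.2 htm.2)] with n h1 h2
  have hts : tsupport (fun y => (φ n).normed volume (t - y)) ⊆ Icc (t - (φ n).rOut)
      (t + (φ n).rOut) := by
    refine closure_minimal (fun y hy => ?_) isClosed_Icc
    have hy' : t - y ∈ Function.support ((φ n).normed volume) := hy
    rw [(φ n).support_normed_eq, Real.ball_eq_Ioo] at hy'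
    constructor <;> linarith [hy'.1, hy'.2]
  let θ : 𝓓(Om l r, ℝ) := ⟨fun y => (φ n).normed volume (t - y),
    (φ n).contDiff_normed.comp (contDiff_const.sub contDiff_id),
    HasCompactSupport.of_support_subset_isCompact isCompact_Icc ((subset_tsupport _).trans hts),
    fun y hy => ⟨by linarith [(hts hy).1], by linarith [(hts hy).2]⟩⟩
  have h3 := h θ fun y => (φ n).nonneg_normed _
  rw [convolution_eq_swap]
  refine h3.trans (le_of_eq ?_)
  rw [← integral_indicator measurableSet_Ioo]
  refine integral_congr_ae (Eventually.of_forall fun y => ?_)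
  by_cases hy : y ∈ Ioo l r
  · rw [indicator_of_mem hy]
    beta_reduce
    rw [indicator_of_mem hy]
    rfl
  · simp [hy]

/-- For nonnegative times `θ` is the integral of `h` from `t` to `T`. A nonnegative density `h`
thereby becomes a test function that carries the initial value. -/
theorem exists_testFunction_deriv_eq_neg (hT : 0 < T) (h : 𝓓(Om 0 T, ℝ)) (h0 : ∀ t, 0 ≤ h t) :
    ∃ θ : 𝓓(Past T, ℝ), (∀ t, 0 ≤ t → 0 ≤ θ t) ∧ (∀ t, 0 ≤ t → deriv θ t = -h t) ∧
      θ 0 = ∫ t in Ioo 0 T, h t := by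
  obtain ⟨b, hbT, hb⟩ : ∃ b < T, ∀ t, b < t → h t = 0 := by
    have hc : IsCompact (tsupport h) := h.hasCompactSupport
    rcases (tsupport h).eq_empty_or_nonempty with he | hne
    · refine ⟨0, hT, fun t _ => ?_⟩
      by_contra hne
      have := subset_tsupport _ (Function.mem_support.2 hne)
      rw [he] at this
      exact this
    · refine ⟨sSup (tsupport h), (h.tsupport_subset (hc.sSup_mem hne)).2, fun t ht => ?_⟩
      by_contra hne
      exact absurd (le_csSup hc.bddAbove (subset_tsupport _ (Function.mem_support.2 hne))) (not_le.2 ht)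
  let P : ℝ → ℝ := fun t => ∫ s in t..T, h s
  have hP : ∀ t, HasDerivAt P (-h t) t := fun t =>
    intervalIntegral.integral_hasDerivAt_left (h.continuous.intervalIntegrable _ _)
      h.continuous.aestronglyMeasurable.stronglyMeasurableAtFilter h.continuous.continuousAt
  have hPd : deriv P = fun t => -h t := funext fun t => (hP t).deriv
  have hPs : ContDiff ℝ (⊤ : ℕ∞) P := contDiff_infty_iff_deriv.2
    ⟨fun t => (hP t).differentiableAt, by rw [hPd]; exact h.contDiff.neg⟩
  -- The transition equals 1 for `t ≥ -1` and 0 for `t ≤ -2`: it provides compact support and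
  -- changes nothing at nonnegative times.
  let c : ℝ → ℝ := fun t => Real.smoothTransition (t + 2) * P t
  have hcs : ContDiff ℝ (⊤ : ℕ∞) c :=
    (Real.smoothTransition.contDiff.comp (contDiff_id.add contDiff_const)).mul hPs
  have hts : tsupport c ⊆ Icc (-2) b := by
    refine closure_minimal (fun t ht => ?_) isClosed_Icc
    have ht' : Real.smoothTransition (t + 2) * P t ≠ 0 := ht
    constructor
    · by_contra h1
      exact ht' (by rw [Real.smoothTransition.zero_of_nonpos (by linarith), zero_mul])
    · by_contra h1
      refine ht' ?_
      have : P t = 0 := intervalIntegral.integral_zero_ae (Eventually.of_forall fun s hs => by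
        refine hb s ?_
        have := hs.1
        rcases min_lt_iff.1 this with h' | h' <;> linarith)
      rw [this, mul_zero]
  have hc1 : ∀ t, 0 ≤ t → c =ᶠ[𝓝 t] P := fun t ht => by
    filter_upwards [Ioi_mem_nhds (by linarith : -1 < t)] with s hs
    have hs' : -1 < s := hs
    simp only [c, Real.smoothTransition.one_of_one_le (by linarith : 1 ≤ s + 2), one_mul]
  refine ⟨⟨c, hcs, HasCompactSupport.of_support_subset_isCompact isCompact_Icc
    ((subset_tsupport _).trans hts), fun t ht => (hts ht).2.trans_lt hbT⟩, fun t ht => ?_,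
    fun t ht => ?_, ?_⟩
  · change 0 ≤ c t
    rw [(hc1 t ht).eq_of_nhds]
    rcases le_or_gt t T with h1 | h1
    · exact intervalIntegral.integral_nonneg h1 fun s _ => h0 s
    · have : P t = 0 := intervalIntegral.integral_zero_ae (Eventually.of_forall fun s hs => by
        refine hb s ?_
        have := hs.1
        rcases min_lt_iff.1 this with h' | h' <;> linarith)
      rw [this]
  · change deriv c t = -h t
    rw [(hc1 t ht).deriv_eq, hPd]
  · change c 0 = _
    rw [(hc1 0 le_rfl).eq_of_nhds, ← intervalIntegral_eq_setIntegral_Ioo hT.le]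

/-- A weak differential inequality in time with initial value holds in integrated form. -/
theorem ae_le_add_integral_of_weak_ineq (hT : 0 < T) {N g : ℝ → ℝ}
    (hN : Integrable N (volOm 0 T)) (hg : Integrable g (volOm 0 T)) {E : ℝ}
    (h : ∀ θ : 𝓓(Past T, ℝ), (∀ t, 0 ≤ t → 0 ≤ θ t) →
      0 ≤ (∫ t in Ioo 0 T, (deriv θ t * N t + θ t * g t)) + θ 0 * E) :
    ∀ᵐ t ∂(volOm 0 T), N t ≤ E + ∫ s in (0 : ℝ)..t, g s := by
  have hi := intervalIntegrable_of_integrable_volOm hg (left_mem_Icc.2 hT.le)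
    (right_mem_Icc.2 hT.le)
  have hP : Integrable (fun t => ∫ s in (0 : ℝ)..t, g s) (volOm 0 T) :=
    ((continuousOn_primitive_Icc hT.le hg).integrableOn_Icc).mono_set Ioo_subset_Icc_self
  have hk : Integrable (fun t => E + (∫ s in (0 : ℝ)..t, g s) - N t) (volOm 0 T) :=
    ((integrable_const E).add hP).sub hN
  refine (ae_nonneg_of_integral_testFunction_mul_nonneg hk fun η hη => ?_).mono
    fun t ht => by linarith
  obtain ⟨θ, hθ0, hθd, hθi⟩ := exists_testFunction_deriv_eq_neg hT η hη
  have h1 := h θ hθ0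
  have hac := hi.absolutelyContinuousOnInterval_intervalIntegral (c := 0) left_mem_uIcc
  -- Integration by parts exchanges `θ * g` for `η` times the primitive of `g`, so that `η`
  -- multiplies every term.
  have h2 := integral_time_by_parts hT hac θ
  rw [intervalIntegral.integral_same, mul_zero, neg_zero] at h2
  have hθb : MemLp θ ∞ (volOm 0 T) :=
    (θ.continuous.memLp_of_hasCompactSupport θ.hasCompactSupport).restrict _
  have hηb : MemLp η ∞ (volOm 0 T) := memLp_testFunction η _
  have e1 : ∫ t in Ioo 0 T, (deriv θ t * (∫ s in (0 : ℝ)..t, g s)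
      + θ t * deriv (fun t => ∫ s in (0 : ℝ)..t, g s) t)
      = ∫ t in Ioo 0 T, (-(η t * ∫ s in (0 : ℝ)..t, g s) + θ t * g t) := by
    refine integral_congr_ae ?_
    have h3 := hi.ae_hasDerivAt_integral
    rw [EventuallyEq, ae_restrict_iff' measurableSet_Ioo]
    filter_upwards [h3] with t ht htm
    have hm : t ∈ uIcc 0 T := by
      rw [uIcc_of_le hT.le]; exact Ioo_subset_Icc_self htm
    rw [(ht hm 0 left_mem_uIcc).deriv, hθd t htm.1.le]
    ring
  have e2 : ∫ t in Ioo 0 T, (deriv θ t * N t + θ t * g t)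
      = ∫ t in Ioo 0 T, (-(η t * N t) + θ t * g t) := by
    refine setIntegral_congr_fun measurableSet_Ioo fun t htm => ?_
    rw [hθd t htm.1.le]
    ring
  have i1 : Integrable (fun t => η t * ∫ s in (0 : ℝ)..t, g s) (volOm 0 T) :=
    Integrable.memLp_top_mul hP hηb
  have i2 : Integrable (fun t => η t * N t) (volOm 0 T) := Integrable.memLp_top_mul hN hηb
  have i3 : Integrable (fun t => θ t * g t) (volOm 0 T) := Integrable.memLp_top_mul hg hθb
  have i4 : Integrable (fun t => η t * E) (volOm 0 T) :=
    (hηb.integrable le_top).mul_const E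
  have s1 : ∫ t in Ioo 0 T, (-(η t * ∫ s in (0 : ℝ)..t, g s) + θ t * g t)
      = -(∫ t in Ioo 0 T, η t * ∫ s in (0 : ℝ)..t, g s) + ∫ t in Ioo 0 T, θ t * g t :=
    (integral_add i1.neg i3).trans (congrArg₂ _ (integral_neg _) rfl)
  have s2 : ∫ t in Ioo 0 T, (-(η t * N t) + θ t * g t)
      = -(∫ t in Ioo 0 T, η t * N t) + ∫ t in Ioo 0 T, θ t * g t :=
    (integral_add i2.neg i3).trans (congrArg₂ _ (integral_neg _) rfl)
  have s3 : ∫ t in Ioo 0 T, η t * (E + (∫ s in (0 : ℝ)..t, g s) - N t)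
      = (∫ t in Ioo 0 T, η t * E) + (∫ t in Ioo 0 T, η t * ∫ s in (0 : ℝ)..t, g s)
        - ∫ t in Ioo 0 T, η t * N t := by
    refine Eq.trans (integral_congr_ae (Eventually.of_forall fun t => ?_))
      ((integral_sub (i4.add i1) i2).trans (congrArg₂ _ (integral_add i4 i1) rfl))
    simp only [Pi.add_apply]
    ring
  rw [integral_mul_const] at s3
  rw [s3]
  rw [e1, s1] at h2
  rw [e2, s2, hθi] at h1
  linarith

end Time

/-! ### Grönwall's inequality and the energy estimate. -/

section Gronwall

open Filter Topology

/-- An integral form of Grönwall's inequality. -/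
theorem gronwall_integral {t D κ : ℝ} (ht : 0 < t) (hκ : 0 ≤ κ) {N : ℝ → ℝ}
    (hN : Integrable N (volOm 0 t))
    (h : ∀ τ ∈ Ioc 0 t, ∀ᵐ s ∂(volOm 0 τ), N s ≤ D + κ * ∫ s in (0 : ℝ)..τ, N s) :
    D + κ * ∫ s in (0 : ℝ)..t, N s ≤ D * Real.exp (κ * t) := by
  set Φ : ℝ → ℝ := fun τ => D + κ * ∫ s in (0 : ℝ)..τ, N s with hΦ
  have hc : ContinuousOn Φ (Icc 0 t) :=
    continuousOn_const.add (continuousOn_const.mul (continuousOn_primitive_Icc ht.le hN))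
  have key := le_gronwallBound_of_liminf_deriv_right_le (f := Φ) (f' := fun x => κ * Φ x)
    (δ := D) (K := κ) (ε := 0) hc (fun x hx ρ hρ => ?_) (by simp [hΦ]) (fun x _ => by simp) t
    (right_mem_Icc.2 ht.le)
  · rw [gronwallBound_ε0, sub_zero] at key
    exact key
  · refine Eventually.frequently ?_
    have hcx : Tendsto Φ (𝓝[>] x) (𝓝 (Φ x)) := by
      rw [← nhdsWithin_Ioc_eq_nhdsGT hx.2]
      exact (hc x ⟨hx.1, hx.2.le⟩).mono_left
        (nhdsWithin_mono _ fun z hz => ⟨hx.1.trans hz.1.le, hz.2⟩)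
    have hev : Ioc x t ∈ 𝓝[>] x := Ioc_mem_nhdsGT hx.2
    filter_upwards [(hcx.const_mul κ).eventually_lt_const hρ, hev] with z hz hzm
    have hzx : 0 < z - x := sub_pos.2 hzm.1
    have h0z : 0 < z := hx.1.trans_lt hzm.1
    have i1 := intervalIntegrable_of_integrable_volOm hN (left_mem_Icc.2 ht.le)
      (⟨hx.1, hx.2.le⟩ : x ∈ Icc 0 t)
    have i2 := intervalIntegrable_of_integrable_volOm hN (⟨hx.1, hx.2.le⟩ : x ∈ Icc 0 t)
      (⟨h0z.le, hzm.2⟩ : z ∈ Icc 0 t)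
    have e1 : Φ z - Φ x = κ * ∫ s in x..z, N s := by
      simp only [hΦ]
      rw [← intervalIntegral.integral_add_adjacent_intervals i1 i2]
      ring
    -- The hypothesis at time `z` bounds `N` on all of `(x, z)` by `Φ z`. The difference quotient of
    -- `Φ` is therefore at most `κ * Φ z`, which tends to `κ * Φ x` by continuity.
    have hb : ∫ s in x..z, N s ≤ (z - x) * Φ z := by
      rw [intervalIntegral_eq_setIntegral_Ioo hzm.1.le]
      have hsub : Ioo x z ⊆ Ioo 0 z := Ioo_subset_Ioo hx.1 le_rfl
      have h1 : ∫ s in Ioo x z, N s ≤ ∫ s in Ioo x z, Φ z :=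
        integral_mono_ae (hN.mono_measure (Measure.restrict_mono
          (hsub.trans (Ioo_subset_Ioo le_rfl hzm.2)) le_rfl)) (integrable_const _)
          (ae_restrict_of_ae_restrict_of_subset hsub (h z ⟨h0z, hzm.2⟩))
      refine h1.trans (le_of_eq ?_)
      simp [hzm.1.le]
    rw [e1, inv_mul_lt_iff₀ hzx]
    calc κ * ∫ s in x..z, N s ≤ κ * ((z - x) * Φ z) := mul_le_mul_of_nonneg_left hb hκ
      _ = (z - x) * (κ * Φ z) := by ring
      _ < (z - x) * ρ := mul_lt_mul_of_pos_left hz hzx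

/-- Here `m ^ 2` is the essential supremum of the positive part of `N`, taken in `ℝ≥0∞`, where no
boundedness condition is attached to it. Writing it as a square makes the contribution of `ρ` linear
in `m`. -/
theorem exists_ae_sup {τ B : ℝ} (hB : 0 ≤ B) {N : ℝ → ℝ}
    (hNB : ∀ᵐ s ∂(volOm 0 τ), N s ≤ B) :
    ∃ m : ℝ, 0 ≤ m ∧ (∀ᵐ s ∂(volOm 0 τ), N s ≤ m ^ 2) ∧
      ∀ c : ℝ, 0 ≤ c → (∀ᵐ s ∂(volOm 0 τ), N s ≤ c) → m ^ 2 ≤ c := by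
  set S := essSup (fun s => ENNReal.ofReal (N s)) (volOm 0 τ) with hS
  have hle : ∀ c : ℝ, 0 ≤ c → (∀ᵐ s ∂(volOm 0 τ), N s ≤ c) → S ≤ ENNReal.ofReal c := fun c _ h =>
    essSup_le_of_ae_le _ (h.mono fun s hs => ENNReal.ofReal_le_ofReal hs)
  have hfin : S ≠ ∞ := ((hle B hB hNB).trans_lt ENNReal.ofReal_lt_top).ne
  refine ⟨√S.toReal, Real.sqrt_nonneg _, ?_, fun c hc h => ?_⟩
  · filter_upwards [ENNReal.ae_le_essSup (μ := volOm 0 τ) (fun s => ENNReal.ofReal (N s))]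
      with s hs
    rw [Real.sq_sqrt ENNReal.toReal_nonneg]
    exact (ENNReal.ofReal_le_iff_le_toReal hfin).1 hs
  · rw [Real.sq_sqrt ENNReal.toReal_nonneg]
    exact ENNReal.toReal_le_of_le_ofReal hc (hle c hc h)

theorem setIntegral_Ioo_mono_right {s t : ℝ} (hst : s ≤ t) {h : ℝ → ℝ} (h0 : ∀ x, 0 ≤ h x)
    (hi : Integrable h (volOm 0 t)) : ∫ x in Ioo 0 s, h x ≤ ∫ x in Ioo 0 t, h x :=
  setIntegral_mono_set hi (Eventually.of_forall h0)
    (Ioo_subset_Ioo le_rfl hst).eventuallyLE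

/-- The energy estimate: from the relative entropy inequality to the stability bound. -/
theorem energy_estimate {T ε α Λ φ E B : ℝ} (hε : 0 < ε)
    (hΛ : 0 ≤ Λ) (hφ : 0 ≤ φ) (hE : 0 ≤ E) (hB : 0 ≤ B) {N D ρ R G : ℝ → ℝ}
    (hN0 : ∀ s, 0 ≤ N s) (hD0 : ∀ s, 0 ≤ D s) (hρ0 : ∀ s, 0 ≤ ρ s)
    (hNB : ∀ᵐ s ∂(volOm 0 T), N s ≤ B) (hN : Integrable N (volOm 0 T))
    (hD : Integrable D (volOm 0 T)) (hρ : Integrable ρ (volOm 0 T))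
    (hR : Integrable (fun s => R s ^ 2) (volOm 0 T)) (hG : Integrable G (volOm 0 T))
    (hGle : ∀ᵐ s ∂(volOm 0 T), G s ≤ -(ε * D s) + ε * α * Λ * (√(N s) * √(D s))
      + φ / 2 * Λ * N s + ρ s * √(N s) + ε * R s * √(D s))
    (h : ∀ᵐ t ∂(volOm 0 T), N t / 2 ≤ E / 2 + ∫ s in (0 : ℝ)..t, G s) :
    ∀ᵐ t ∂(volOm 0 T), ∀ᵐ s ∂(volOm 0 t), N s + 2 * ε * ∫ σ in Ioo 0 t, D σ
      ≤ (4 * E + 16 * (∫ σ in Ioo 0 t, ρ σ) ^ 2 + 8 * ε * ∫ σ in Ioo 0 t, R σ ^ 2)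
        * Real.exp (8 * ((ε * Λ * α ^ 2 + φ) * Λ) * t) := by
  set K := (ε * Λ * α ^ 2 + φ) * Λ with hK
  have hK0 : 0 ≤ K := by positivity
  have hρN : Integrable (fun s => ρ s * √(N s)) (volOm 0 T) := by
    refine Integrable.mul_memLp_top hρ (memLp_top_of_bound
      (Real.continuous_sqrt.comp_aestronglyMeasurable hN.1) (√B) ?_)
    filter_upwards [hNB] with s hs
    rw [Real.norm_of_nonneg (Real.sqrt_nonneg _)]
    exact Real.sqrt_le_sqrt hs
  have hsub : ∀ {t : ℝ}, t ∈ Ioo 0 T → volOm 0 t ≤ volOm 0 T := fun ht =>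
    Measure.restrict_mono (Ioo_subset_Ioo le_rfl ht.2.le) le_rfl
  have hae : ∀ {t : ℝ} {P : ℝ → Prop}, t ∈ Ioo 0 T → (∀ᵐ s ∂(volOm 0 T), P s) →
      ∀ᵐ s ∂(volOm 0 t), P s := fun ht hP => ae_mono (hsub ht) hP
  -- integrated inequality with a Young parameter
  have young : ∀ c : ℝ, 1 ≤ c → ∀ᵐ t ∂(volOm 0 T),
      N t + (2 - 2 / c) * ε * (∫ s in Ioo 0 t, D s) ≤ E + c * K * (∫ s in Ioo 0 t, N s)
        + 2 * (∫ s in Ioo 0 t, ρ s * √(N s)) + c * ε * ∫ s in Ioo 0 t, R s ^ 2 := by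
    intro c hc
    have hc0 : 0 < c := by linarith
    filter_upwards [h, ae_restrict_mem measurableSet_Ioo] with t ht htm
    have hm := hsub htm
    have jN := hN.mono_measure hm
    have jD := hD.mono_measure hm
    have jρ := hρN.mono_measure hm
    have jR := hR.mono_measure hm
    have i1 : Integrable (fun s => -((2 - 2 / c) * ε * D s) + c * K * N s + 2 * (ρ s * √(N s))
        + c * ε * R s ^ 2) (volOm 0 t) :=
      (((jD.const_mul _).neg.add (jN.const_mul _)).add (jρ.const_mul _)).add (jR.const_mul _)
    have e1 : ∫ s in Ioo 0 t, (-((2 - 2 / c) * ε * D s) + c * K * N s + 2 * (ρ s * √(N s))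
        + c * ε * R s ^ 2) = -((2 - 2 / c) * ε * ∫ s in Ioo 0 t, D s)
          + c * K * (∫ s in Ioo 0 t, N s) + 2 * (∫ s in Ioo 0 t, ρ s * √(N s))
          + c * ε * ∫ s in Ioo 0 t, R s ^ 2 := by
      simp only [← integral_const_mul, ← integral_neg]
      exact (integral_add (((jD.const_mul _).neg.add (jN.const_mul _)).add (jρ.const_mul _))
        (jR.const_mul _)).trans (congrArg₂ _ ((integral_add ((jD.const_mul _).neg.add
          (jN.const_mul _)) (jρ.const_mul _)).trans (congrArg₂ _ (integral_add
            (jD.const_mul _).neg (jN.const_mul _)) rfl)) rfl)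
    have e2 : ∫ s in Ioo 0 t, 2 * G s ≤ ∫ s in Ioo 0 t, (-((2 - 2 / c) * ε * D s) + c * K * N s
        + 2 * (ρ s * √(N s)) + c * ε * R s ^ 2) := by
      refine integral_mono_ae ((hG.mono_measure hm).const_mul 2) i1 ?_
      filter_upwards [hae htm hGle] with s hs
      have q1 := Real.sq_sqrt (hN0 s)
      have q2 := Real.sq_sqrt (hD0 s)
      set n := √(N s)
      set g := √(D s)
      rw [← q1, ← q2] at hs ⊢
      -- Both mixed terms are absorbed by Young's inequality with weight `c`. After doubling, each
      -- spends `ε / c` of the dissipation `2 * ε`, which leaves `(2 - 2 / c) * ε`.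
      have y1 : 0 ≤ ε / c * (g - c * (α * Λ * n)) ^ 2 := by positivity
      have y2 : 0 ≤ ε / c * (g - c * R s) ^ 2 := by positivity
      have x1 : ε / c * (g - c * (α * Λ * n)) ^ 2
          = ε / c * g ^ 2 - 2 * ε * α * Λ * (n * g) + c * (ε * α ^ 2 * Λ ^ 2 * n ^ 2) := by
        field_simp
        ring
      have x2 : ε / c * (g - c * R s) ^ 2
          = ε / c * g ^ 2 - 2 * ε * R s * g + c * ε * R s ^ 2 := by
        field_simp
        ring
      have x3 : φ * Λ * n ^ 2 ≤ c * (φ * Λ * n ^ 2) :=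
        le_mul_of_one_le_left (by positivity) hc
      have x4 : (2 - 2 / c) * ε * g ^ 2 = 2 * ε * g ^ 2 - 2 * (ε / c * g ^ 2) := by
        field_simp
      have x5 : c * K * n ^ 2 = c * (ε * α ^ 2 * Λ ^ 2 * n ^ 2) + c * (φ * Λ * n ^ 2) := by
        rw [hK]; ring
      rw [x4, x5]
      linarith
    rw [integral_const_mul, e1] at e2
    rw [intervalIntegral_eq_setIntegral_Ioo htm.1.le] at ht
    linarith
  -- the bound for the supremum up to a given time
  have sup : ∀ t ∈ Ioo 0 T, ∀ m : ℝ, 0 ≤ m → (∀ᵐ s ∂(volOm 0 t), N s ≤ m ^ 2) →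
      (∀ c : ℝ, 0 ≤ c → (∀ᵐ s ∂(volOm 0 t), N s ≤ c) → m ^ 2 ≤ c) →
      (∫ s in Ioo 0 t, ρ s * √(N s)) ≤ m * (∫ s in Ioo 0 t, ρ s) ∧
      m ^ 2 ≤ E + K * (∫ s in Ioo 0 t, N s) + 2 * (m * ∫ s in Ioo 0 t, ρ s)
        + ε * ∫ s in Ioo 0 t, R s ^ 2 := by
    intro t htm m hm0 hm hmin
    have hms := hsub htm
    have b1 : (∫ s in Ioo 0 t, ρ s * √(N s)) ≤ m * ∫ s in Ioo 0 t, ρ s := by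
      rw [← integral_const_mul]
      refine integral_mono_ae (hρN.mono_measure hms) ((hρ.mono_measure hms).const_mul m) ?_
      filter_upwards [hm] with s hs
      rw [mul_comm m]
      exact mul_le_mul_of_nonneg_left (Real.sqrt_le_iff.2 ⟨hm0, hs⟩) (hρ0 s)
    refine ⟨b1, hmin _ ?_ ?_⟩
    · have c1 : 0 ≤ ∫ s in Ioo 0 t, N s := integral_nonneg hN0
      have c2 : 0 ≤ ∫ s in Ioo 0 t, ρ s := integral_nonneg hρ0
      have c3 : 0 ≤ ∫ s in Ioo 0 t, R s ^ 2 := integral_nonneg fun _ => sq_nonneg _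
      positivity
    -- The weight 1 spends the whole dissipation and gives a bound for `N` alone; as the right side
    -- is monotone in time, it bounds the supremum.
    · filter_upwards [hae htm (young 1 le_rfl), ae_restrict_mem measurableSet_Ioo] with s hs hsm
      have d1 := setIntegral_Ioo_mono_right hsm.2.le hN0 (hN.mono_measure hms)
      have d2 := setIntegral_Ioo_mono_right hsm.2.le
        (fun s => mul_nonneg (hρ0 s) (Real.sqrt_nonneg _)) (hρN.mono_measure hms)
      have d3 := setIntegral_Ioo_mono_right hsm.2.le (fun s => sq_nonneg (R s))
        (hR.mono_measure hms)
      have d4 := mul_le_mul_of_nonneg_left d1 hK0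
      have d5 := mul_le_mul_of_nonneg_left d3 hε.le
      norm_num at hs
      linarith
  -- The weight 4 keeps the dissipation `3 / 2 * ε`.
  filter_upwards [young 4 (by norm_num), ae_restrict_mem measurableSet_Ioo] with t ht htm
  have hms := hsub htm
  set I := ∫ s in Ioo 0 t, N s with hI
  set P := ∫ s in Ioo 0 t, ρ s with hP
  set Q := ∫ s in Ioo 0 t, R s ^ 2 with hQ
  have hP0 : 0 ≤ P := integral_nonneg hρ0
  have gron := gronwall_integral (D := 4 * E + 16 * P ^ 2 + 8 * ε * Q) htm.1
    (by positivity : 0 ≤ 8 * K) (hN.mono_measure hms) (fun τ hτ => by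
      have hτm : τ ∈ Ioo 0 T := ⟨hτ.1, hτ.2.trans_lt htm.2⟩
      obtain ⟨m, hm0, hm, hmin⟩ := exists_ae_sup hB (hae hτm hNB)
      obtain ⟨-, k2⟩ := sup τ hτm m hm0 hm hmin
      have p1 := setIntegral_Ioo_mono_right hτ.2 hρ0 (hρ.mono_measure hms)
      have p2 := setIntegral_Ioo_mono_right hτ.2 (fun s => sq_nonneg (R s)) (hR.mono_measure hms)
      have p3 : 0 ≤ ∫ s in Ioo 0 τ, N s := integral_nonneg hN0
      have p4 : 0 ≤ ∫ s in Ioo 0 τ, ρ s := integral_nonneg hρ0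
      rw [intervalIntegral_eq_setIntegral_Ioo hτ.1.le]
      filter_upwards [hm] with s hs
      have p5 := mul_le_mul_of_nonneg_left p2 hε.le
      have p6 := mul_le_mul_of_nonneg_left p1 hm0
      have p7 := mul_nonneg hK0 p3
      have p8 : 0 ≤ ε * Q := mul_nonneg hε.le (integral_nonneg fun _ => sq_nonneg _)
      -- The square gives 2mP ≤ m²/2 + 2P², so half of m² is absorbed on the left.
      nlinarith [sq_nonneg (m - 2 * P), sq_nonneg P])
  rw [intervalIntegral_eq_setIntegral_Ioo htm.1.le] at gron
  obtain ⟨m, hm0, hm, hmin⟩ := exists_ae_sup hB (hae htm hNB)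
  obtain ⟨k1, k2⟩ := sup t htm m hm0 hm hmin
  filter_upwards [hm] with s hs
  refine le_trans ?_ gron
  norm_num at ht
  have k3 : 0 ≤ K * I := mul_nonneg hK0 (integral_nonneg hN0)
  have k4 : 0 ≤ ε * Q := mul_nonneg hε.le (integral_nonneg fun _ => sq_nonneg _)
  have k5 := hN0 t
  -- Twice the supremum bound plus 4/3 of the weight 4 inequality has m² to spare on the left and
  -- (20/3) mP on the right; the square bounds the latter by m² + (100/9) P². All resulting
  -- coefficients are below 4, 16 and 8.
  nlinarith [sq_nonneg (m - 10 / 3 * P), sq_nonneg P]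

end Gronwall

/-! ### Estimate of the relative entropy production. -/

section Slice

variable {T l r ε : ℝ} {f A : ℝ → ℝ} {u ux v r₁ : ℝ × ℝ → ℝ} {C : ℝ≥0}

/-- The remainder is the integral of the increment of `deriv f` along the segment from `y` to `x`.
The mean value inequality bounds the increment linearly in the parameter, whence the factor 1/2. -/
theorem abs_sub_sub_deriv_mul_le {f : ℝ → ℝ} (hf : ContDiff ℝ 2 f) {s : Set ℝ} (hs : Convex ℝ s)
    {φ : ℝ} (hφ : ∀ w ∈ s, |deriv (deriv f) w| ≤ φ) {x y : ℝ} (hx : x ∈ s) (hy : y ∈ s) :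
    |f x - f y - deriv f y * (x - y)| ≤ φ / 2 * (x - y) ^ 2 := by
  have hf1 : Differentiable ℝ f := hf.differentiable (by norm_num)
  have hf' : ContDiff ℝ 1 (deriv f) := ((contDiff_succ_iff_deriv (n := 1)).1 hf).2.2
  have hlip : ∀ w ∈ s, |deriv f w - deriv f y| ≤ φ * |w - y| := fun w hw =>
    hs.norm_image_sub_le_of_norm_deriv_le
      (fun z _ => (hf'.differentiable (by norm_num)).differentiableAt) hφ hy hw
  have hd : ∀ τ : ℝ, HasDerivAt (fun τ => f (y + τ * (x - y)) - τ * (deriv f y * (x - y)))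
      (deriv f (y + τ * (x - y)) * (x - y) - deriv f y * (x - y)) τ := fun τ => by
    have h1 : HasDerivAt (fun τ : ℝ => y + τ * (x - y)) (x - y) τ := by
      simpa using ((hasDerivAt_id τ).mul_const (x - y)).const_add y
    have h2 := (hf1 (y + τ * (x - y))).hasDerivAt.comp τ h1
    have h3 : HasDerivAt (fun τ : ℝ => τ * (deriv f y * (x - y))) (deriv f y * (x - y)) τ := by
      simpa using (hasDerivAt_id τ).mul_const (deriv f y * (x - y))
    exact h2.sub h3
  have hc : Continuous fun τ : ℝ => deriv f (y + τ * (x - y)) * (x - y) - deriv f y * (x - y) := by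
    have := hf'.continuous
    fun_prop
  have hI := intervalIntegral.integral_eq_sub_of_hasDerivAt (a := 0) (b := 1) (fun τ _ => hd τ)
    (hc.intervalIntegrable _ _)
  have e : f x - f y - deriv f y * (x - y)
      = ∫ τ in (0 : ℝ)..1, (deriv f (y + τ * (x - y)) * (x - y) - deriv f y * (x - y)) := by
    rw [hI]
    simp only [one_mul, zero_mul, add_zero, sub_zero, add_sub_cancel]
    ring
  have hb : ‖∫ τ in (0 : ℝ)..1, (deriv f (y + τ * (x - y)) * (x - y) - deriv f y * (x - y))‖
      ≤ ∫ τ in (0 : ℝ)..1, φ * (x - y) ^ 2 * τ := by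
    refine intervalIntegral.norm_integral_le_of_norm_le zero_le_one
      (Filter.Eventually.of_forall fun τ hτ => ?_)
      ((by fun_prop : Continuous fun τ : ℝ => φ * (x - y) ^ 2 * τ).intervalIntegrable _ _)
    have hw : y + τ * (x - y) ∈ s := by
      have := hs hy hx (sub_nonneg.2 hτ.2) hτ.1.le (by ring)
      simp only [smul_eq_mul] at this
      convert this using 1
      ring
    have h1 := hlip _ hw
    rw [← sub_mul, norm_mul, Real.norm_eq_abs, Real.norm_eq_abs]
    rw [add_sub_cancel_left, abs_mul, abs_of_pos hτ.1] at h1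
    calc _ ≤ φ * (τ * |x - y|) * |x - y| := mul_le_mul_of_nonneg_right h1 (abs_nonneg _)
      _ = φ * |x - y| ^ 2 * τ := by ring
      _ = _ := by rw [sq_abs]
  rw [e, ← Real.norm_eq_abs]
  refine hb.trans (le_of_eq ?_)
  rw [intervalIntegral.integral_const_mul, integral_id]
  ring

/-- The estimate of the relative entropy production at almost every time. -/
theorem ae_integral_relProd_le (hε : 0 < ε) (hf : ContDiff ℝ 1 f)
    (hA : Continuous A) (hA1 : ∀ w, 1 ≤ A w) (hu : MemLp u ∞ (volCyl T l r))
    (hux : MemLp ux 2 (volCyl T l r)) (hv : LipschitzWith C v) (hr₁ : MemL1L2 T l r r₁)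
    (hH : ∀ᵐ t ∂(volOm 0 T), ∫ x in Ioo l r, (ux (t, x) - dx v (t, x)) = 0 ∧
      ∀ᵐ x ∂(volOm l r), u (t, x) - v (t, x) = ∫ y in l..x, (ux (t, y) - dx v (t, y)))
    {R : ℝ → ℝ}
    (hP : ∀ᵐ t ∂(volOm 0 T), ∀ g : ℝ → ℝ, MemLp g 2 (volOm l r) → ∫ x in Ioo l r, g x = 0 →
      |(∫ x in Ioo l r, ε * (A (v (t, x)) * dx v (t, x)) * g x)
        + ∫ x in Ioo l r, (dt v (t, x) + deriv f (v (t, x)) * dx v (t, x) - r₁ (t, x))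
          * ∫ y in l..x, g y|
      ≤ ε * R t * √(sqInt (volOm l r) g))
    {I : Set ℝ} {α φ Λ : ℝ}
    (hα : ∀ x ∈ I, ∀ y ∈ I, |A x - A y| ≤ α * |x - y|)
    (hφ : ∀ x ∈ I, ∀ y ∈ I, |f x - f y - deriv f y * (x - y)| ≤ φ / 2 * (x - y) ^ 2)
    (huI : ∀ᵐ p ∂(volCyl T l r), u p ∈ I) (hvI : ∀ᵐ p ∂(volCyl T l r), v p ∈ I)
    (hΛ : ∀ᵐ p ∂(volCyl T l r), |dx v p| ≤ Λ) (hα0 : 0 ≤ α) (hΛ0 : 0 ≤ Λ) :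
    ∀ᵐ t ∂(volOm 0 T), ∫ x in Ioo l r, relProd ε f A u ux v (t, x)
      ≤ -(ε * sqInt (volOm l r) (fun x => ux (t, x) - dx v (t, x)))
        + ε * α * Λ * (√(sqInt (volOm l r) (fun x => u (t, x) - v (t, x)))
          * √(sqInt (volOm l r) (fun x => ux (t, x) - dx v (t, x))))
        + φ / 2 * Λ * sqInt (volOm l r) (fun x => u (t, x) - v (t, x))
        + (eLpNorm (fun x => r₁ (t, x)) 2 (volOm l r)).toReal
          * √(sqInt (volOm l r) (fun x => u (t, x) - v (t, x)))
        + ε * R t * √(sqInt (volOm l r) (fun x => ux (t, x) - dx v (t, x))) := by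
  have hv1 : MemLp v ∞ (volCyl T l r) := memLp_volCyl_of_continuous hv.continuous _
  have hG := integrable_relProd (ε := ε) hf hA hu hux hv
  have hw2 : MemLp (fun p => u p - v p) 2 (volCyl T l r) := (hu.sub hv1).mono_exponent le_top
  have hg2 : MemLp (fun p => ux p - dx v p) 2 (volCyl T l r) := hux.sub (memLp_dx hv 2)
  have hAv : MemLp (fun p => ε * (A (v p) * dx v p)) 2 (volCyl T l r) :=
    ((memLp_dx hv 2).mul' (memLp_top_comp hv1 hA)).const_mul ε
  have hb2 : MemLp (fun p => dt v p + deriv f (v p) * dx v p) 2 (volCyl T l r) :=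
    (memLp_dt hv 2).add ((memLp_dx hv 2).mul'
      (memLp_top_comp hv1 (hf.continuous_deriv le_rfl)))
  filter_upwards [hH, hP, ae_ae_of_ae_volCyl huI, ae_ae_of_ae_volCyl hvI, ae_ae_of_ae_volCyl hΛ,
    ae_integrable_slice hG, ae_memLp_two_slice hw2, ae_memLp_two_slice hg2,
    ae_memLp_two_slice hAv, ae_memLp_two_slice hb2, (ae_memLp_two_of_memL1L2 hr₁).2.1]
    with t h1 h2 h3 h4 h5 h6 h7 h8 h9 h10 h11
  have hX := h2 _ h8 h1.1
  have e0 : ∫ x in Ioo l r, (dt v (t, x) + deriv f (v (t, x)) * dx v (t, x) - r₁ (t, x))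
        * ∫ y in l..x, (ux (t, y) - dx v (t, y))
      = ∫ x in Ioo l r, (dt v (t, x) + deriv f (v (t, x)) * dx v (t, x) - r₁ (t, x))
        * (u (t, x) - v (t, x)) := by
    refine integral_congr_ae ?_
    filter_upwards [h1.2] with x hx
    rw [hx]
  rw [e0] at hX
  have i1 := integrable_mul_of_memLp_two h9 h8
  have i2 : Integrable (fun x => (dt v (t, x) + deriv f (v (t, x)) * dx v (t, x) - r₁ (t, x))
        * (u (t, x) - v (t, x))) (volOm l r) := integrable_mul_of_memLp_two (h10.sub h11) h7
  have j1 := h8.integrable_sq.const_mul ε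
  have n1 : MemLp (fun x => |u (t, x) - v (t, x)|) 2 (volOm l r) := h7.abs
  have n2 : MemLp (fun x => |ux (t, x) - dx v (t, x)|) 2 (volOm l r) := h8.abs
  have n3 : MemLp (fun x => |r₁ (t, x)|) 2 (volOm l r) := h11.abs
  have j2 := (integrable_mul_of_memLp_two n1 n2).const_mul (ε * α * Λ)
  have j3 := h7.integrable_sq.const_mul (φ / 2 * Λ)
  have j4 := integrable_mul_of_memLp_two n3 n1
  -- Adding the perturbed equation tested with `u - v` cancels ∂ₜv. What is left involves only A(u)
  -- - A(v), the first-order Taylor remainder of `f`, and `r₁`, besides the dissipation.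
  have main : (∫ x in Ioo l r, relProd ε f A u ux v (t, x))
      + ((∫ x in Ioo l r, ε * (A (v (t, x)) * dx v (t, x)) * (ux (t, x) - dx v (t, x)))
        + ∫ x in Ioo l r, (dt v (t, x) + deriv f (v (t, x)) * dx v (t, x) - r₁ (t, x))
        * (u (t, x) - v (t, x)))
      ≤ -(∫ x in Ioo l r, ε * (ux (t, x) - dx v (t, x)) ^ 2)
        + (∫ x in Ioo l r, ε * α * Λ * (|u (t, x) - v (t, x)| * |ux (t, x) - dx v (t, x)|))
        + (∫ x in Ioo l r, φ / 2 * Λ * (u (t, x) - v (t, x)) ^ 2)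
        + ∫ x in Ioo l r, |r₁ (t, x)| * |u (t, x) - v (t, x)| := by
    have s1 := (integral_add h6 (i1.add i2)).trans (congrArg₂ _ rfl (integral_add i1 i2))
    have s2 := (integral_add ((j1.neg.add j2).add j3) j4).trans (congrArg₂ _
      ((integral_add (j1.neg.add j2) j3).trans (congrArg₂ _ ((integral_add j1.neg j2).trans
        (congrArg₂ _ (integral_neg _) rfl)) rfl)) rfl)
    refine s1.symm.le.trans (le_trans ?_ s2.le)
    refine integral_mono_ae (h6.add (i1.add i2)) (((j1.neg.add j2).add j3).add j4) ?_
    filter_upwards [h3, h4, h5] with x hx hy hz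
    simp only [Pi.add_apply, Pi.neg_apply, relProd]
    have a1 := hα _ hx _ hy
    have a2 := hφ _ hx _ hy
    set U := u (t, x)
    set V := v (t, x)
    set X := ux (t, x)
    set Y := dx v (t, x)
    have b1 : ε * (X - Y) ^ 2 ≤ ε * (A U * (X - Y) ^ 2) :=
      mul_le_mul_of_nonneg_left (le_mul_of_one_le_left (sq_nonneg _) (hA1 U)) hε.le
    have b2 : -(ε * ((A U - A V) * Y * (X - Y))) ≤ ε * α * Λ * (|U - V| * |X - Y|) := by
      refine (neg_le_abs _).trans ?_
      rw [abs_mul, abs_of_pos hε, abs_mul, abs_mul]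
      calc ε * (|A U - A V| * |Y| * |X - Y|) ≤ ε * (α * |U - V| * Λ * |X - Y|) := by gcongr
        _ = _ := by ring
    have b3 : -(Y * (f U - f V - deriv f V * (U - V))) ≤ φ / 2 * Λ * (U - V) ^ 2 := by
      refine (neg_le_abs _).trans ?_
      rw [abs_mul]
      calc |Y| * |f U - f V - deriv f V * (U - V)| ≤ Λ * (φ / 2 * (U - V) ^ 2) := by gcongr
        _ = _ := by ring
    have b4 : -(r₁ (t, x) * (U - V)) ≤ |r₁ (t, x)| * |U - V| := by
      rw [← abs_mul]; exact neg_le_abs _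
    nlinarith
  have cs1 : (∫ x in Ioo l r, |u (t, x) - v (t, x)| * |ux (t, x) - dx v (t, x)|)
      ≤ √(sqInt (volOm l r) (fun x => u (t, x) - v (t, x)))
        * √(sqInt (volOm l r) (fun x => ux (t, x) - dx v (t, x))) := by
    have := (le_abs_self _).trans (abs_integral_mul_le n1 n2)
    simpa only [sqInt, sq_abs] using this
  have cs2 : (∫ x in Ioo l r, |r₁ (t, x)| * |u (t, x) - v (t, x)|)
      ≤ (eLpNorm (fun x => r₁ (t, x)) 2 (volOm l r)).toReal
        * √(sqInt (volOm l r) (fun x => u (t, x) - v (t, x))) := by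
    have := (le_abs_self _).trans (abs_integral_mul_le n3 n1)
    rw [eLpNorm_two_eq_ofReal_sqrt h11, ENNReal.toReal_ofReal (Real.sqrt_nonneg _)]
    simpa only [sqInt, sq_abs] using this
  rw [integral_const_mul, integral_const_mul, integral_const_mul] at main
  have cs3 := mul_le_mul_of_nonneg_left cs1 (by positivity : 0 ≤ ε * α * Λ)
  -- Only the lower bound on the tested equation is used; it supplies the `R t` term.
  have hX' := (abs_le.1 hX).1
  have q1 : sqInt (volOm l r) (fun x => ux (t, x) - dx v (t, x))
      = ∫ x in Ioo l r, (ux (t, x) - dx v (t, x)) ^ 2 := rfl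
  have q2 : sqInt (volOm l r) (fun x => u (t, x) - v (t, x))
      = ∫ x in Ioo l r, (u (t, x) - v (t, x)) ^ 2 := rfl
  rw [← q1, ← q2] at main
  linarith

end Slice

/-! ### Stability estimate and conversion of the norms. -/

section Stability

variable {T l r ε : ℝ} {f A : ℝ → ℝ} {u₀ v₀ : ℝ → ℝ} {u ux v r₁ : ℝ × ℝ → ℝ} {C : ℝ≥0}

/-- The stability estimate for a comparison function that is Lipschitz on the whole plane. -/
theorem ae_sqInt_sub_le (hT : 0 < T) (hlr : l < r) (hε : 0 < ε) (hf : ContDiff ℝ 1 f)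
    (hA : Continuous A) (hA1 : ∀ w, 1 ≤ A w) (hu₀ : MemLp u₀ 2 (volOm l r))
    (hu : MemL2H1 T l r u ux)
    (hs : IsEntropySolution T l r ε f A quadEntropy (quadFlux f) u₀ u ux)
    (hr₁ : MemL1L2 T l r r₁) {r₂ : ℝ → 𝓓'(Om l r, ℝ)} (hr₂ : MemL2Hm1 T r₂)
    (hv : LipschitzWith C v) (hvs : IsLipschitzPerturbedSolution T l r ε f A r₁ r₂ v₀ v)
    (hb : ∀ᵐ t ∂(volOm 0 T), HasTraces l r (fun x => u (t, x)) (v (t, l)) (v (t, r)))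
    {I : Set ℝ} {α φ Λ : ℝ} (hα0 : 0 ≤ α) (hφ0 : 0 ≤ φ) (hΛ0 : 0 ≤ Λ)
    (hα : ∀ x ∈ I, ∀ y ∈ I, |A x - A y| ≤ α * |x - y|)
    (hφ : ∀ x ∈ I, ∀ y ∈ I, |f x - f y - deriv f y * (x - y)| ≤ φ / 2 * (x - y) ^ 2)
    (huI : ∀ᵐ p ∂(volCyl T l r), u p ∈ I) (hvI : ∀ᵐ p ∂(volCyl T l r), v p ∈ I)
    (hΛ : ∀ᵐ p ∂(volCyl T l r), |dx v p| ≤ Λ) :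
    ∀ᵐ t ∂(volOm 0 T), ∀ᵐ s ∂(volOm 0 t),
      sqInt (volOm l r) (fun x => u (s, x) - v (s, x))
        + 2 * ε * ∫ σ in Ioo 0 t, sqInt (volOm l r) (fun x => ux (σ, x) - dx v (σ, x))
      ≤ (4 * sqInt (volOm l r) (fun x => u₀ x - v (0, x))
          + 16 * (∫ σ in Ioo 0 t, (eLpNorm (fun x => r₁ (σ, x)) 2 (volOm l r)).toReal) ^ 2
          + 8 * ε * ∫ σ in Ioo 0 t, (normHm1 (r₂ σ)).toReal ^ 2)
        * Real.exp (8 * ((ε * Λ * α ^ 2 + φ) * Λ) * t) := by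
  have hub := hs.bounded
  have hv1 : MemLp v ∞ (volCyl T l r) := memLp_volCyl_of_continuous hv.continuous _
  have hw : MemLp (fun p => u p - v p) ∞ (volCyl T l r) := hub.sub hv1
  have hw2 : MemLp (fun p => u p - v p) 2 (volCyl T l r) := hw.mono_exponent le_top
  have hg2 : MemLp (fun p => ux p - dx v p) 2 (volCyl T l r) := hu.2.1.sub (memLp_dx hv 2)
  have hH := ae_slice_sub_mem_H10 hlr hu hv hb
  have hP := ae_perturbed_slice_bound hT hlr hε hf hA hr₁ hr₂ hv hvs
  have hG := integrable_relProd (ε := ε) hf hA hub hu.2.1 hv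
  have hN := integrable_integral_slice hw2.integrable_sq
  -- Boundedness of `u` and `v` makes the squared slice norms essentially bounded in time, so that
  -- their supremum in the energy estimate is finite.
  obtain ⟨M, hM0, hM⟩ := exists_ae_abs_le hw
  have hNB : ∀ᵐ s ∂(volOm 0 T), sqInt (volOm l r) (fun x => u (s, x) - v (s, x))
      ≤ M ^ 2 * (r - l) := by
    filter_upwards [ae_ae_of_ae_volCyl hM] with s hs
    have h1 : ∀ᵐ x ∂(volOm l r), ‖(u (s, x) - v (s, x)) ^ 2‖ ≤ M ^ 2 := by
      filter_upwards [hs] with x hx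
      rw [norm_pow, Real.norm_eq_abs]
      exact pow_le_pow_left₀ (abs_nonneg _) hx 2
    refine (le_abs_self _).trans ((norm_integral_le_of_norm_le_const h1).trans (le_of_eq ?_))
    simp [hlr.le]
  refine energy_estimate hε hΛ0 hφ0 (sqInt_nonneg _)
    (mul_nonneg (sq_nonneg M) (sub_nonneg.2 hlr.le)) (fun _ => sqInt_nonneg _)
    (fun _ => sqInt_nonneg _) (fun _ => ENNReal.toReal_nonneg) hNB hN
    (integrable_integral_slice hg2.integrable_sq) (ae_memLp_two_of_memL1L2 hr₁).1
    (memLp_two_toReal_normHm1 hr₂).integrable_sq (integrable_integral_slice hG)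
    (ae_integral_relProd_le hε hf hA hA1 hub hu.2.1 hv hr₁ hH hP hα hφ huI hvI hΛ hα0 hΛ0) ?_
  refine ae_le_add_integral_of_weak_ineq hT (hN.div_const 2) (integrable_integral_slice hG)
    fun θ hθ => ?_
  have h := rel_entropy_ineq hT hlr hf hA hu₀ hu.2.1 hs hv hH θ hθ
  have i1 : Integrable (fun p => (u p - v p) ^ 2 / 2) (volCyl T l r) :=
    hw2.integrable_sq.div_const 2
  have k1 : Integrable (fun p : ℝ × ℝ => deriv θ p.1 * ((u p - v p) ^ 2 / 2)) (volCyl T l r) :=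
    Integrable.memLp_top_mul i1 (memLp_volCyl_of_continuous
      ((continuous_deriv_testFunction θ).comp continuous_fst) _)
  have k2 : Integrable (fun p : ℝ × ℝ => θ p.1 * relProd ε f A u ux v p) (volCyl T l r) :=
    Integrable.memLp_top_mul hG (memLp_volCyl_of_continuous (θ.continuous.comp continuous_fst) _)
  have e : (∫ p in Ioo 0 T ×ˢ Ioo l r,
        (deriv θ p.1 * ((u p - v p) ^ 2 / 2) + θ p.1 * relProd ε f A u ux v p))
      = ∫ t in Ioo 0 T, (deriv θ t * ((∫ x in Ioo l r, (u (t, x) - v (t, x)) ^ 2) / 2)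
        + θ t * ∫ x in Ioo l r, relProd ε f A u ux v (t, x)) := by
    refine (integral_volCyl (k1.add k2)).trans (integral_congr_ae ?_)
    filter_upwards [ae_integrable_slice k1, ae_integrable_slice k2] with t h1 h2
    refine (integral_add h1 h2).trans ?_
    rw [integral_const_mul, integral_const_mul, integral_div]
  rw [e] at h
  exact h

theorem memLp_volOm_of_continuous {h : ℝ → ℝ} (hh : Continuous h) (p : ℝ≥0∞) :
    MemLp h p (volOm l r) := by
  obtain ⟨M, hM⟩ := (isCompact_Icc (a := l) (b := r)).exists_bound_of_continuousOn hh.continuousOn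
  refine MemLp.of_bound hh.aestronglyMeasurable M ?_
  filter_upwards [ae_restrict_mem measurableSet_Ioo] with x hx
  exact hM x (Ioo_subset_Icc_self hx)

theorem normL2Hm1_sq_eq {r₂ : ℝ → 𝓓'(Om l r, ℝ)} (hr₂ : MemL2Hm1 T r₂) {t : ℝ}
    (ht : t ≤ T) :
    normL2Hm1 t r₂ ^ 2 = ENNReal.ofReal (∫ s in Ioo 0 t, (normHm1 (r₂ s)).toReal ^ 2) := by
  have hm : volOm 0 t ≤ volOm 0 T := Measure.restrict_mono (Ioo_subset_Ioo le_rfl ht) le_rfl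
  rw [ofReal_integral_eq_lintegral_ofReal
    ((memLp_two_toReal_normHm1 hr₂).integrable_sq.mono_measure hm)
    (Filter.Eventually.of_forall fun _ => sq_nonneg _), normL2Hm1, ← ENNReal.rpow_natCast,
    ← ENNReal.rpow_mul]
  norm_num
  refine lintegral_congr_ae ?_
  filter_upwards [ae_mono hm (ae_normHm1_ne_top hr₂)] with s hs
  rw [ENNReal.ofReal_toReal hs]

theorem normL1L2_eq_ofReal (hr₁ : MemL1L2 T l r r₁) {t : ℝ} (ht : t ≤ T) :
    normL1L2 t l r r₁ = ENNReal.ofReal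
      (∫ s in Ioo 0 t, (eLpNorm (fun x => r₁ (s, x)) 2 (volOm l r)).toReal) := by
  have hm : volOm 0 t ≤ volOm 0 T := Measure.restrict_mono (Ioo_subset_Ioo le_rfl ht) le_rfl
  obtain ⟨h1, h2, -⟩ := ae_memLp_two_of_memL1L2 hr₁
  rw [ofReal_integral_eq_lintegral_ofReal (h1.mono_measure hm)
    (Filter.Eventually.of_forall fun _ => ENNReal.toReal_nonneg)]
  refine lintegral_congr_ae ?_
  filter_upwards [ae_mono hm h2] with s hs
  rw [ENNReal.ofReal_toReal hs.2.ne]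

theorem eLpNorm_two_sq_volCyl {g : ℝ × ℝ → ℝ} (hg : MemLp g 2 (volCyl T l r)) {t : ℝ}
    (ht : t ≤ T) :
    eLpNorm g 2 (volCyl t l r) ^ 2
      = ENNReal.ofReal (∫ s in Ioo 0 t, sqInt (volOm l r) (fun x => g (s, x))) := by
  have hg' : MemLp g 2 (volCyl t l r) := hg.mono_measure
    (Measure.restrict_mono (prod_mono (Ioo_subset_Ioo le_rfl ht) le_rfl) le_rfl)
  rw [eLpNorm_two_sq_eq hg', sqInt, integral_volCyl hg'.integrable_sq]
  rfl

theorem normLinfL2_sq_le {w : ℝ × ℝ → ℝ} (hw : MemLp w 2 (volCyl T l r)) {t c : ℝ} (ht : t ≤ T)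
    (hc : 0 ≤ c) (h : ∀ᵐ s ∂(volOm 0 t), sqInt (volOm l r) (fun x => w (s, x)) ≤ c) :
    normLinfL2 t l r w ^ 2 ≤ ENNReal.ofReal c := by
  have hm : volOm 0 t ≤ volOm 0 T := Measure.restrict_mono (Ioo_subset_Ioo le_rfl ht) le_rfl
  have h1 : normLinfL2 t l r w ≤ ENNReal.ofReal (√c) := by
    refine essSup_le_of_ae_le _ ?_
    filter_upwards [h, ae_mono hm (ae_memLp_two_slice hw)] with s hs h2
    rw [eLpNorm_two_eq_ofReal_sqrt h2]
    exact ENNReal.ofReal_le_ofReal (Real.sqrt_le_sqrt hs)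
  calc _ ≤ ENNReal.ofReal (√c) ^ 2 := by gcongr
    _ = _ := by rw [← ENNReal.ofReal_pow (Real.sqrt_nonneg _), Real.sq_sqrt hc]

/-- For real-valued functions the essential bounds are meaningful only under essential boundedness,
which membership in L^∞ provides. -/
theorem ae_mem_Icc_of_essInf_essSup {β : Type*} [MeasurableSpace β] {μ : Measure β} {h : β → ℝ}
    (hh : MemLp h ∞ μ) {a b : ℝ} (ha : a ≤ essInf h μ) (hb : essSup h μ ≤ b) :
    ∀ᵐ p ∂μ, h p ∈ Icc a b := by
  obtain ⟨M, -, hM⟩ := exists_ae_abs_le hh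
  have h1 : Filter.IsBoundedUnder (· ≥ ·) (ae μ) h :=
    Filter.isBoundedUnder_of_eventually_ge (a := -M) (hM.mono fun x hx => (abs_le.1 hx).1)
  have h2 : Filter.IsBoundedUnder (· ≤ ·) (ae μ) h :=
    Filter.isBoundedUnder_of_eventually_le (a := M) (hM.mono fun x hx => (abs_le.1 hx).2)
  filter_upwards [ae_essInf_le h1, ae_le_essSup h2] with p hp hq
  exact ⟨ha.trans hp, hq.trans hb⟩

theorem dx_congr_of_eqOn {w : ℝ × ℝ → ℝ} (h : EqOn w v (Icc 0 T ×ˢ Icc l r)) :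
    EqOn (dx w) (dx v) (Ioo 0 T ×ˢ Ioo l r) := fun p hp => by
  refine Filter.EventuallyEq.deriv_eq ?_
  filter_upwards [isOpen_Ioo.mem_nhds hp.2] with y hy
  exact h ⟨Ioo_subset_Icc_self hp.1, Ioo_subset_Icc_self hy⟩

end Stability

end ConvDiff

end

/-! ### Proof of the main theorem. -/

theorem mainTheorem1 (T l r ε : ℝ) (hT : 0 < T) (hlr : l < r) (hε : 0 < ε)
    (f A : ℝ → ℝ) (hf : ContDiff ℝ 2 f) (hA : ContDiff ℝ 2 A) (hA1 : ∀ v, 1 ≤ A v)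
    -- Dirichlet data on `(0, T) × ∂Ω`
    (gD : ℝ × ℝ → ℝ) (hgD : ∃ C : ℝ≥0, LipschitzOnWith C gD (Ioo 0 T ×ˢ {l, r}))
    -- the entropy solution `u`, with `ux = ∂ₓ u`
    (u₀ : ℝ → ℝ) (hu₀ : ConvDiff.MemH1 l r u₀)
    (u ux : ℝ × ℝ → ℝ) (hu : ConvDiff.MemL2H1 T l r u ux)
    (hu_ent : ConvDiff.IsEntropySolution T l r ε f A ConvDiff.quadEntropy (ConvDiff.quadFlux f)
      u₀ u ux)
    (hu_bdry : ∀ᵐ t ∂(volume.restrict (Ioo 0 T)),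
      ConvDiff.HasTraces l r (fun x => u (t, x)) (gD (t, l)) (gD (t, r)))
    -- the residual `r₁ + ε r₂`
    (r₁ : ℝ × ℝ → ℝ) (hr₁ : ConvDiff.MemL1L2 T l r r₁)
    (r₂ : ℝ → 𝓓'(ConvDiff.Om l r, ℝ)) (hr₂ : ConvDiff.MemL2Hm1 T r₂)
    -- the Lipschitz solution `û` of the perturbed problem
    (uh₀ : ℝ → ℝ) (uh : ℝ × ℝ → ℝ)
    (huh : ConvDiff.IsLipschitzPerturbedSolution T l r ε f A r₁ r₂ uh₀ uh)
    (huh_bdry : ∀ t ∈ Ioo 0 T, uh (t, l) = gD (t, l) ∧ uh (t, r) = gD (t, r)) :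
    ∀ a b : ℝ,
      a ≤ min (essInf u (ConvDiff.volCyl T l r)) (essInf uh (ConvDiff.volCyl T l r)) →
      max (essSup u (ConvDiff.volCyl T l r)) (essSup uh (ConvDiff.volCyl T l r)) ≤ b →
      ∀ᵐ t ∂(volume.restrict (Ioo 0 T)),
        ConvDiff.normLinfL2 t l r (fun p => u p - uh p) ^ 2
          + ENNReal.ofReal (2 * ε)
            * eLpNorm (fun p => ux p - ConvDiff.dx uh p) 2 (ConvDiff.volCyl t l r) ^ 2
        ≤ (4 * eLpNorm (fun x => u₀ x - uh₀ x) 2 (ConvDiff.volOm l r) ^ 2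
            + 16 * ConvDiff.normL1L2 t l r r₁ ^ 2
            + ENNReal.ofReal (8 * ε) * ConvDiff.normL2Hm1 t r₂ ^ 2)
          * ENNReal.ofReal
              (Real.exp (8 * ConvDiff.stabConst T l r ε f A a b uh * t)) := by
  open ConvDiff in
  intro a b ha hb
  obtain ⟨C, hC⟩ := huh.lipschitz
  -- A Lipschitz extension to the plane makes mollification and global slices available. On the open
  -- cylinder it has the same values and the same spatial derivative.
  obtain ⟨v, hv, huv⟩ := hC.extend_real
  have hdx := dx_congr_of_eqOn huv
  have hms : MeasurableSet (Ioo 0 T ×ˢ Ioo l r) := measurableSet_Ioo.prod measurableSet_Ioo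
  have hsub : Ioo 0 T ×ˢ Ioo l r ⊆ Icc 0 T ×ˢ Icc l r :=
    prod_mono Ioo_subset_Icc_self Ioo_subset_Icc_self
  have hlm : l ∈ Icc l r := left_mem_Icc.2 hlr.le
  have hrm : r ∈ Icc l r := right_mem_Icc.2 hlr.le
  have huv_ae : uh =ᵐ[volCyl T l r] v := by
    filter_upwards [ae_restrict_mem hms] with p hp using huv (hsub hp)
  have hdx_ae : dx uh =ᵐ[volCyl T l r] dx v := by
    filter_upwards [ae_restrict_mem hms] with p hp using hdx hp
  have hvs : IsLipschitzPerturbedSolution T l r ε f A r₁ r₂ uh₀ v := by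
    refine ⟨⟨C, hv.lipschitzOnWith⟩, fun x hx => ?_, fun φ => ?_⟩
    · rw [← huv ⟨left_mem_Icc.2 hT.le, hx⟩, huh.initial x hx]
    · have e : ∫ p in Ioo 0 T ×ˢ Ioo l r,
            dt φ p * v p + dx φ p * (f (v p) - ε * (A (v p) * dx v p)) + r₁ p * φ p
          = ∫ p in Ioo 0 T ×ˢ Ioo l r,
            dt φ p * uh p + dx φ p * (f (uh p) - ε * (A (uh p) * dx uh p)) + r₁ p * φ p :=
        setIntegral_congr_fun hms fun p hp => by simp only [hdx hp, huv (hsub hp)]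
      rw [e]
      exact huh.weak_eq φ
  have htr : ∀ᵐ t ∂(volOm 0 T), HasTraces l r (fun x => u (t, x)) (v (t, l)) (v (t, r)) := by
    filter_upwards [hu_bdry, ae_restrict_mem measurableSet_Ioo] with t h1 ht
    rwa [← huv ⟨Ioo_subset_Icc_self ht, hlm⟩, ← huv ⟨Ioo_subset_Icc_self ht, hrm⟩,
      (huh_bdry t ht).1, (huh_bdry t ht).2]
  have hv1 : MemLp v ∞ (volCyl T l r) := memLp_volCyl_of_continuous hv.continuous _
  have huI := ae_mem_Icc_of_essInf_essSup hu_ent.bounded (ha.trans (min_le_left _ _))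
    ((le_max_left _ _).trans hb)
  have hvI : ∀ᵐ p ∂(volCyl T l r), v p ∈ Icc a b := by
    refine ae_mem_Icc_of_essInf_essSup hv1 ?_ ?_
    · rw [← essInf_congr_ae huv_ae]; exact ha.trans (min_le_right _ _)
    · rw [← essSup_congr_ae huv_ae]; exact (le_max_right _ _).trans hb
  have hA' : ContDiff ℝ 1 (deriv A) := ((contDiff_succ_iff_deriv (𝕜 := ℝ) (n := 1)).1 hA).2.2
  have hf' : ContDiff ℝ 1 (deriv f) := ((contDiff_succ_iff_deriv (n := 1)).1 hf).2.2
  set S := sSup ((fun w => |deriv A w| ^ 2) '' Icc a b) with hS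
  set φ := sSup ((fun w => |deriv (deriv f) w|) '' Icc a b) with hφ
  set Λ := (eLpNorm (dx uh) ∞ (volCyl T l r)).toReal with hΛ
  have hS0 : 0 ≤ S := Real.sSup_nonneg fun y ⟨w, _, hw⟩ => hw ▸ sq_nonneg _
  have hφ0 : 0 ≤ φ := Real.sSup_nonneg fun y ⟨w, _, hw⟩ => hw ▸ abs_nonneg _
  -- The constant involves the supremum of |A'|², so `√S` serves as Lipschitz constant of `A` and
  -- its square returns `S`.
  have hSb : ∀ w ∈ Icc a b, |deriv A w| ≤ √S := fun w hw => by
    refine Real.le_sqrt_of_sq_le (le_csSup (isCompact_Icc.bddAbove_image ?_)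
      (mem_image_of_mem _ hw))
    exact (hA'.continuous.abs.pow 2).continuousOn
  have hφb : ∀ w ∈ Icc a b, |deriv (deriv f) w| ≤ φ := fun w hw =>
    le_csSup (isCompact_Icc.bddAbove_image
      (hf'.continuous_deriv le_rfl).abs.continuousOn) (mem_image_of_mem _ hw)
  have hΛb : ∀ᵐ p ∂(volCyl T l r), |dx v p| ≤ Λ := by
    rw [hΛ, eLpNorm_congr_ae hdx_ae]
    exact ae_abs_le_toReal_eLpNorm_top (memLp_dx hv ∞)
  have key := ae_sqInt_sub_le hT hlr hε (hf.of_le (by norm_num)) hA.continuous hA1 hu₀.1 hu hu_ent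
    hr₁ hr₂ hv hvs htr (Real.sqrt_nonneg S) hφ0 ENNReal.toReal_nonneg
    (fun x hx y hy => (convex_Icc a b).norm_image_sub_le_of_norm_deriv_le (𝕜 := ℝ) (f := A)
      (fun z _ => hA.differentiable (by norm_num) z) hSb hy hx)
    (fun x hx y hy => abs_sub_sub_deriv_mul_le hf (convex_Icc a b) hφb hx hy) huI hvI hΛb
  have hw2 : MemLp (fun p => u p - uh p) 2 (volCyl T l r) :=
    ((hu_ent.bounded.sub hv1).mono_exponent le_top).ae_eq
      (by filter_upwards [huv_ae] with p hp; simp [hp])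
  have hg2 : MemLp (fun p => ux p - dx uh p) 2 (volCyl T l r) :=
    (hu.2.1.sub (memLp_dx hv 2)).ae_eq (by filter_upwards [hdx_ae] with p hp; simp [hp])
  have hE : eLpNorm (fun x => u₀ x - uh₀ x) 2 (volOm l r) ^ 2
      = ENNReal.ofReal (sqInt (volOm l r) (fun x => u₀ x - v (0, x))) := by
    have hvm : MemLp (fun x => v (0, x)) 2 (volOm l r) :=
      memLp_volOm_of_continuous (hv.continuous.comp (Continuous.prodMk_right 0)) 2
    refine Eq.trans ?_ (eLpNorm_two_sq_eq (hu₀.1.sub hvm))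
    congr 1
    refine eLpNorm_congr_ae ?_
    filter_upwards [ae_restrict_mem measurableSet_Ioo] with x hx
    simp only [hvs.initial x (Ioo_subset_Icc_self hx)]
  filter_upwards [key, ae_restrict_mem measurableSet_Ioo] with t ht htm
  have hN : ∀ s ∈ Ioo 0 t, sqInt (volOm l r) (fun x => u (s, x) - v (s, x))
      = sqInt (volOm l r) (fun x => u (s, x) - uh (s, x)) := fun s hs =>
    setIntegral_congr_fun measurableSet_Ioo fun x hx => by
      simp only [huv (hsub (⟨⟨hs.1, hs.2.trans htm.2⟩, hx⟩ : (s, x) ∈ Ioo 0 T ×ˢ Ioo l r))]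
  have hD : ∫ s in Ioo 0 t, sqInt (volOm l r) (fun x => ux (s, x) - dx v (s, x))
      = ∫ s in Ioo 0 t, sqInt (volOm l r) (fun x => ux (s, x) - dx uh (s, x)) :=
    setIntegral_congr_fun measurableSet_Ioo fun s hs =>
      setIntegral_congr_fun measurableSet_Ioo fun x hx => by
        simp only [hdx (⟨⟨hs.1, hs.2.trans htm.2⟩, hx⟩ : (s, x) ∈ Ioo 0 T ×ˢ Ioo l r)]
  rw [hD, Real.sq_sqrt hS0] at ht
  set D := ∫ s in Ioo 0 t, sqInt (volOm l r) (fun x => ux (s, x) - dx uh (s, x)) with hDdef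
  have hD0 : 0 ≤ D := integral_nonneg fun _ => sqInt_nonneg _
  set E := sqInt (volOm l r) (fun x => u₀ x - v (0, x)) with hEdef
  have hE0 : 0 ≤ E := sqInt_nonneg _
  set ρ := ∫ σ in Ioo 0 t, (eLpNorm (fun x => r₁ (σ, x)) 2 (volOm l r)).toReal with hρdef
  have hρ0 : 0 ≤ ρ := integral_nonneg fun _ => ENNReal.toReal_nonneg
  set R := ∫ σ in Ioo 0 t, (normHm1 (r₂ σ)).toReal ^ 2 with hRdef
  have hR0 : 0 ≤ R := integral_nonneg fun _ => sq_nonneg _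
  have hK : (ε * Λ * S + φ) * Λ = stabConst T l r ε f A a b uh := rfl
  rw [hK] at ht
  set X := (4 * E + 16 * ρ ^ 2 + 8 * ε * R) * Real.exp (8 * stabConst T l r ε f A a b uh * t)
    with hX
  -- Since `(0, t)` has positive measure, some time satisfies the estimate, which yields `0 ≤ X - 2
  -- * ε * D`; this sign is needed to move the dissipation to the other side in `ℝ≥0∞`.
  have hne : (ae (volOm 0 t)).NeBot := by
    rw [ae_neBot, Ne, Measure.restrict_eq_zero, Real.volume_Ioo]
    simpa using htm.1
  have hc : ∀ᵐ s ∂(volOm 0 t), sqInt (volOm l r) (fun x => u (s, x) - uh (s, x))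
      ≤ X - 2 * ε * D := by
    filter_upwards [ht, ae_restrict_mem measurableSet_Ioo] with s hs hsm
    rw [hN s hsm] at hs
    linarith
  have hc0 : 0 ≤ X - 2 * ε * D := by
    obtain ⟨s, hs⟩ := hc.exists
    exact (sqInt_nonneg _).trans hs
  have h1 := normLinfL2_sq_le hw2 htm.2.le hc0 hc
  rw [eLpNorm_two_sq_volCyl hg2 htm.2.le, hE, normL1L2_eq_ofReal hr₁ htm.2.le,
    normL2Hm1_sq_eq hr₂ htm.2.le]
  have e4 : (4 : ℝ≥0∞) = ENNReal.ofReal 4 := by norm_num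
  have e16 : (16 : ℝ≥0∞) = ENNReal.ofReal 16 := by norm_num
  rw [e4, e16, ← ENNReal.ofReal_pow hρ0, ← ENNReal.ofReal_mul (by positivity),
    ← ENNReal.ofReal_mul (by positivity), ← ENNReal.ofReal_mul (by positivity),
    ← ENNReal.ofReal_mul (by positivity), ← ENNReal.ofReal_add (by positivity) (by positivity),
    ← ENNReal.ofReal_add (by positivity) (by positivity), ← ENNReal.ofReal_mul (by positivity),
    ← hX]
  calc _ ≤ ENNReal.ofReal (X - 2 * ε * D) + ENNReal.ofReal (2 * ε * D) := by gcongr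
    _ = ENNReal.ofReal X := by
      rw [← ENNReal.ofReal_add hc0 (by positivity), sub_add_cancel]
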